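/- Let $d,n_{\rm priv},B$ be positive integers with $B\le n_{\rm priv}$, let $\mu,L,\mathcal L_0>0$ and $\xi\ge 0$, let $l(z,\mathbf w)$ be a per-sample loss, differentiable in $\mathbf w\in\mathbb R^d$, with $\nabla l(z,\mathbf w)$ jointly measurable, and let $\nu$ be a probability distribution (of the public samples). For $T\ge1$ put $$\sigma_T^2=\frac1{\ln\!\big(\frac{n_{\rm priv}^2\mu^2}{TB^2}+1\big)},\qquad \eta_{\rm pub}=\frac1{BL\sqrt T},\qquad \eta_{\rm priv}=\frac1B\sqrt{\frac{2\mathcal L_0}{LT(1+\sigma_T^2d/B^2)}} .$$ Mixed training with $T$ iterations starts at a fixed $\mathbf w_0$ and, for $0\le t<T$, sets $$\mathbf w_{t+1}=\mathbf w_t-\Big[\eta_{\rm pub}\sum_{j=1}^{B}\mathbf g_{t,j}+\eta_{\rm priv}\Big(\sum_{i}\frac{\mathbf g_{t,i}}{\|\mathbf g_{t,i}\|+1}+\sigma_T\mathbf Z_t\Big)\Big],\qquad \mathbf Z_t\sim\mathcal N(0,\mathbf I_d),$$ where $\mathbf g_{t,j}$ are the gradients at $\mathbf w_t$ of $B$ i.i.d.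 public samples from $\nu$, the index $i$ runs over the private batch, $\mathbf g_{t,i}$ are the private per-sample gradients at $\mathbf w_t$, and all sampling and noise is independent over sources and iterations. The private batch is either (P) a Poisson subsample of a private dataset $S$, in which each record is included independently with probability $B/n_{\rm priv}$, or (I) a batch of $B$ i.i.d. samples from a distribution $\rho$. Then: 1. (Accounting.) $\sigma_T>0$ and $\mu=\frac{B}{n_{\rm priv}}\sqrt{T(e^{1/\sigma_T^2}-1)}$ for every $T\ge 1$. 2. (Privacy.) The algorithm with sampling (P) that releases all iterates $M_T(S)=(\mathbf w_0,\dots,\mathbf w_T)$ is asymptotically $\mu$-GDP as $T\to\infty$: for every $\varepsilon>0$ there is $T_0$ such that for all $T\ge T_0$, all private datasets $S,S'$ one of which arises from the other by discarding one record, and all $\alpha\in[0,1]$, $$\mathcal T\big(M_T(S),M_T(S')\big)(\alpha)\ \ge\ G_\mu(\alpha)-\varepsilon .$$ Here $\mathcal T(P,Q)(\alpha)$ is the smallest type II error of a (randomized) test of $P$ against $Q$ with type I error at most $\alpha$, and $G_\mu=\mathcal T(\mathcal N(0,1),\mathcal N(\mu,1))$. 3. (Rate function.) For $\sigma,x\ge0$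 let $$f(x;\sigma)=\sup_{r>1}f_r(x;\sigma),\qquad f_r(x;\sigma)=\frac{x^2}{2L}+\sqrt{\frac{\mathcal L_0}{2L(1+\sigma^2d/B^2)}}\Big(\frac1{(r-1)x+1}-\frac1{(r+1)x+1}\Big)\Big(x-\frac{\xi}{r}\Big).$$ Then $f(x;\sigma)>0$ for $x>0$; $f(\cdot;\sigma)$ is a strictly increasing bijection of $[0,\infty)$ onto itself; and for $x>0$, $f(x;\sigma)$ is strictly decreasing in $\sigma\ge0$. Write $f^{-1}(\cdot;\sigma)$ for the inverse of $f(\cdot;\sigma)$. 4. (Convergence.) Let $\mathcal L:\mathbb R^d\to[0,\infty)$ be differentiable with $\mathcal L(\mathbf w_0)=\mathcal L_0$ and $\mathcal L(\mathbf v)-[\mathcal L(\mathbf w)+\nabla\mathcal L(\mathbf w)^\top(\mathbf v-\mathbf w)]\le\frac L2\|\mathbf w-\mathbf v\|^2$ for all $\mathbf w,\mathbf v$. Say that a distribution of samples $z$ satisfies the noise assumption if, for every $\mathbf w$, the gradient noise $\nabla l(z,\mathbf w)-\nabla\mathcal L(\mathbf w)$ has a symmetric law with mean $0$ and second moment $\mathbb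 E\|\cdot\|^2\le\xi^2$. Suppose that $\nu$ satisfies it, and that so does the uniform distribution on the $n_{\rm priv}$ records of $S$ in case (P), respectively $\rho$ in case (I). Then, with $\mathbf g_t=\nabla\mathcal L(\mathbf w_t)$, the iterates of mixed training satisfy, as $T\to\infty$, $$\min_{0\le t\le T}\mathbb P\Big(\|\mathbf g_t\|>f^{-1}\Big(\frac{2\mathcal L_0+\frac{\xi^2}{2BL}}{c\sqrt T};\,\sigma_T\Big)\Big)\ \lesssim\ c ,$$ i.e. for every $\varepsilon>0$ there is $T_0$ such that for all $T\ge T_0$ and all $c>0$ the left-hand side is at most $(1+\varepsilon)c$. -/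

import Mathlib

open MeasureTheory ProbabilityTheory Filter Topology

noncomputable section

namespace MixedTraining

/-! ### Trade-off functions and Gaussian differential privacy -/

section Privacy

/-- The trade-off function of the testing problem `P` against `Q`: the smallest type II error of a
randomized test (rejection rule) `φ` whose type I error is at most `α`. -/
def tradeoff {Y : Type*} [MeasurableSpace Y] (P Q : Measure Y) (α : ℝ) : ℝ :=
  sInf {β : ℝ | ∃ φ : Y → ℝ, Measurable φ ∧ (∀ y, 0 ≤ φ y ∧ φ y ≤ 1) ∧
    ∫ y, φ y ∂P ≤ α ∧ β = 1 - ∫ y, φ y ∂Q}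

/-- The Gaussian trade-off function `G_μ`, that of `N(0, 1)` against `N(μ, 1)`. -/
def gaussianTradeoff (μ α : ℝ) : ℝ :=
  tradeoff (gaussianReal 0 1) (gaussianReal μ 1) α

/-- A finite dataset: its size together with its records. -/
abbrev Dataset (𝒟 : Type*) := Σ m : ℕ, Fin m → 𝒟

/-- `S'` arises from `S` by discarding one record. -/
def OneRemoved {𝒟 : Type*} (S S' : Dataset 𝒟) : Prop :=
  ∃ (m : ℕ) (s : Fin (m + 1) → 𝒟) (i : Fin (m + 1)),
    S = ⟨m + 1, s⟩ ∧ S' = ⟨m, fun j => s (i.succAbove j)⟩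

/-- Neighbouring datasets: one has exactly one record more than the other. -/
def Neighbours {𝒟 : Type*} (S S' : Dataset 𝒟) : Prop :=
  OneRemoved S S' ∨ OneRemoved S' S

/-- The mechanisms `M T` (given by the law of their output) satisfy `μ`-GDP asymptotically as
`T → ∞`: up to an error that tends to zero uniformly over all neighbouring datasets and all levels
`α`, the trade-off function of `M T S` against `M T S'` is at least `G_μ`. -/
def AsymptoticallyGDP {𝒟 : Type*} {Y : ℕ → Type*} [∀ T, MeasurableSpace (Y T)]
    (M : (T : ℕ) → Dataset 𝒟 → Measure (Y T)) (μ : ℝ) : Prop :=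
  ∀ ε : ℝ, 0 < ε → ∀ᶠ T in atTop, ∀ S S' : Dataset 𝒟, Neighbours S S' →
    ∀ α ∈ Set.Icc (0 : ℝ) 1, gaussianTradeoff μ α - ε ≤ tradeoff (M T S) (M T S') α

end Privacy

/-! ### The mixed training algorithm -/

section Algorithm

/-- The parameter space `ℝ^d` with its Euclidean norm. -/
abbrev Param (d : ℕ) := EuclideanSpace ℝ (Fin d)

variable {𝒟 : Type*} [MeasurableSpace 𝒟] {d : ℕ}

/-- Automatic clipping with threshold `R = 1`: `v / (‖v‖ + 1)`. -/
def clip (v : Param d) : Param d := (1 / (‖v‖ + 1)) • v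

/-- Law of the public gradient `∑_{j < B} ∇l(z_j, w)`, with `z_j` i.i.d. from `ν`. -/
def publicGradient (B : ℕ) (ν : Measure 𝒟) (l : 𝒟 → Param d → ℝ) (w : Param d) :
    Measure (Param d) :=
  (Measure.pi fun _ : Fin B => ν).map fun z => ∑ j, gradient (l (z j)) w

/-- Law of the sum of clipped per-sample gradients over `B` i.i.d. samples from `ν`. -/
def clippedGradientIID (B : ℕ) (ν : Measure 𝒟) (l : 𝒟 → Param d → ℝ) (w : Param d) :
    Measure (Param d) :=
  (Measure.pi fun _ : Fin B => ν).map fun z => ∑ i, clip (gradient (l (z i)) w)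

/-- Law of the sum of clipped per-sample gradients over a Poisson subsample of the dataset `S`:
every record is included independently with probability `p`. -/
def clippedGradientPoisson (p : unitInterval) (S : Dataset 𝒟) (l : 𝒟 → Param d → ℝ)
    (w : Param d) : Measure (Param d) :=
  (Measure.pi fun _ : Fin S.1 => bernoulliMeasure true false p).map
    fun b => ∑ i, if b i = true then clip (gradient (l (S.2 i)) w) else 0

/-- Law of the next iterate
`w - [η_pub * (public gradient) + η_priv * (clipped private gradient + σ Z)]`,
where `Z` is standard Gaussian and the three sources of randomness are independent. -/
def stepLaw (ηpub ηpriv σ : ℝ) (pub priv : Param d → Measure (Param d)) (w : Param d) :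
    Measure (Param d) :=
  ((pub w).prod ((priv w).prod (stdGaussian (Param d)))).map
    fun x => w - (ηpub • x.1 + ηpriv • (x.2.1 + σ • x.2.2))

/-- Joint law of the iterates `w_0, …, w_T` of the Markov chain with transition law `step`. -/
def trajectoryLaw (step : Param d → Measure (Param d)) (w₀ : Param d) :
    (T : ℕ) → Measure (Fin (T + 1) → Param d)
  | 0 => Measure.dirac fun _ => w₀
  | T + 1 => (trajectoryLaw step w₀ T).bind fun h =>
      (step (h (Fin.last T))).map fun w => Fin.snoc (α := fun _ => Param d) h w

/-- `σ_T` with `σ_T² = 1 / ln(n² μ² / (T B²) + 1)`. -/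
def noiseMultiplier (n B : ℕ) (μ : ℝ) (T : ℕ) : ℝ :=
  √(1 / Real.log ((n : ℝ) ^ 2 * μ ^ 2 / (T * (B : ℝ) ^ 2) + 1))

/-- `η_pub = 1 / (B L √T)`. -/
def publicRate (B : ℕ) (L : ℝ) (T : ℕ) : ℝ := 1 / (B * L * √T)

/-- `η_priv = √(2 L₀ / (L T (1 + σ² d / B²))) / B`. -/
def privateRate (d B : ℕ) (L L₀ σ : ℝ) (T : ℕ) : ℝ :=
  √(2 * L₀ / (L * T * (1 + σ ^ 2 * d / (B : ℝ) ^ 2))) / B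

/-- The Poisson sampling rate `B / n`. -/
def samplingRate (B n : ℕ) (h : B ≤ n) : unitInterval :=
  ⟨(B : ℝ) / n, by positivity, div_le_one_of_le₀ (by exact_mod_cast h) (by positivity)⟩

/-- Law of the `T + 1` iterates of mixed training with private batch law `priv`, the learning rates
above and noise multiplier `σ_T`. -/
def mixedTraining (n B : ℕ) (μ L L₀ : ℝ) (ν : Measure 𝒟) (l : 𝒟 → Param d → ℝ)
    (priv : Param d → Measure (Param d)) (w₀ : Param d) (T : ℕ) :
    Measure (Fin (T + 1) → Param d) :=
  trajectoryLaw
    (stepLaw (publicRate B L T) (privateRate d B L L₀ (noiseMultiplier n B μ T) T)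
      (noiseMultiplier n B μ T) (publicGradient B ν l) priv) w₀ T

end Algorithm

/-! ### Assumptions and the convergence bound -/

section Convergence

variable {𝒟 : Type*} [MeasurableSpace 𝒟] {d : ℕ}

/-- Smoothness: the loss is differentiable and lies below its quadratic upper models. -/
def SmoothLoss (loss : Param d → ℝ) (L : ℝ) : Prop :=
  Differentiable ℝ loss ∧ ∀ w v : Param d,
    loss v - (loss w + inner ℝ (gradient loss w) (v - w)) ≤ L / 2 * ‖w - v‖ ^ 2

/-- Gradient noise: for a sample `z` from `ν`, the noise `∇l(z, w) - ∇loss(w)` has, at every `w`, a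
symmetric law with mean zero and second moment at most `ξ²`. -/
structure GradientNoise (ν : Measure 𝒟) (l : 𝒟 → Param d → ℝ) (loss : Param d → ℝ) (ξ : ℝ) :
    Prop where
  symmetric : ∀ w, ν.map (fun z => -(gradient (l z) w - gradient loss w)) =
    ν.map (fun z => gradient (l z) w - gradient loss w)
  memLp : ∀ w, MemLp (fun z => gradient (l z) w - gradient loss w) 2 ν
  mean : ∀ w, ∫ z, (gradient (l z) w - gradient loss w) ∂ν = 0
  second_moment : ∀ w, ∫ z, ‖gradient (l z) w - gradient loss w‖ ^ 2 ∂ν ≤ ξ ^ 2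

/-- The law of a uniformly drawn record of a dataset with `n` records. -/
def empiricalLaw {n : ℕ} (s : Fin n → 𝒟) : Measure 𝒟 :=
  (n : ENNReal)⁻¹ • ∑ i, Measure.dirac (s i)

/-- `f_r(x; σ, ξ, d, B, L₀, L)` for a fixed `r`. -/
def fr (r : ℝ) (d B : ℕ) (ξ L L₀ σ x : ℝ) : ℝ :=
  1 / (2 * L) * x ^ 2 + √(L₀ / (2 * L * (1 + σ ^ 2 * d / (B : ℝ) ^ 2))) *
    (1 / ((r - 1) * x + 1) - 1 / ((r + 1) * x + 1)) * (x - ξ / r)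

/-- The rate function: `f_r` with the best choice of `r > 1` at each `x`. -/
def rateFun (d B : ℕ) (ξ L L₀ σ x : ℝ) : ℝ :=
  ⨆ r : Set.Ioi (1 : ℝ), fr (r : ℝ) d B ξ L L₀ σ x

/-- The inverse of the rate function on `[0, ∞)`. -/
def rateInv (d B : ℕ) (ξ L L₀ σ y : ℝ) : ℝ :=
  Function.invFunOn (rateFun d B ξ L L₀ σ) (Set.Ici 0) y

/-- The asymptotic bound
`min_{0 ≤ t ≤ T} P(‖g_t‖ > f⁻¹((2 L₀ + ξ² / (2 B L)) / (c √T); σ_T)) ≲ c` for every `c > 0`,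
i.e. at most `(1 + o(1)) c` as `T → ∞`; here `law T` is the joint law of `w_0, …, w_T`, and
`g_t = ∇loss(w_t)`. -/
def GradientNormBound (d B : ℕ) (ξ L L₀ : ℝ) (σ : ℕ → ℝ) (loss : Param d → ℝ)
    (law : (T : ℕ) → Measure (Fin (T + 1) → Param d)) : Prop :=
  ∀ ε : ℝ, 0 < ε → ∀ᶠ T : ℕ in atTop, ∀ c : ℝ, 0 < c →
    (⨅ t : Fin (T + 1), (law T).real {h | rateInv d B ξ L L₀ (σ T)
      ((2 * L₀ + ξ ^ 2 / (2 * B * L)) / (c * √T)) < ‖gradient loss (h t)‖}) ≤ (1 + ε) * c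

end Convergence

end MixedTraining

end

open MeasureTheory ProbabilityTheory Filter Topology

noncomputable section

namespace MixedTraining

/-! ### The noise multiplier -/

/-! Privacy. Let `v w` be the clipped gradient of the record that is discarded; its norm is at most
1. The Gaussian noise splits as `y • v w + residual` with a scalar y ~ N(0, 1) independent of the
residual, so adding `v w` to the private gradient amounts to moving the mean of y from 0 to θ =
1/σ_T (`stdGaussian_eq_map_residual`, `bind_drivenStep`). Poisson sampling adds `v w` with
probability p = B/n. Hence both algorithms are the same chain of randomized maps, driven at each
step by N(0, 1) without the record and by p N(θ, 1) + (1 - p) N(0, 1) with it.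

Three facts then suffice, and no central limit theorem is needed. The mixture is within chi-square
distance θ⁴ of N(pθ, 1), because the means agree (`chiSqLE_gaussianMix_mean`); these bounds multiply
along the chain, and (1 + θ⁴)^T - 1 = O(1/T), so the mixture may be replaced at a vanishing cost in
total variation. A chain driven T times by N(pθ, 1) is post-processing of a single N(√T pθ, 1)
(`exists_kernel_trajectoryLaw`). Finally √T pθ ≤ μ, from ln(1 + x) ≤ x. No bound depends on the
dataset, whence the uniformity.

Convergence. Symmetry of the noise allows pairing the noise D with -D. The two clipped gradients
`clip (g + D)` and `clip (g - D)` together have inner product with g at least an explicit function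
of ‖g‖ and ‖D‖, affine in ‖D‖ (`le_inner_clip_add`); taking means replaces ‖D‖ by ξ and gives the
second term of the rate function. The smoothness inequality then yields, with q = 1/√T, an expected
decrease of (1 - q) q f(‖g‖) per step, up to an error q² (ξ²/(2BL) + L₀ (1 + B/(B² + σ²d)))
(`lintegral_loss_step_add_le`). The learning rates are tuned so that T such errors add up to O(1).
Telescoping and Markov's inequality for f(‖g_t‖) give the bound with c multiplied by (1 + B/(B² +
σ_T²d))/(1 - q). This factor tends to 1 because σ_T → ∞. -/

lemma log_noise_arg_pos {n B : ℕ} (hB : 0 < B) (hBn : B ≤ n) {μ : ℝ} (hμ : 0 < μ) {T : ℕ}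
    (hT : 0 < T) : 0 < Real.log ((n : ℝ) ^ 2 * μ ^ 2 / (T * (B : ℝ) ^ 2) + 1) := by
  have hn : 0 < n := hB.trans_le hBn
  apply Real.log_pos
  have : 0 < (n : ℝ) ^ 2 * μ ^ 2 / (T * (B : ℝ) ^ 2) := by positivity
  linarith

lemma noiseMultiplier_pos {n B : ℕ} (hB : 0 < B) (hBn : B ≤ n) {μ : ℝ} (hμ : 0 < μ) {T : ℕ}
    (hT : 0 < T) : 0 < noiseMultiplier n B μ T :=
  Real.sqrt_pos.2 (one_div_pos.2 (log_noise_arg_pos hB hBn hμ hT))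

lemma one_div_noiseMultiplier_sq {n B : ℕ} (hB : 0 < B) (hBn : B ≤ n) {μ : ℝ} (hμ : 0 < μ) {T : ℕ}
    (hT : 0 < T) : 1 / noiseMultiplier n B μ T ^ 2
      = Real.log ((n : ℝ) ^ 2 * μ ^ 2 / (T * (B : ℝ) ^ 2) + 1) := by
  have h := log_noise_arg_pos hB hBn hμ hT
  rw [noiseMultiplier, Real.sq_sqrt (one_div_pos.2 h).le, one_div_one_div]

lemma accounting {n B : ℕ} (hB : 0 < B) (hBn : B ≤ n) {μ : ℝ} (hμ : 0 < μ) {T : ℕ}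
    (hT : 0 < T) :
    μ = (B : ℝ) / n * √(T * (Real.exp (1 / noiseMultiplier n B μ T ^ 2) - 1)) := by
  have hn : 0 < n := hB.trans_le hBn
  rw [one_div_noiseMultiplier_sq hB hBn hμ hT, Real.exp_log (by positivity), add_sub_cancel_right]
  have : (T : ℝ) * ((n : ℝ) ^ 2 * μ ^ 2 / (T * (B : ℝ) ^ 2)) = (n * μ / B) ^ 2 := by
    field_simp
  rw [this, Real.sqrt_sq (by positivity)]
  field_simp

/-- The noise multiplier grows at least like `√T`. -/
lemma one_div_noiseMultiplier_sq_le {n B : ℕ} (hB : 0 < B) (hBn : B ≤ n) {μ : ℝ} (hμ : 0 < μ)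
    {T : ℕ} (hT : 0 < T) :
    1 / noiseMultiplier n B μ T ^ 2 ≤ ((n : ℝ) * μ / B) ^ 2 / T := by
  have hn : 0 < n := hB.trans_le hBn
  rw [one_div_noiseMultiplier_sq hB hBn hμ hT]
  -- The bound ln(1 + x) ≤ x is the only loss in passing from the accounting equation to √T p/σ_T ≤
  -- μ.
  have h := Real.log_le_sub_one_of_pos
    (show 0 < (n : ℝ) ^ 2 * μ ^ 2 / (T * (B : ℝ) ^ 2) + 1 by positivity)
  refine h.trans (le_of_eq ?_)
  field_simp
  ring

/-- Used twice: for privacy, 1/σ_T² eventually drops below 1, as the exponential estimate requires;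
for convergence, the batch variance B/(B² + σ_T²d) vanishes. -/
lemma tendsto_noiseMultiplier_sq {n B : ℕ} (hB : 0 < B) (hBn : B ≤ n) {μ : ℝ} (hμ : 0 < μ) :
    Tendsto (fun T => noiseMultiplier n B μ T ^ 2) atTop atTop := by
  have hn : 0 < n := hB.trans_le hBn
  have ha : 0 < ((n : ℝ) * μ / B) ^ 2 := by positivity
  refine tendsto_atTop_mono' atTop ?_ (tendsto_natCast_atTop_atTop.atTop_div_const ha)
  filter_upwards [eventually_gt_atTop 0] with T hT
  have h1 := one_div_noiseMultiplier_sq_le hB hBn hμ hT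
  have hs : 0 < noiseMultiplier n B μ T ^ 2 := pow_pos (noiseMultiplier_pos hB hBn hμ hT) 2
  have hT' : (0 : ℝ) < T := by exact_mod_cast hT
  rw [div_le_div_iff₀ hs hT'] at h1
  rw [div_le_iff₀ ha]
  linarith

/-! ### The rate function -/

/-- The gain of automatic clipping at gradient norm `x`, for a fixed `r`. -/
def clipGain (r ξ x : ℝ) : ℝ := (1 / ((r - 1) * x + 1) - 1 / ((r + 1) * x + 1)) * (x - ξ / r)

/-- The gain of automatic clipping at gradient norm `x`, for the best `r > 1`. -/
def bestGain (ξ x : ℝ) : ℝ := ⨆ r : Set.Ioi (1 : ℝ), clipGain (r : ℝ) ξ x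

/-- The weight of the clipping gain in the rate function. -/
def gainWeight (d B : ℕ) (L L₀ σ : ℝ) : ℝ := √(L₀ / (2 * L * (1 + σ ^ 2 * d / (B : ℝ) ^ 2)))

lemma fr_eq (r : ℝ) (d B : ℕ) (ξ L L₀ σ x : ℝ) :
    fr r d B ξ L L₀ σ x = 1 / (2 * L) * x ^ 2 + gainWeight d B L L₀ σ * clipGain r ξ x := by
  rw [fr, gainWeight, clipGain, mul_assoc]

lemma gainWeight_pos (d B : ℕ) {L L₀ : ℝ} (hL : 0 < L) (hL₀ : 0 < L₀) (σ : ℝ) :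
    0 < gainWeight d B L L₀ σ := by
  unfold gainWeight; positivity

lemma gainWeight_strictAntiOn {d B : ℕ} (hd : 0 < d) (hB : 0 < B) {L L₀ : ℝ} (hL : 0 < L)
    (hL₀ : 0 < L₀) : StrictAntiOn (gainWeight d B L L₀) (Set.Ici 0) := by
  intro s hs t ht hst
  have hs : 0 ≤ s := hs
  unfold gainWeight
  apply Real.sqrt_lt_sqrt (by positivity)
  gcongr

lemma clipFactor_eq {r x : ℝ} (hr : 1 < r) (hx : 0 ≤ x) :
    1 / ((r - 1) * x + 1) - 1 / ((r + 1) * x + 1)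
      = 2 * x / (((r - 1) * x + 1) * ((r + 1) * x + 1)) := by
  have h1 : 0 < (r - 1) * x + 1 := by nlinarith
  have h2 : 0 < (r + 1) * x + 1 := by nlinarith
  field_simp
  ring

lemma clipFactor_nonneg {r x : ℝ} (hr : 1 < r) (hx : 0 ≤ x) :
    0 ≤ 1 / ((r - 1) * x + 1) - 1 / ((r + 1) * x + 1) := by
  rw [clipFactor_eq hr hx]
  have h1 : 0 < (r - 1) * x + 1 := by nlinarith
  have h2 : 0 < (r + 1) * x + 1 := by nlinarith
  positivity

lemma clipFactor_le_one {r x : ℝ} (hr : 1 < r) (hx : 0 ≤ x) :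
    1 / ((r - 1) * x + 1) - 1 / ((r + 1) * x + 1) ≤ 1 := by
  have h1 : 1 ≤ (r - 1) * x + 1 := by nlinarith
  have h2 : 0 < (r + 1) * x + 1 := by nlinarith
  have h3 : 1 / ((r - 1) * x + 1) ≤ 1 := by rw [div_le_one (by linarith)]; exact h1
  have h4 : 0 < 1 / ((r + 1) * x + 1) := by positivity
  linarith

lemma clipGain_zero (r ξ : ℝ) : clipGain r ξ 0 = 0 := by simp [clipGain]

/-- A bound uniform in r: it makes the supremum finite and forces continuity of `bestGain` at 0. -/
lemma clipGain_le_self {r ξ x : ℝ} (hr : 1 < r) (hξ : 0 ≤ ξ) (hx : 0 ≤ x) :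
    clipGain r ξ x ≤ x := by
  have h0 := clipFactor_nonneg hr hx
  have h1 := clipFactor_le_one hr hx
  have h2 : 0 ≤ ξ / r := div_nonneg hξ (by linarith)
  unfold clipGain
  nlinarith

lemma bddAbove_clipGain {ξ x : ℝ} (hξ : 0 ≤ ξ) (hx : 0 ≤ x) :
    BddAbove (Set.range fun r : Set.Ioi (1 : ℝ) => clipGain (r : ℝ) ξ x) :=
  ⟨x, by rintro _ ⟨r, rfl⟩; exact clipGain_le_self r.2 hξ hx⟩

instance : Nonempty (Set.Ioi (1 : ℝ)) := ⟨⟨2, by norm_num⟩⟩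

lemma clipGain_le_bestGain {r ξ x : ℝ} (hr : 1 < r) (hξ : 0 ≤ ξ) (hx : 0 ≤ x) :
    clipGain r ξ x ≤ bestGain ξ x :=
  le_ciSup (bddAbove_clipGain hξ hx) (⟨r, hr⟩ : Set.Ioi (1 : ℝ))

lemma bestGain_zero (ξ : ℝ) : bestGain ξ 0 = 0 := by simp [bestGain, clipGain_zero]

lemma bestGain_le_self {ξ x : ℝ} (hξ : 0 ≤ ξ) (hx : 0 ≤ x) : bestGain ξ x ≤ x :=
  ciSup_le fun r => clipGain_le_self r.2 hξ hx

lemma bestGain_pos {ξ x : ℝ} (hξ : 0 ≤ ξ) (hx : 0 < x) : 0 < bestGain ξ x := by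
  -- Any r > ξ/x makes the last factor x - ξ/r positive; this choice also exceeds 1.
  have hr : 1 < ξ / x + 2 := by have := div_nonneg hξ hx.le; linarith
  refine lt_of_lt_of_le ?_ (clipGain_le_bestGain hr hξ hx.le)
  have h1 : 0 < (ξ / x + 2 - 1) * x + 1 := by nlinarith
  have h2 : 0 < (ξ / x + 2 + 1) * x + 1 := by nlinarith
  rw [clipGain, clipFactor_eq hr hx.le]
  refine mul_pos (by positivity) (sub_pos.2 ?_)
  rw [div_lt_iff₀ (by linarith), mul_add, mul_div_cancel₀ _ hx.ne']
  linarith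

lemma bestGain_nonneg {ξ x : ℝ} (hξ : 0 ≤ ξ) (hx : 0 ≤ x) : 0 ≤ bestGain ξ x := by
  rcases hx.eq_or_lt with rfl | hx
  · rw [bestGain_zero]
  · exact (bestGain_pos hξ hx).le

lemma clipGain_le_clipGain {r ξ x y : ℝ} (hr : 1 < r) (hξ : 0 ≤ ξ) (hx : 0 < x) (hxy : x ≤ y)
    (h : 0 ≤ x - ξ / r) : clipGain r ξ x ≤ clipGain r ξ y := by
  -- After dividing numerator and denominator by z², the numerator grows with z and both factors of
  -- the denominator shrink.
  have key : ∀ z, 0 < z → clipGain r ξ z = 2 * (1 - ξ / r / z) / ((r - 1 + 1 / z) * (r + 1 + 1 / z)) := by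
    intro z hz
    have h1 : 0 < (r - 1) * z + 1 := by nlinarith
    have h2 : 0 < (r + 1) * z + 1 := by nlinarith
    rw [clipGain, clipFactor_eq hr hz.le]
    field_simp
  have hy := hx.trans_le hxy
  have hr1 : 0 < r - 1 := by linarith
  have hr0 : 0 < r := by linarith
  have hz : ξ / r / y ≤ 1 := by rw [div_le_one hy]; linarith
  rw [key x hx, key y hy]
  gcongr

lemma bestGain_monotoneOn {ξ : ℝ} (hξ : 0 ≤ ξ) : MonotoneOn (bestGain ξ) (Set.Ici 0) := by
  intro x hx y hy hxy
  have hx : 0 ≤ x := hx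
  rcases hx.eq_or_lt with rfl | hx
  · rw [bestGain_zero]; exact bestGain_nonneg hξ hy
  refine ciSup_le fun r => ?_
  -- A single `clipGain r ξ` need not be monotone where it is negative, but there it lies below the
  -- nonnegative `bestGain ξ y`.
  by_cases h : 0 ≤ x - ξ / r
  · exact (clipGain_le_clipGain r.2 hξ hx hxy h).trans (clipGain_le_bestGain r.2 hξ hy)
  · refine le_trans ?_ (bestGain_nonneg hξ hy)
    exact mul_nonpos_of_nonneg_of_nonpos (clipFactor_nonneg r.2 hx.le) (not_le.1 h).le

/-- The difference quotient is k/((kx + 1)(ky + 1)) ≤ 1/x ≤ 1/a. The bound does not involve k, so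
the Lipschitz estimate below is uniform in r and passes to the supremum. -/
lemma one_div_linear_sub_le {k a x y : ℝ} (hk : 0 ≤ k) (ha : 0 < a) (hx : a ≤ x) (hy : a ≤ y) :
    |1 / (k * y + 1) - 1 / (k * x + 1)| ≤ |y - x| / a := by
  have h1 : 0 < k * x + 1 := by nlinarith
  have h2 : 0 < k * y + 1 := by nlinarith
  have h3 : 1 / (k * y + 1) - 1 / (k * x + 1) = (x - y) * (k / ((k * y + 1) * (k * x + 1))) := by
    field_simp
    ring
  rw [h3, abs_mul, abs_sub_comm, div_eq_mul_one_div |y - x| a]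
  gcongr
  rw [abs_of_nonneg (by positivity), div_le_div_iff₀ (by positivity) ha]
  have : 0 ≤ k * x := by nlinarith
  have : 0 ≤ k * y := by nlinarith
  nlinarith

lemma clipGain_sub_le {r ξ a b x y : ℝ} (hr : 1 < r) (hξ : 0 ≤ ξ) (ha : 0 < a)
    (hx : x ∈ Set.Icc a b) (hy : y ∈ Set.Icc a b) :
    clipGain r ξ y - clipGain r ξ x ≤ (2 / a * (b + ξ) + 1) * |y - x| := by
  have h1 := one_div_linear_sub_le (k := r - 1) (by linarith) ha hx.1 hy.1
  have h2 := one_div_linear_sub_le (k := r + 1) (by linarith) ha hx.1 hy.1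
  have hx0 : 0 ≤ x := ha.le.trans hx.1
  have h3 := clipFactor_nonneg hr hx0
  have h4 := clipFactor_le_one hr hx0
  unfold clipGain
  set p := 1 / ((r - 1) * y + 1)
  set q := 1 / ((r + 1) * y + 1)
  set p' := 1 / ((r - 1) * x + 1)
  set q' := 1 / ((r + 1) * x + 1)
  have hξr : ξ / r ≤ ξ := div_le_self hξ hr.le
  have hξr0 : 0 ≤ ξ / r := div_nonneg hξ (by linarith)
  have hb : |y - ξ / r| ≤ b + ξ := by
    rw [abs_le]; constructor <;> linarith [hy.1, hy.2]
  have e : (p - q) * (y - ξ / r) - (p' - q') * (x - ξ / r)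
      = (p - p' - (q - q')) * (y - ξ / r) + (p' - q') * (y - x) := by ring
  rw [e, add_mul]
  refine add_le_add ?_ ?_
  · refine (le_abs_self _).trans ?_
    rw [abs_mul]
    have : |p - p' - (q - q')| ≤ 2 / a * |y - x| := by
      refine (abs_sub _ _).trans ((add_le_add h1 h2).trans (le_of_eq ?_))
      ring
    calc |p - p' - (q - q')| * |y - ξ / r| ≤ (2 / a * |y - x|) * (b + ξ) := by gcongr
      _ = _ := by ring
  · refine (mul_le_mul_of_nonneg_left (le_abs_self _) h3).trans ?_
    gcongr

lemma bestGain_sub_le {ξ a b x y : ℝ} (hξ : 0 ≤ ξ) (ha : 0 < a)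
    (hx : x ∈ Set.Icc a b) (hy : y ∈ Set.Icc a b) :
    bestGain ξ y - bestGain ξ x ≤ (2 / a * (b + ξ) + 1) * |y - x| := by
  rw [sub_le_iff_le_add]
  refine ciSup_le fun r => ?_
  have h1 := clipGain_sub_le r.2 hξ ha hx hy
  have h2 := clipGain_le_bestGain r.2 hξ (ha.le.trans hx.1)
  linarith

/-- The Lipschitz constants on [a, b] blow up as a → 0, so the point 0 is treated separately, by
squeezing between 0 and x. -/
lemma continuousOn_bestGain {ξ : ℝ} (hξ : 0 ≤ ξ) : ContinuousOn (bestGain ξ) (Set.Ici 0) := by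
  intro x hx
  have hx : 0 ≤ x := hx
  rcases hx.eq_or_lt with rfl | hx
  · rw [ContinuousWithinAt, bestGain_zero]
    have h : Tendsto (fun x : ℝ => x) (𝓝[Set.Ici 0] 0) (𝓝 0) := tendsto_id.mono_left inf_le_left
    refine tendsto_of_tendsto_of_tendsto_of_le_of_le' tendsto_const_nhds h ?_ ?_
    · filter_upwards [self_mem_nhdsWithin] with y hy using bestGain_nonneg hξ hy
    · filter_upwards [self_mem_nhdsWithin] with y hy using bestGain_le_self hξ hy
  · refine ContinuousAt.continuousWithinAt ?_
    have hx2 : x / 2 < x := by linarith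
    have hC : 0 ≤ 2 / (x / 2) * (2 * x + ξ) + 1 := by positivity
    have hl : LipschitzOnWith (Real.toNNReal (2 / (x / 2) * (2 * x + ξ) + 1)) (bestGain ξ) (Set.Icc (x / 2) (2 * x)) := by
      refine LipschitzOnWith.of_dist_le_mul fun y hy z hz => ?_
      rw [Real.coe_toNNReal _ hC, Real.dist_eq, Real.dist_eq, abs_le]
      have h1 := bestGain_sub_le hξ (by positivity) hy hz
      have h2 := bestGain_sub_le hξ (by positivity) hz hy
      rw [abs_sub_comm] at h1
      exact ⟨by linarith, h2⟩
    exact hl.continuousOn.continuousAt (Icc_mem_nhds hx2 (by linarith))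

lemma rateFun_eq {d B : ℕ} {ξ L L₀ x : ℝ} (hL : 0 < L) (hL₀ : 0 < L₀) (hξ : 0 ≤ ξ) (σ : ℝ)
    (hx : 0 ≤ x) : rateFun d B ξ L L₀ σ x
      = 1 / (2 * L) * x ^ 2 + gainWeight d B L L₀ σ * bestGain ξ x := by
  have hA := (gainWeight_pos d B hL hL₀ σ).le
  simp only [rateFun, fr_eq]
  rw [bestGain, Real.mul_iSup_of_nonneg hA, add_ciSup]
  refine ⟨gainWeight d B L L₀ σ * x, ?_⟩
  rintro _ ⟨r, rfl⟩
  exact mul_le_mul_of_nonneg_left (clipGain_le_self r.2 hξ hx) hA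

lemma rateFun_nonneg {d B : ℕ} {ξ L L₀ x : ℝ} (hL : 0 < L) (hL₀ : 0 < L₀) (hξ : 0 ≤ ξ) (σ : ℝ)
    (hx : 0 ≤ x) : 0 ≤ rateFun d B ξ L L₀ σ x := by
  rw [rateFun_eq hL hL₀ hξ σ hx]
  have := bestGain_nonneg hξ hx
  have := gainWeight_pos d B hL hL₀ σ
  positivity

lemma rateFun_pos {d B : ℕ} {ξ L L₀ x : ℝ} (hL : 0 < L) (hL₀ : 0 < L₀) (hξ : 0 ≤ ξ) (σ : ℝ)
    (hx : 0 < x) : 0 < rateFun d B ξ L L₀ σ x := by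
  rw [rateFun_eq hL hL₀ hξ σ hx.le]
  have := bestGain_nonneg hξ hx.le
  have := gainWeight_pos d B hL hL₀ σ
  positivity

lemma rateFun_strictMonoOn {d B : ℕ} {ξ L L₀ : ℝ} (hL : 0 < L) (hL₀ : 0 < L₀) (hξ : 0 ≤ ξ)
    (σ : ℝ) : StrictMonoOn (rateFun d B ξ L L₀ σ) (Set.Ici 0) := by
  intro x hx y hy hxy
  rw [rateFun_eq hL hL₀ hξ σ hx, rateFun_eq hL hL₀ hξ σ hy]
  refine add_lt_add_of_lt_of_le ?_
    (mul_le_mul_of_nonneg_left (bestGain_monotoneOn hξ hx hy hxy.le) (gainWeight_pos d B hL hL₀ σ).le)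
  have hx : 0 ≤ x := hx
  gcongr

lemma continuousOn_rateFun {d B : ℕ} {ξ L L₀ : ℝ} (hL : 0 < L) (hL₀ : 0 < L₀) (hξ : 0 ≤ ξ)
    (σ : ℝ) : ContinuousOn (rateFun d B ξ L L₀ σ) (Set.Ici 0) := by
  have h : ContinuousOn (fun x => 1 / (2 * L) * x ^ 2 + gainWeight d B L L₀ σ * bestGain ξ x)
      (Set.Ici 0) :=
    (by fun_prop : Continuous fun x : ℝ => 1 / (2 * L) * x ^ 2).continuousOn.add
      (continuousOn_const.mul (continuousOn_bestGain hξ))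
  exact h.congr fun x hx => rateFun_eq hL hL₀ hξ σ hx

lemma rateFun_bijOn {d B : ℕ} {ξ L L₀ : ℝ} (hL : 0 < L) (hL₀ : 0 < L₀) (hξ : 0 ≤ ξ)
    (σ : ℝ) : Set.BijOn (rateFun d B ξ L L₀ σ) (Set.Ici 0) (Set.Ici 0) := by
  refine ⟨fun x hx => rateFun_nonneg hL hL₀ hξ σ hx, (rateFun_strictMonoOn hL hL₀ hξ σ).injOn, ?_⟩
  intro y hy
  have hy : 0 ≤ y := hy
  have h0 : rateFun d B ξ L L₀ σ 0 = 0 := by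
    rw [rateFun_eq hL hL₀ hξ σ le_rfl, bestGain_zero]; simp
  -- The quadratic term alone reaches y at √(2Ly), which bounds the interval for the intermediate
  -- value theorem.
  have h1 : y ≤ rateFun d B ξ L L₀ σ (√(2 * L * y)) := by
    rw [rateFun_eq hL hL₀ hξ σ (Real.sqrt_nonneg _), Real.sq_sqrt (by positivity)]
    have := mul_nonneg (gainWeight_pos d B hL hL₀ σ).le
      (bestGain_nonneg hξ (Real.sqrt_nonneg (2 * L * y)))
    have e : 1 / (2 * L) * (2 * L * y) = y := by field_simp
    linarith
  have h2 := intermediate_value_Icc (Real.sqrt_nonneg (2 * L * y))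
    ((continuousOn_rateFun (d := d) (B := B) hL hL₀ hξ σ).mono Set.Icc_subset_Ici_self)
  obtain ⟨x, hx, hxy⟩ := h2 ⟨h0.le.trans hy, h1⟩
  exact ⟨x, hx.1, hxy⟩

lemma rateFun_strictAntiOn {d B : ℕ} (hd : 0 < d) (hB : 0 < B) {ξ L L₀ x : ℝ} (hL : 0 < L)
    (hL₀ : 0 < L₀) (hξ : 0 ≤ ξ) (hx : 0 < x) :
    StrictAntiOn (fun σ => rateFun d B ξ L L₀ σ x) (Set.Ici 0) := by
  intro s hs t ht hst
  simp only [rateFun_eq hL hL₀ hξ _ hx.le]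
  have h1 := gainWeight_strictAntiOn hd hB hL hL₀ hs ht hst
  have h2 := bestGain_pos hξ hx
  gcongr

lemma le_rateFun_of_rateInv_lt {d B : ℕ} {ξ L L₀ x y : ℝ} (hL : 0 < L) (hL₀ : 0 < L₀)
    (hξ : 0 ≤ ξ) (σ : ℝ) (hy : 0 ≤ y) (hx : 0 ≤ x) (h : rateInv d B ξ L L₀ σ y < x) :
    y ≤ rateFun d B ξ L L₀ σ x := by
  have hmem : y ∈ rateFun d B ξ L L₀ σ '' Set.Ici 0 := (rateFun_bijOn hL hL₀ hξ σ).surjOn hy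
  have h1 : rateFun d B ξ L L₀ σ (rateInv d B ξ L L₀ σ y) = y := Function.invFunOn_eq hmem
  have h2 : rateInv d B ξ L L₀ σ y ∈ Set.Ici (0 : ℝ) := Function.invFunOn_mem hmem
  have h3 := rateFun_strictMonoOn (d := d) (B := B) hL hL₀ hξ σ h2 hx h
  linarith

/-- Continuity is used because the rate function is a supremum over an uncountable family. -/
lemma measurable_rateFun_norm {d B : ℕ} {ξ L L₀ : ℝ} (hL : 0 < L) (hL₀ : 0 < L₀) (hξ : 0 ≤ ξ)
    (σ : ℝ) : Measurable fun v : Param d => rateFun d B ξ L L₀ σ ‖v‖ := by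
  have h : Continuous fun v : Param d => rateFun d B ξ L L₀ σ ‖v‖ :=
    (continuousOn_rateFun hL hL₀ hξ σ).comp_continuous continuous_norm fun v => norm_nonneg v
  exact h.measurable

/-! ### The gain of automatic clipping under symmetric noise -/

section Clipping

variable {d : ℕ}

lemma norm_clip_le_one (v : Param d) : ‖clip v‖ ≤ 1 := by
  have h : 0 < ‖v‖ + 1 := by positivity
  rw [clip, norm_smul, Real.norm_of_nonneg (by positivity), one_div, inv_mul_le_one₀ h]
  linarith

lemma measurable_clip : Measurable (clip : Param d → Param d) := by
  unfold clip; fun_prop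

/-- Here x = ‖g‖, s = ‖D‖, and m ± δ are the norms of g ± D. Equality holds for noise parallel to g
of norm R, where m = R and δ² = x²: among noise of norm at most R ≥ x this is the worst case. The
proof measures the distance from it by e = x² - δ². -/
lemma clip_pair_core {x s m δ R : ℝ} (hx : 0 ≤ x) (h : m ^ 2 + δ ^ 2 = x ^ 2 + s ^ 2)
    (hδ : δ ^ 2 ≤ x ^ 2) (hm : x ≤ m) (hs : 0 ≤ s) (hsR : s ≤ R) (hxR : x ≤ R) :
    x ^ 2 * ((m + 1) ^ 2 - δ ^ 2) ≤ (x ^ 2 * (m + 1) - δ ^ 2 * m) * ((R + 1) ^ 2 - x ^ 2) := by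
  obtain ⟨e, he⟩ : ∃ e, e = x ^ 2 - δ ^ 2 := ⟨_, rfl⟩
  have he0 : 0 ≤ e := by linarith
  have hm2 : m ^ 2 ≤ R ^ 2 + e := by nlinarith
  have hR : 0 ≤ R := hs.trans hsR
  have hxx : x ^ 2 ≤ m * R := by nlinarith
  have hRx : 2 * R + 1 ≤ (R + 1) ^ 2 - x ^ 2 := by nlinarith
  have h1 : 2 * x ^ 2 + m ≤ m * ((R + 1) ^ 2 - x ^ 2) := by
    have := mul_le_mul_of_nonneg_left hRx (hx.trans hm)
    nlinarith
  have h2 : x ^ 2 * (2 * (m - R)) ≤ e * m := by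
    rcases le_total m R with hmR | hmR
    · have : 0 ≤ e * m := mul_nonneg he0 (hx.trans hm)
      nlinarith [sq_nonneg x]
    · rcases (hx.trans hm).eq_or_lt with hm0 | hm0
      · have : x = 0 := by linarith
        subst this; simp [← hm0]
      · have h3 : (m - R) * (m + R) ≤ e := by nlinarith
        have h4 : 2 * x ^ 2 ≤ m * (m + R) := by nlinarith
        have h5 : 0 ≤ m - R := by linarith
        have h6 := mul_le_mul_of_nonneg_right h4 h5
        have h7 := mul_le_mul_of_nonneg_left h3 hm0.le
        nlinarith
  have h3 : e * (2 * x ^ 2 + m) ≤ e * (m * ((R + 1) ^ 2 - x ^ 2)) :=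
    mul_le_mul_of_nonneg_left h1 he0
  have h4 : δ ^ 2 = x ^ 2 - e := by linarith
  have h5 : x ^ 2 * (m ^ 2) ≤ x ^ 2 * (R ^ 2 + e) := mul_le_mul_of_nonneg_left hm2 (sq_nonneg x)
  rw [h4]
  nlinarith

lemma clip_pair_eq {x m δ : ℝ} (ha : 0 < m + δ + 1) (hb : 0 < m - δ + 1) :
    1 / (m + δ + 1) * (x ^ 2 + m * δ) + 1 / (m - δ + 1) * (x ^ 2 - m * δ)
      = 2 * (x ^ 2 * (m + 1) - δ ^ 2 * m) / ((m + 1) ^ 2 - δ ^ 2) := by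
  have : (m + 1) ^ 2 - δ ^ 2 = (m + δ + 1) * (m - δ + 1) := by ring
  rw [this]
  field_simp
  ring

/-- The two clipped gradients with opposite noise add up to a gain in the direction of `g`. -/
lemma le_inner_clip_add (g D : Param d) {r : ℝ} (hr : 1 < r) :
    (1 / ((r - 1) * ‖g‖ + 1) - 1 / ((r + 1) * ‖g‖ + 1)) * (‖g‖ - ‖D‖ / r)
      ≤ inner ℝ g (clip (g + D)) + inner ℝ g (clip (g - D)) := by
  -- In the coordinates m and δ the parallelogram law reads m² + δ² = ‖g‖² + ‖D‖², and ⟨g, D⟩ = mδ,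
  -- so the claim becomes a scalar inequality.
  obtain ⟨m, hm⟩ : ∃ m, m = (‖g + D‖ + ‖g - D‖) / 2 := ⟨_, rfl⟩
  obtain ⟨δ, hδ⟩ : ∃ δ, δ = (‖g + D‖ - ‖g - D‖) / 2 := ⟨_, rfl⟩
  have ha : ‖g + D‖ = m + δ := by rw [hm, hδ]; ring
  have hb : ‖g - D‖ = m - δ := by rw [hm, hδ]; ring
  have hx := norm_nonneg g
  have hs := norm_nonneg D
  have e1 := norm_add_sq_real g D
  have e2 := norm_sub_sq_real g D
  rw [ha] at e1
  rw [hb] at e2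
  have hin : inner ℝ g D = m * δ := by nlinarith
  have hsum : m ^ 2 + δ ^ 2 = ‖g‖ ^ 2 + ‖D‖ ^ 2 := by nlinarith
  have hmx : ‖g‖ ≤ m := by
    have h := norm_add_le (g + D) (g - D)
    have h2 : g + D + (g - D) = (2 : ℝ) • g := by rw [two_smul]; abel
    rw [h2, norm_smul, Real.norm_of_nonneg zero_le_two] at h
    linarith
  have hδx : δ ^ 2 ≤ ‖g‖ ^ 2 := by
    have h := abs_norm_sub_norm_le (g + D) (D - g)
    have h2 : g + D - (D - g) = (2 : ℝ) • g := by rw [two_smul]; abel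
    rw [h2, norm_smul, Real.norm_of_nonneg zero_le_two, norm_sub_rev D g] at h
    rw [sq_le_sq, abs_of_nonneg hx, hδ, abs_div, abs_two]
    linarith
  have ha0 : 0 < m + δ + 1 := by rw [← ha]; positivity
  have hb0 : 0 < m - δ + 1 := by rw [← hb]; positivity
  have hden : 0 < (m + 1) ^ 2 - δ ^ 2 := by
    have : (m + 1) ^ 2 - δ ^ 2 = (m + δ + 1) * (m - δ + 1) := by ring
    rw [this]; positivity
  have hQ : inner ℝ g (clip (g + D)) + inner ℝ g (clip (g - D))
      = 2 * (‖g‖ ^ 2 * (m + 1) - δ ^ 2 * m) / ((m + 1) ^ 2 - δ ^ 2) := by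
    rw [← clip_pair_eq ha0 hb0, clip, clip, inner_smul_right, inner_smul_right, inner_add_right,
      inner_sub_right, real_inner_self_eq_norm_sq, ha, hb, hin]
  have hnum : 0 ≤ ‖g‖ ^ 2 * (m + 1) - δ ^ 2 * m := by nlinarith [sq_nonneg ‖g‖]
  have hF := clipFactor_nonneg hr hx
  have hr0 : 0 < r := by linarith
  rw [hQ]
  -- For ‖D‖ ≤ r‖g‖ the worst case R = r‖g‖ applies, with ‖D‖/r simply dropped. For larger noise the
  -- left side is nonpositive, while the sum of inner products is nonnegative.
  rcases le_total ‖D‖ (r * ‖g‖) with h | h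
  · have hc := clip_pair_core hx hsum hδx hmx hs h (le_mul_of_one_le_left hx hr.le)
    have hle : ‖g‖ - ‖D‖ / r ≤ ‖g‖ := by have := div_nonneg hs hr0.le; linarith
    refine (mul_le_mul_of_nonneg_left hle hF).trans ?_
    have h1 : 0 < (r - 1) * ‖g‖ + 1 := by nlinarith
    have h2 : 0 < (r + 1) * ‖g‖ + 1 := by nlinarith
    rw [clipFactor_eq hr hx, div_mul_eq_mul_div, div_le_div_iff₀ (by positivity) hden]
    have h3 : (r * ‖g‖ + 1) ^ 2 - ‖g‖ ^ 2 = ((r - 1) * ‖g‖ + 1) * ((r + 1) * ‖g‖ + 1) := by ring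
    rw [← h3]
    nlinarith
  · refine (mul_nonpos_of_nonneg_of_nonpos hF ?_).trans (by positivity)
    rw [sub_nonpos, le_div_iff₀ hr0]
    linarith

variable {𝒟 : Type*} [MeasurableSpace 𝒟]

lemma measurable_gradient_left {l : 𝒟 → Param d → ℝ}
    (hlm : Measurable fun x : 𝒟 × Param d => gradient (l x.1) x.2) (w : Param d) :
    Measurable fun z => gradient (l z) w :=
  hlm.comp (measurable_id.prodMk measurable_const)

lemma integrable_of_norm_le {Ω E : Type*} [MeasurableSpace Ω] [NormedAddCommGroup E]
    {P : Measure Ω} [IsFiniteMeasure P] {f : Ω → E} (hf : AEStronglyMeasurable f P) (C : ℝ)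
    (h : ∀ x, ‖f x‖ ≤ C) : Integrable f P :=
  Integrable.of_bound hf C (.of_forall h)

/-- The mean of the clipped per-sample gradient is aligned with the gradient of the loss. -/
lemma clipGain_le_inner_integral_clip {l : 𝒟 → Param d → ℝ}
    (hlm : Measurable fun x : 𝒟 × Param d => gradient (l x.1) x.2) {ρ : Measure 𝒟}
    [IsProbabilityMeasure ρ] {loss : Param d → ℝ} {ξ : ℝ} (hξ : 0 ≤ ξ)
    (hn : GradientNoise ρ l loss ξ) (w : Param d) {r : ℝ} (hr : 1 < r) :
    clipGain r ξ ‖gradient loss w‖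
      ≤ 2 * inner ℝ (gradient loss w) (∫ z, clip (gradient (l z) w) ∂ρ) := by
  have hm := measurable_gradient_left hlm w
  obtain ⟨g, hg⟩ : ∃ g, g = gradient loss w := ⟨_, rfl⟩
  obtain ⟨N, hN⟩ : ∃ N : 𝒟 → Param d, N = fun z => gradient (l z) w - g := ⟨_, rfl⟩
  have hsym := hn.symmetric w
  have hLp := hn.memLp w
  have h2 := hn.second_moment w
  rw [← hg] at hsym hLp h2 ⊢
  have hNm : Measurable N := by rw [hN]; fun_prop
  change MemLp (fun z => gradient (l z) w - g) 2 ρ at hLp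
  rw [← hN] at hLp hsym
  have hNz : ∀ z, gradient (l z) w - g = N z := fun z => by rw [hN]
  have hsym' : ρ.map (fun z => - N z) = ρ.map N := by simpa only [hNz] using hsym
  simp only [hNz] at h2
  have hc : ∀ z, clip (gradient (l z) w) = clip (g + N z) := fun z => by
    rw [← hNz, add_sub_cancel]
  simp only [hc]
  have hφm : Measurable fun y : Param d => inner ℝ g (clip (g + y)) := by
    have := (measurable_clip (d := d)).comp (measurable_const_add g)
    exact Measurable.inner measurable_const this
  have hclm : Measurable fun z => clip (g + N z) := measurable_clip.comp (by fun_prop)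
  have hclm' : Measurable fun z => clip (g - N z) := measurable_clip.comp (by fun_prop)
  have hi : Integrable (fun z => clip (g + N z)) ρ :=
    integrable_of_norm_le hclm.aestronglyMeasurable 1 fun z => norm_clip_le_one _
  have hi' : Integrable (fun z => clip (g - N z)) ρ :=
    integrable_of_norm_le hclm'.aestronglyMeasurable 1 fun z => norm_clip_le_one _
  -- Symmetry of the noise law: flipping the sign of the noise does not change the mean, so twice
  -- the mean is the mean of the paired sum.
  have hsw : ∫ z, inner ℝ g (clip (g - N z)) ∂ρ = ∫ z, inner ℝ g (clip (g + N z)) ∂ρ := by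
    have e1 := integral_map (μ := ρ) (φ := N) hNm.aemeasurable hφm.aestronglyMeasurable
    have e2 := integral_map (μ := ρ) (φ := fun z => - N z) hNm.neg.aemeasurable
      hφm.aestronglyMeasurable
    rw [← e1, ← hsym', e2]
    simp only [sub_eq_add_neg]
  rw [← integral_inner hi g, two_mul]
  nth_rewrite 2 [← hsw]
  rw [← integral_add (hi.const_inner g) (hi'.const_inner g)]
  have hNn : Integrable (fun z => ‖N z‖) ρ := (hLp.integrable (by norm_num)).norm
  -- Nonnegativity of the variance of ‖N‖ turns the second moment bound into a first moment bound.
  have hmean : ∫ z, ‖N z‖ ∂ρ ≤ ξ := by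
    have hv : 0 ≤ ∫ z, ‖N z‖ ^ 2 ∂ρ - (∫ z, ‖N z‖ ∂ρ) ^ 2 := by
      have := variance_nonneg (fun z => ‖N z‖) ρ
      rwa [variance_eq_sub hLp.norm] at this
    exact abs_le_of_sq_le_sq' (by linarith) hξ |>.2
  have hF := clipFactor_nonneg hr (norm_nonneg g)
  have hr0 : 0 < r := by linarith
  calc clipGain r ξ ‖g‖
      ≤ (1 / ((r - 1) * ‖g‖ + 1) - 1 / ((r + 1) * ‖g‖ + 1)) * (‖g‖ - (∫ z, ‖N z‖ ∂ρ) / r) := by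
        unfold clipGain; gcongr
    _ = ∫ z, (1 / ((r - 1) * ‖g‖ + 1) - 1 / ((r + 1) * ‖g‖ + 1)) * (‖g‖ - ‖N z‖ / r) ∂ρ := by
        rw [integral_const_mul, integral_sub (integrable_const _) (hNn.div_const r),
          integral_div, integral_const]
        simp
    _ ≤ _ := integral_mono (((integrable_const _).sub (hNn.div_const r)).const_mul _)
        ((hi.const_inner g).add (hi'.const_inner g)) fun z => le_inner_clip_add g (N z) hr

end Clipping

/-! ### Second moments of independent sums -/

section Moments

lemma memLp_sum_pi {E : Type*} [NormedAddCommGroup E] {m : ℕ} {α : Fin m → Type*} [∀ i, MeasurableSpace (α i)]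
    {P : ∀ i, Measure (α i)} [∀ i, IsProbabilityMeasure (P i)] {Y : ∀ i, α i → E}
    (hY : ∀ i, MemLp (Y i) 2 (P i)) : MemLp (fun z => ∑ i, Y i (z i)) 2 (Measure.pi P) :=
  memLp_finsetSum _ fun i _ => (hY i).comp_measurePreserving (measurePreserving_eval P i)

lemma integral_sum_pi {E : Type*} [NormedAddCommGroup E] [NormedSpace ℝ E] {m : ℕ} {α : Fin m → Type*} [∀ i, MeasurableSpace (α i)]
    {P : ∀ i, Measure (α i)} [∀ i, IsProbabilityMeasure (P i)] {Y : ∀ i, α i → E}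
    (hY : ∀ i, MemLp (Y i) 2 (P i)) :
    ∫ z, ∑ i, Y i (z i) ∂(Measure.pi P) = ∑ i, ∫ y, Y i y ∂(P i) := by
  have h : ∀ i, Integrable (fun z : ∀ i, α i => Y i (z i)) (Measure.pi P) := fun i =>
    ((hY i).comp_measurePreserving (measurePreserving_eval P i)).integrable (by norm_num)
  rw [integral_finsetSum _ fun i _ => h i]
  exact Finset.sum_congr rfl fun i _ => integral_comp_eval (hY i).1

variable {E : Type*} [NormedAddCommGroup E] [InnerProductSpace ℝ E] [CompleteSpace E]

lemma integral_norm_add_sq_prod {α β : Type*} [MeasurableSpace α] [MeasurableSpace β]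
    {P : Measure α} {Q : Measure β} [IsProbabilityMeasure P] [IsProbabilityMeasure Q]
    {X : α → E} {Y : β → E} (hX : MemLp X 2 P) (hY : MemLp Y 2 Q) :
    ∫ z, ‖X z.1 + Y z.2‖ ^ 2 ∂(P.prod Q)
      = ∫ x, ‖X x‖ ^ 2 ∂P + 2 * inner ℝ (∫ x, X x ∂P) (∫ y, Y y ∂Q) + ∫ y, ‖Y y‖ ^ 2 ∂Q := by
  have hX1 := hX.integrable (by norm_num)
  have hY1 := hY.integrable (by norm_num)
  have hX2 : Integrable (fun x => ‖X x‖ ^ 2) P := hX.integrable_norm_pow (by norm_num)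
  have hY2 : Integrable (fun y => ‖Y y‖ ^ 2) Q := hY.integrable_norm_pow (by norm_num)
  have hXY : Integrable (fun z : α × β => inner ℝ (X z.1) (Y z.2)) (P.prod Q) :=
    hX1.op_fst_snd (op := fun x y => inner ℝ x y) (by fun_prop)
      ⟨1, fun x y => by simpa using norm_inner_le_norm (𝕜 := ℝ) x y⟩ hY1
  simp only [norm_add_sq_real]
  have hA : Integrable (fun z : α × β => ‖X z.1‖ ^ 2 + 2 * inner ℝ (X z.1) (Y z.2)) (P.prod Q) :=
    (hX2.comp_fst Q).add (hXY.const_mul 2)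
  rw [integral_add hA (hY2.comp_snd P),
    integral_add (hX2.comp_fst Q) (hXY.const_mul 2), integral_const_mul,
    integral_fun_fst (fun x => ‖X x‖ ^ 2), integral_fun_snd (fun y => ‖Y y‖ ^ 2),
    integral_prod _ hXY]
  simp only [integral_inner hY1]
  simp only [real_inner_comm (∫ y, Y y ∂Q)]
  rw [integral_inner hX1]
  simp

/-- The variance of an independent sum is the sum of the variances. The factors may differ, as they
do for Poisson batches, where each record has its own gradient. -/
lemma integral_norm_sum_sq_pi {m : ℕ} {α : Fin m → Type*} [∀ i, MeasurableSpace (α i)]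
    {P : ∀ i, Measure (α i)} [∀ i, IsProbabilityMeasure (P i)] {Y : ∀ i, α i → E}
    (hY : ∀ i, MemLp (Y i) 2 (P i)) :
    ∫ z, ‖∑ i, Y i (z i)‖ ^ 2 ∂(Measure.pi P)
      = ‖∑ i, ∫ y, Y i y ∂(P i)‖ ^ 2
        + ∑ i, (∫ y, ‖Y i y‖ ^ 2 ∂(P i) - ‖∫ y, Y i y ∂(P i)‖ ^ 2) := by
  induction m with
  | zero => simp
  | succ m ih =>
    have hmp := measurePreserving_piFinSuccAbove P 0
    have e1 : ∫ z, ‖∑ i, Y i (z i)‖ ^ 2 ∂(Measure.pi P)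
        = ∫ z : α 0 × (∀ j : Fin m, α (Fin.succAbove 0 j)),
          ‖Y 0 z.1 + ∑ j : Fin m, Y (Fin.succAbove 0 j) (z.2 j)‖ ^ 2
            ∂((P 0).prod (Measure.pi fun j : Fin m => P (Fin.succAbove 0 j))) := by
      rw [← hmp.integral_comp']
      refine integral_congr_ae (.of_forall fun z => ?_)
      simp only [Fin.sum_univ_succAbove _ 0]
      rfl
    have hY' := fun j : Fin m => hY (Fin.succAbove 0 j)
    rw [e1, integral_norm_add_sq_prod (hY 0) (memLp_sum_pi hY'), ih hY', integral_sum_pi hY',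
      Fin.sum_univ_succAbove _ 0, Fin.sum_univ_succAbove _ 0, norm_add_sq_real]
    ring

end Moments

/-! ### Measurability of the transition laws -/

section Kernels

/-- The transition laws are plain functions into measures; bundling them as a `Kernel` gives access
to the measurability of sections. -/
lemma measurable_map_of_measurable {α β γ : Type*} [MeasurableSpace α] [MeasurableSpace β]
    [MeasurableSpace γ] {κ : α → Measure β} (hκ : Measurable κ) (hp : ∀ a, IsProbabilityMeasure (κ a))
    {f : α → β → γ} (hf : Measurable (Function.uncurry f)) :
    Measurable fun a => (κ a).map (f a) := by
  let K : Kernel α β := ⟨κ, hκ⟩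
  have : IsMarkovKernel K := ⟨hp⟩
  refine Measure.measurable_of_measurable_coe _ fun s hs => ?_
  have e : ∀ a, (κ a).map (f a) s = K a (Prod.mk a ⁻¹' (Function.uncurry f ⁻¹' s)) := fun a => by
    have hfa : Measurable (f a) := hf.comp measurable_prodMk_left
    rw [Measure.map_apply hfa hs]; rfl
  simp only [e]
  exact Kernel.measurable_kernel_prodMk_left (hf hs)

lemma measurable_prod_of_measurable {α β γ : Type*} [MeasurableSpace α] [MeasurableSpace β]
    [MeasurableSpace γ] {κ : α → Measure β} {η : α → Measure γ} (hκ : Measurable κ)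
    (hη : Measurable η) (hp : ∀ a, IsProbabilityMeasure (κ a))
    (hp' : ∀ a, IsProbabilityMeasure (η a)) : Measurable fun a => (κ a).prod (η a) := by
  let K : Kernel α β := ⟨κ, hκ⟩
  let H : Kernel α γ := ⟨η, hη⟩
  have : IsMarkovKernel K := ⟨hp⟩
  have : IsMarkovKernel H := ⟨hp'⟩
  have e : (fun a => (κ a).prod (η a)) = fun a => (K ×ₖ H) a := by
    funext a; rw [Kernel.prod_apply]; rfl
  rw [e]
  exact Kernel.measurable _

variable {𝒟 : Type*} [MeasurableSpace 𝒟] {d : ℕ} {l : 𝒟 → Param d → ℝ}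

lemma measurable_snoc (T : ℕ) : Measurable fun x : (Fin (T + 1) → Param d) × Param d =>
    (Fin.snoc (α := fun _ => Param d) x.1 x.2 : Fin (T + 2) → Param d) := by
  refine measurable_pi_lambda _ fun i => ?_
  induction i using Fin.lastCases with
  | last => simpa using measurable_snd
  | cast i => simp only [Fin.snoc_castSucc]; fun_prop

lemma measurable_trajectory_step {step : Param d → Measure (Param d)} (hs : Measurable step)
    (hp : ∀ w, IsProbabilityMeasure (step w)) (T : ℕ) :
    Measurable fun h : Fin (T + 1) → Param d => (step (h (Fin.last T))).map
      fun w => (Fin.snoc (α := fun _ => Param d) h w : Fin (T + 2) → Param d) := by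
  have hκ : Measurable fun h : Fin (T + 1) → Param d => step (h (Fin.last T)) :=
    hs.comp (by fun_prop)
  exact measurable_map_of_measurable
    (f := fun h w => (Fin.snoc (α := fun _ => Param d) h w : Fin (T + 2) → Param d))
    hκ (fun h => hp (h (Fin.last T))) (measurable_snoc T)

/-- Disintegration over the last step, on which the later inductions over T rest. Extended
nonnegative integrands avoid integrability conditions. -/
lemma lintegral_trajectoryLaw_succ {step : Param d → Measure (Param d)} (hs : Measurable step)
    (hp : ∀ w, IsProbabilityMeasure (step w)) (w₀ : Param d) (T : ℕ)
    {f : (Fin (T + 2) → Param d) → ENNReal} (hf : Measurable f) :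
    ∫⁻ h, f h ∂(trajectoryLaw step w₀ (T + 1))
      = ∫⁻ h, ∫⁻ w, f (Fin.snoc (α := fun _ => Param d) h w) ∂(step (h (Fin.last T)))
        ∂(trajectoryLaw step w₀ T) := by
  rw [trajectoryLaw, Measure.lintegral_bind (measurable_trajectory_step hs hp T).aemeasurable
    hf.aemeasurable]
  refine lintegral_congr fun h => ?_
  have hm : Measurable fun w => (Fin.snoc (α := fun _ => Param d) h w : Fin (T + 2) → Param d) :=
    (measurable_snoc T).comp measurable_prodMk_left
  rw [lintegral_map hf hm]

lemma isProbabilityMeasure_trajectoryLaw {step : Param d → Measure (Param d)}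
    (hs : Measurable step) (hp : ∀ w, IsProbabilityMeasure (step w)) (w₀ : Param d) (T : ℕ) :
    IsProbabilityMeasure (trajectoryLaw step w₀ T) := by
  induction T with
  | zero => rw [trajectoryLaw]; infer_instance
  | succ T ih =>
    refine ⟨?_⟩
    rw [← lintegral_one, lintegral_trajectoryLaw_succ hs hp w₀ T measurable_const]
    simp

lemma isProbabilityMeasure_stepLaw (ηpub ηpriv σ : ℝ) {pub priv : Param d → Measure (Param d)}
    (hp : ∀ w, IsProbabilityMeasure (pub w)) (hp' : ∀ w, IsProbabilityMeasure (priv w))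
    (w : Param d) : IsProbabilityMeasure (stepLaw ηpub ηpriv σ pub priv w) := by
  have := hp w
  have := hp' w
  exact Measure.isProbabilityMeasure_map (by fun_prop)

lemma measurable_stepLaw (ηpub ηpriv σ : ℝ) {pub priv : Param d → Measure (Param d)}
    (hm : Measurable pub) (hm' : Measurable priv)
    (hp : ∀ w, IsProbabilityMeasure (pub w)) (hp' : ∀ w, IsProbabilityMeasure (priv w)) :
    Measurable (stepLaw ηpub ηpriv σ pub priv) := by
  refine measurable_map_of_measurable (f := fun w (x : Param d × Param d × Param d) =>
    w - (ηpub • x.1 + ηpriv • (x.2.1 + σ • x.2.2)))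
    (measurable_prod_of_measurable hm (measurable_prod_of_measurable hm' measurable_const hp'
      fun _ => inferInstance) hp fun w => ?_) (fun w => ?_) (by unfold Function.uncurry; fun_prop)
  · have := hp' w; infer_instance
  · have := hp w; have := hp' w; infer_instance

lemma measurable_publicGradient
    (hlm : Measurable fun x : 𝒟 × Param d => gradient (l x.1) x.2) (B : ℕ) (ν : Measure 𝒟)
    [IsProbabilityMeasure ν] : Measurable (publicGradient B ν l) := by
  refine measurable_map_of_measurable (f := fun w (z : Fin B → 𝒟) => ∑ j, gradient (l (z j)) w)
    measurable_const (fun _ => inferInstance) (Finset.measurable_sum _ fun j _ => ?_)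
  have h : Measurable fun a : Param d × (Fin B → 𝒟) => (a.2 j, a.1) := by fun_prop
  exact hlm.comp h

lemma measurable_clippedGradientIID
    (hlm : Measurable fun x : 𝒟 × Param d => gradient (l x.1) x.2) (B : ℕ) (ν : Measure 𝒟)
    [IsProbabilityMeasure ν] : Measurable (clippedGradientIID B ν l) := by
  refine measurable_map_of_measurable
    (f := fun w (z : Fin B → 𝒟) => ∑ j, clip (gradient (l (z j)) w))
    measurable_const (fun _ => inferInstance) (Finset.measurable_sum _ fun j _ => ?_)
  have h : Measurable fun a : Param d × (Fin B → 𝒟) => (a.2 j, a.1) := by fun_prop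
  exact measurable_clip.comp (hlm.comp h)

lemma measurable_gradient_right
    (hlm : Measurable fun x : 𝒟 × Param d => gradient (l x.1) x.2) (z : 𝒟) :
    Measurable fun w => gradient (l z) w :=
  hlm.comp measurable_prodMk_left

lemma measurable_clippedGradientPoisson
    (hlm : Measurable fun x : 𝒟 × Param d => gradient (l x.1) x.2) (p : unitInterval)
    (S : Dataset 𝒟) : Measurable (clippedGradientPoisson p S l) := by
  refine measurable_map_of_measurable (f := fun w (b : Fin S.1 → Bool) =>
      ∑ i, if b i = true then clip (gradient (l (S.2 i)) w) else 0)
    measurable_const (fun _ => inferInstance) (Finset.measurable_sum _ fun i _ => ?_)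
  refine Measurable.ite ?_ ?_ measurable_const
  · have h : Measurable fun a : Param d × (Fin S.1 → Bool) => a.2 i := by fun_prop
    exact h (measurableSet_singleton true)
  · exact measurable_clip.comp ((measurable_gradient_right hlm _).comp measurable_fst)

lemma isProbabilityMeasure_publicGradient
    (hlm : Measurable fun x : 𝒟 × Param d => gradient (l x.1) x.2) (B : ℕ) (ν : Measure 𝒟)
    [IsProbabilityMeasure ν] (w : Param d) : IsProbabilityMeasure (publicGradient B ν l w) :=
  Measure.isProbabilityMeasure_map (Finset.measurable_sum _ fun j _ =>
    (measurable_gradient_left hlm w).comp (measurable_pi_apply j)).aemeasurable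

lemma isProbabilityMeasure_clippedGradientIID
    (hlm : Measurable fun x : 𝒟 × Param d => gradient (l x.1) x.2) (B : ℕ) (ν : Measure 𝒟)
    [IsProbabilityMeasure ν] (w : Param d) : IsProbabilityMeasure (clippedGradientIID B ν l w) :=
  Measure.isProbabilityMeasure_map (Finset.measurable_sum _ fun j _ => measurable_clip.comp
    ((measurable_gradient_left hlm w).comp (measurable_pi_apply j))).aemeasurable

lemma isProbabilityMeasure_clippedGradientPoisson {𝒟 : Type*} {l : 𝒟 → Param d → ℝ}
    (p : unitInterval) (S : Dataset 𝒟) (w : Param d) : IsProbabilityMeasure (clippedGradientPoisson p S l w) :=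
  Measure.isProbabilityMeasure_map (measurable_of_finite _).aemeasurable

end Kernels

/-! ### Moments of the gradient laws -/

section GradientMoments

variable {𝒟 : Type*} [MeasurableSpace 𝒟] {d : ℕ} {l : 𝒟 → Param d → ℝ}

lemma memLp_id_map {α : Type*} [MeasurableSpace α] {P : Measure α} {X : α → Param d}
    (hX : MemLp X 2 P) (hm : Measurable X) : MemLp id 2 (P.map X) :=
  (memLp_map_measure_iff aestronglyMeasurable_id hm.aemeasurable).2 hX

lemma integral_id_map {α : Type*} [MeasurableSpace α] {P : Measure α} {X : α → Param d}
    (hm : Measurable X) : ∫ x, x ∂(P.map X) = ∫ a, X a ∂P :=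
  integral_map hm.aemeasurable aestronglyMeasurable_id

lemma integral_norm_sq_map {α : Type*} [MeasurableSpace α] {P : Measure α} {X : α → Param d}
    (hm : Measurable X) : ∫ x, ‖x‖ ^ 2 ∂(P.map X) = ∫ a, ‖X a‖ ^ 2 ∂P :=
  integral_map hm.aemeasurable (by fun_prop)

lemma publicGradient_moments
    (hlm : Measurable fun x : 𝒟 × Param d => gradient (l x.1) x.2) (B : ℕ) {ν : Measure 𝒟}
    [IsProbabilityMeasure ν] {loss : Param d → ℝ} {ξ : ℝ} (hn : GradientNoise ν l loss ξ)
    (w : Param d) :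
    MemLp id 2 (publicGradient B ν l w) ∧
      ∫ x, x ∂(publicGradient B ν l w) = (B : ℝ) • gradient loss w ∧
      ∫ x, ‖x‖ ^ 2 ∂(publicGradient B ν l w) ≤ (B : ℝ) ^ 2 * ‖gradient loss w‖ ^ 2 + B * ξ ^ 2 := by
  have hm := measurable_gradient_left hlm w
  have hsm : Measurable fun z : Fin B → 𝒟 => ∑ j, gradient (l (z j)) w :=
    Finset.measurable_sum _ fun j _ => hm.comp (measurable_pi_apply j)
  obtain ⟨g, hg⟩ : ∃ g, g = gradient loss w := ⟨_, rfl⟩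
  have hN := hn.memLp w
  have hmean := hn.mean w
  have h2 := hn.second_moment w
  rw [← hg] at hN hmean h2 ⊢
  have hG : MemLp (fun z => gradient (l z) w) 2 ν := by
    have h := hN.add (memLp_const g)
    have e : (fun z => gradient (l z) w - g) + (fun _ => g) = fun z => gradient (l z) w := by
      funext z; simp
    rwa [e] at h
  have hG1 : ∫ z, gradient (l z) w ∂ν = g := by
    rw [integral_sub (hG.integrable (by norm_num)) (integrable_const g)] at hmean
    simpa [sub_eq_zero] using hmean
  have hG2 : ∫ z, ‖gradient (l z) w‖ ^ 2 ∂ν = ∫ z, ‖gradient (l z) w - g‖ ^ 2 ∂ν + ‖g‖ ^ 2 := by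
    have hi : Integrable (fun z => ‖gradient (l z) w - g‖ ^ 2) ν :=
      hN.integrable_norm_pow (by norm_num)
    have hi1 : Integrable (fun z => gradient (l z) w - g) ν := hN.integrable (by norm_num)
    have hi2 : Integrable (fun z => 2 * inner ℝ g (gradient (l z) w - g)) ν :=
      (hi1.const_inner g).const_mul 2
    have e : ∀ z, ‖gradient (l z) w‖ ^ 2
        = ‖gradient (l z) w - g‖ ^ 2 + 2 * inner ℝ g (gradient (l z) w - g) + ‖g‖ ^ 2 := fun z => by
      rw [real_inner_comm, ← norm_add_sq_real, sub_add_cancel]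
    have hA : Integrable (fun z => ‖gradient (l z) w - g‖ ^ 2
        + 2 * inner ℝ g (gradient (l z) w - g)) ν := hi.add hi2
    simp only [e]
    rw [integral_add hA (integrable_const _), integral_add hi hi2, integral_const_mul,
      integral_inner hi1, hmean]
    simp
  have hY : ∀ _ : Fin B, MemLp (fun z => gradient (l z) w) 2 ν := fun _ => hG
  refine ⟨memLp_id_map (memLp_sum_pi hY) hsm, ?_, ?_⟩
  · rw [publicGradient, integral_id_map hsm, integral_sum_pi hY, hG1]
    simp [Nat.cast_smul_eq_nsmul]
  · rw [publicGradient, integral_norm_sq_map hsm, integral_norm_sum_sq_pi hY, hG1, hG2]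
    simp only [Finset.sum_const, Finset.card_univ, Fintype.card_fin, add_sub_cancel_right,
      nsmul_eq_mul]
    rw [← Nat.cast_smul_eq_nsmul ℝ, norm_smul, mul_pow, Real.norm_natCast]
    gcongr

/-- What the convergence proof needs to know about the law of the private gradient at a point with
loss gradient `g`. -/
structure PrivateMoments (P : Measure (Param d)) (B : ℕ) (ξ : ℝ) (g : Param d) : Prop where
  memLp : MemLp id 2 P
  gain : ∀ r : ℝ, 1 < r → B * clipGain r ξ ‖g‖ ≤ 2 * inner ℝ g (∫ c, c ∂P)
  second_moment : ∫ c, ‖c‖ ^ 2 ∂P ≤ (B : ℝ) ^ 2 + B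

lemma privateMoments_iid
    (hlm : Measurable fun x : 𝒟 × Param d => gradient (l x.1) x.2) (B : ℕ) {ρ : Measure 𝒟}
    [IsProbabilityMeasure ρ] {loss : Param d → ℝ} {ξ : ℝ} (hξ : 0 ≤ ξ)
    (hn : GradientNoise ρ l loss ξ) (w : Param d) :
    PrivateMoments (clippedGradientIID B ρ l w) B ξ (gradient loss w) := by
  have hm : Measurable fun z => clip (gradient (l z) w) :=
    measurable_clip.comp (measurable_gradient_left hlm w)
  have hsm : Measurable fun z : Fin B → 𝒟 => ∑ j, clip (gradient (l (z j)) w) :=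
    Finset.measurable_sum _ fun j _ => hm.comp (measurable_pi_apply j)
  have hC : MemLp (fun z => clip (gradient (l z) w)) 2 ρ :=
    MemLp.of_bound hm.aestronglyMeasurable 1 (.of_forall fun z => norm_clip_le_one _)
  have hY : ∀ _ : Fin B, MemLp (fun z => clip (gradient (l z) w)) 2 ρ := fun _ => hC
  refine ⟨memLp_id_map (memLp_sum_pi hY) hsm, fun r hr => ?_, ?_⟩
  · rw [clippedGradientIID, integral_id_map hsm, integral_sum_pi hY]
    simp only [Finset.sum_const, Finset.card_univ, Fintype.card_fin]
    rw [← Nat.cast_smul_eq_nsmul ℝ, inner_smul_right]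
    have := mul_le_mul_of_nonneg_left (clipGain_le_inner_integral_clip hlm hξ hn w hr)
      (Nat.cast_nonneg (α := ℝ) B)
    linarith
  -- Batches of fixed size satisfy the bound with B² alone; the extra B is there to cover Poisson
  -- batches.
  · rw [clippedGradientIID, integral_norm_sq_map hsm]
    have hb : ∀ z : Fin B → 𝒟, ‖∑ j, clip (gradient (l (z j)) w)‖ ^ 2 ≤ (B : ℝ) ^ 2 + B := by
      intro z
      have : ‖∑ j, clip (gradient (l (z j)) w)‖ ≤ B := by
        refine (norm_sum_le_of_le _ fun j _ => norm_clip_le_one _).trans ?_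
        simp
      have h2 : ‖∑ j, clip (gradient (l (z j)) w)‖ ^ 2 ≤ (B : ℝ) ^ 2 := by gcongr
      have : (0 : ℝ) ≤ B := Nat.cast_nonneg B
      linarith
    refine (integral_mono ((memLp_sum_pi hY).integrable_norm_pow (by norm_num))
      (integrable_const _) hb).trans ?_
    simp

lemma integral_empiricalLaw {n : ℕ} (s : Fin n → 𝒟) {f : 𝒟 → Param d} (hf : Measurable f) :
    ∫ z, f z ∂(empiricalLaw s) = (n : ℝ)⁻¹ • ∑ i, f (s i) := by
  rw [empiricalLaw, integral_smul_measure, integral_finsetSum_measure]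
  · simp only [integral_dirac' f _ hf.stronglyMeasurable]
    simp
  · intro i _
    exact (integrable_dirac' hf.stronglyMeasurable (by simp))

lemma isProbabilityMeasure_empiricalLaw {n : ℕ} (hn : 0 < n) (s : Fin n → 𝒟) :
    IsProbabilityMeasure (empiricalLaw s) := by
  refine ⟨?_⟩
  simp [empiricalLaw, ENNReal.inv_mul_cancel, hn.ne']

/-- The mean (B/n) ∑ c_i is B times the mean under the empirical law, so the i.i.d. gain estimate
carries over. The random batch size costs a variance of at most n · B/n = B. -/
lemma privateMoments_poisson
    (hlm : Measurable fun x : 𝒟 × Param d => gradient (l x.1) x.2) {n B : ℕ} (hB : 0 < B)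
    (hBn : B ≤ n) (s : Fin n → 𝒟) {loss : Param d → ℝ} {ξ : ℝ} (hξ : 0 ≤ ξ)
    (hn : GradientNoise (empiricalLaw s) l loss ξ) (w : Param d) :
    PrivateMoments (clippedGradientPoisson (samplingRate B n hBn) ⟨n, s⟩ l w) B ξ
      (gradient loss w) := by
  have hn0 : 0 < n := hB.trans_le hBn
  have hn' : (0 : ℝ) < n := by exact_mod_cast hn0
  have := isProbabilityMeasure_empiricalLaw hn0 s
  obtain ⟨c, hc⟩ : ∃ c : Fin n → Param d, c = fun i => clip (gradient (l (s i)) w) := ⟨_, rfl⟩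
  have hc1 : ∀ i, ‖c i‖ ≤ 1 := fun i => by rw [hc]; exact norm_clip_le_one _
  obtain ⟨P, hP⟩ : ∃ P : Measure Bool,
    P = bernoulliMeasure true false (samplingRate B n hBn) := ⟨_, rfl⟩
  have hPp : IsProbabilityMeasure P := by rw [hP]; infer_instance
  have hsm : Measurable fun b : Fin n → Bool => ∑ i, if b i = true then c i else 0 :=
    measurable_of_finite _
  have hY : ∀ i, MemLp (fun b : Bool => if b = true then c i else 0) 2 P := fun i =>
    MemLp.of_bound (measurable_of_finite _).aestronglyMeasurable 1
      (.of_forall fun b => by cases b <;> simp [hc1])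
  have hmean : ∀ i, ∫ b, (if b = true then c i else 0) ∂P = ((B : ℝ) / n) • c i := fun i => by
    rw [hP, integral_bernoulliMeasure]; simp [samplingRate]
  have hsq : ∀ i, ∫ b, ‖if b = true then c i else 0‖ ^ 2 ∂P = ((B : ℝ) / n) * ‖c i‖ ^ 2 :=
    fun i => by rw [hP, integral_bernoulliMeasure]; simp [samplingRate]
  have heq : clippedGradientPoisson (samplingRate B n hBn) ⟨n, s⟩ l w
      = (Measure.pi fun _ : Fin n => P).map fun b => ∑ i, if b i = true then c i else 0 := by
    rw [hP, hc]; rfl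
  rw [heq]
  refine ⟨memLp_id_map (memLp_sum_pi hY) hsm, fun r hr => ?_, ?_⟩
  · rw [integral_id_map hsm, integral_sum_pi hY]
    simp only [hmean]
    have h := clipGain_le_inner_integral_clip hlm hξ hn w hr
    have hcm : Measurable fun z => clip (gradient (l z) w) :=
      measurable_clip.comp (measurable_gradient_left hlm w)
    rw [integral_empiricalLaw s hcm] at h
    have hcs : ∑ i, clip (gradient (l (s i)) w) = ∑ i, c i := by rw [hc]
    rw [hcs] at h
    rw [← Finset.smul_sum, inner_smul_right]
    rw [inner_smul_right] at h
    have h2 := mul_le_mul_of_nonneg_left h (Nat.cast_nonneg (α := ℝ) B)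
    calc _ ≤ _ := h2
      _ = _ := by ring
  · rw [integral_norm_sq_map hsm, integral_norm_sum_sq_pi hY]
    simp only [hmean, hsq]
    have hsum : ‖∑ i, c i‖ ≤ n := by
      refine (norm_sum_le_of_le _ fun j _ => hc1 _).trans ?_
      simp
    refine add_le_add ?_ ?_
    · rw [← Finset.smul_sum, norm_smul, Real.norm_of_nonneg (by positivity)]
      have : (B : ℝ) / n * ‖∑ i, c i‖ ≤ B / n * n := by gcongr
      rw [div_mul_cancel₀ _ hn'.ne'] at this
      gcongr
    · have : ∀ i ∈ Finset.univ, (B : ℝ) / n * ‖c i‖ ^ 2 - ‖((B : ℝ) / n) • c i‖ ^ 2 ≤ B / n := by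
        intro i _
        have h1 : ‖c i‖ ^ 2 ≤ 1 := pow_le_one₀ (norm_nonneg _) (hc1 i)
        have h2 : (B : ℝ) / n * ‖c i‖ ^ 2 ≤ B / n := mul_le_of_le_one_right (by positivity) h1
        have := sq_nonneg ‖((B : ℝ) / n) • c i‖
        linarith
      refine (Finset.sum_le_sum this).trans (le_of_eq ?_)
      simp only [Finset.sum_const, Finset.card_univ, Fintype.card_fin, nsmul_eq_mul]
      field_simp

lemma integral_norm_sq_stdGaussian : ∫ z, ‖z‖ ^ 2 ∂(stdGaussian (Param d)) = d := by
  rw [← map_pi_eq_stdGaussian, integral_map (by fun_prop) (by fun_prop)]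
  simp only [EuclideanSpace.norm_sq_eq, Real.norm_eq_abs, sq_abs]
  have h2 : ∫ x, x ^ 2 ∂(gaussianReal 0 1) = 1 := by
    rw [← variance_of_integral_eq_zero (X := fun x => x) (by fun_prop) integral_id_gaussianReal,
      variance_fun_id_gaussianReal]
    simp
  have hi : Integrable (fun x : ℝ => x ^ 2) (gaussianReal 0 1) :=
    (memLp_id_gaussianReal (μ := 0) (v := 1) 2).integrable_sq
  rw [integral_finsetSum _ fun i _ => integrable_comp_eval (μ := fun _ : Fin d => gaussianReal 0 1)
    (i := i) hi]
  have e : ∀ i : Fin d, ∫ x : Fin d → ℝ, x i ^ 2 ∂(Measure.pi fun _ => gaussianReal 0 1) = 1 :=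
    fun i => (integral_comp_eval (μ := fun _ : Fin d => gaussianReal 0 1) (i := i)
      hi.aestronglyMeasurable).trans h2
  simp [e]

end GradientMoments

/-! ### Expected descent -/

section Descent

variable {d : ℕ}

/-- The mean of the quadratic upper model of the loss after one step. -/
lemma integral_quadratic_model {P Q : Measure (Param d)} [IsProbabilityMeasure P]
    [IsProbabilityMeasure Q] (hP : MemLp id 2 P) (hQ : MemLp id 2 Q) (a b σ c L : ℝ)
    (g : Param d) :
    Integrable (fun x : Param d × Param d × Param d =>
      c - inner ℝ g (a • x.1 + b • (x.2.1 + σ • x.2.2))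
        + L / 2 * ‖a • x.1 + b • (x.2.1 + σ • x.2.2)‖ ^ 2)
      (P.prod (Q.prod (stdGaussian (Param d)))) ∧
    ∫ x : Param d × Param d × Param d, (c - inner ℝ g (a • x.1 + b • (x.2.1 + σ • x.2.2))
        + L / 2 * ‖a • x.1 + b • (x.2.1 + σ • x.2.2)‖ ^ 2)
        ∂(P.prod (Q.prod (stdGaussian (Param d))))
      = c - (a * inner ℝ g (∫ x, x ∂P) + b * inner ℝ g (∫ y, y ∂Q))
        + L / 2 * (a ^ 2 * ∫ x, ‖x‖ ^ 2 ∂P + 2 * a * b * inner ℝ (∫ x, x ∂P) (∫ y, y ∂Q)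
          + b ^ 2 * (∫ y, ‖y‖ ^ 2 ∂Q + σ ^ 2 * d)) := by
  obtain ⟨Z, hZ⟩ : ∃ Z, Z = stdGaussian (Param d) := ⟨_, rfl⟩
  have hZp : IsProbabilityMeasure Z := by rw [hZ]; infer_instance
  have hZm : MemLp id 2 Z := by rw [hZ]; exact IsGaussian.memLp_id _ 2 (by norm_num)
  have hZ1 : ∫ z, z ∂Z = 0 := by rw [hZ]; exact integral_id_stdGaussian
  have hZ2 : ∫ z, ‖z‖ ^ 2 ∂Z = d := by rw [hZ]; exact integral_norm_sq_stdGaussian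
  rw [← hZ]
  have hσZ : MemLp (fun z : Param d => σ • z) 2 Z := hZm.const_smul σ
  have hQ' : MemLp (fun y : Param d => y) 2 Q := hQ
  have hU : MemLp (fun y : Param d × Param d => y.1 + σ • y.2) 2 (Q.prod Z) :=
    (hQ'.comp_fst Z).add (hσZ.comp_snd Q)
  have hY : MemLp (fun y : Param d × Param d => b • (y.1 + σ • y.2)) 2 (Q.prod Z) :=
    hU.const_smul b
  have hX : MemLp (fun x : Param d => a • x) 2 P := hP.const_smul a
  have hΔ : MemLp (fun x : Param d × Param d × Param d => a • x.1 + b • (x.2.1 + σ • x.2.2)) 2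
      (P.prod (Q.prod Z)) := (hX.comp_fst (Q.prod Z)).add (hY.comp_snd P)
  have hΔ1 := hΔ.integrable (by norm_num)
  have hΔ2 : Integrable (fun x : Param d × Param d × Param d =>
    ‖a • x.1 + b • (x.2.1 + σ • x.2.2)‖ ^ 2) (P.prod (Q.prod Z)) :=
    hΔ.integrable_norm_pow (by norm_num)
  have hi : Integrable (fun x : Param d × Param d × Param d =>
      c - inner ℝ g (a • x.1 + b • (x.2.1 + σ • x.2.2))) (P.prod (Q.prod Z)) :=
    (integrable_const c).sub (hΔ1.const_inner g)
  refine ⟨hi.add (hΔ2.const_mul (L / 2)), ?_⟩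
  have mX : ∫ x, a • x ∂P = a • ∫ x, x ∂P := integral_smul a _
  have mU : ∫ y : Param d × Param d, (y.1 + σ • y.2) ∂(Q.prod Z) = ∫ y, y ∂Q := by
    have i1 : Integrable (fun y : Param d × Param d => y.1) (Q.prod Z) :=
      (hQ'.integrable (by norm_num)).comp_fst Z
    have i2 : Integrable (fun y : Param d × Param d => σ • y.2) (Q.prod Z) :=
      (hσZ.integrable (by norm_num)).comp_snd Q
    rw [integral_add i1 i2, integral_smul, integral_fun_fst (fun y : Param d => y),
      integral_fun_snd (fun y : Param d => y), hZ1]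
    simp
  have mY : ∫ y : Param d × Param d, b • (y.1 + σ • y.2) ∂(Q.prod Z) = b • ∫ y, y ∂Q := by
    rw [integral_smul, mU]
  have mΔ : ∫ x : Param d × Param d × Param d, (a • x.1 + b • (x.2.1 + σ • x.2.2))
      ∂(P.prod (Q.prod Z)) = a • ∫ x, x ∂P + b • ∫ y, y ∂Q := by
    have i1 : Integrable (fun x : Param d × Param d × Param d => a • x.1) (P.prod (Q.prod Z)) :=
      (hX.integrable (by norm_num)).comp_fst (Q.prod Z)
    have i2 : Integrable (fun x : Param d × Param d × Param d => b • (x.2.1 + σ • x.2.2))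
        (P.prod (Q.prod Z)) := (hY.integrable (by norm_num)).comp_snd P
    rw [integral_add i1 i2, integral_fun_fst (fun x : Param d => a • x),
      integral_fun_snd (fun y : Param d × Param d => b • (y.1 + σ • y.2)), mX, mY]
    simp
  have sU : ∫ y : Param d × Param d, ‖y.1 + σ • y.2‖ ^ 2 ∂(Q.prod Z)
      = ∫ y, ‖y‖ ^ 2 ∂Q + σ ^ 2 * d := by
    rw [integral_norm_add_sq_prod hQ' hσZ, integral_smul, hZ1]
    simp only [norm_smul, mul_pow, Real.norm_eq_abs, sq_abs]
    rw [integral_const_mul, hZ2]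
    simp
  have sY : ∫ y : Param d × Param d, ‖b • (y.1 + σ • y.2)‖ ^ 2 ∂(Q.prod Z)
      = b ^ 2 * (∫ y, ‖y‖ ^ 2 ∂Q + σ ^ 2 * d) := by
    rw [← sU, ← integral_const_mul]
    simp only [norm_smul, mul_pow, Real.norm_eq_abs, sq_abs]
  have sX : ∫ x, ‖a • x‖ ^ 2 ∂P = a ^ 2 * ∫ x, ‖x‖ ^ 2 ∂P := by
    rw [← integral_const_mul]
    simp only [norm_smul, mul_pow, Real.norm_eq_abs, sq_abs]
  rw [integral_add hi (hΔ2.const_mul (L / 2)), integral_const_mul,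
    integral_norm_add_sq_prod hX hY, integral_sub (integrable_const c) (hΔ1.const_inner g),
    integral_inner hΔ1, mΔ, mX, mY, sX, sY, inner_add_right, inner_smul_right, inner_smul_right,
    inner_smul_right, inner_smul_left]
  simp only [integral_const, probReal_univ, one_smul, conj_trivial]
  ring

/-- The expected decrease of the loss in one step, for arbitrary laws of the public and the private
gradient with the right moments. -/
lemma lintegral_loss_step_add_le {B T : ℕ} (hB : 0 < B) (hT : 0 < T) {L L₀ ξ σ : ℝ} (hL : 0 < L)
    (hL₀ : 0 < L₀) (hξ : 0 ≤ ξ) {loss : Param d → ℝ} (hnn : ∀ w, 0 ≤ loss w)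
    (hsm : SmoothLoss loss L) {pub priv : Param d → Measure (Param d)} (w : Param d)
    [IsProbabilityMeasure (pub w)] [IsProbabilityMeasure (priv w)]
    (hp : MemLp id 2 (pub w)) (hp1 : ∫ x, x ∂(pub w) = (B : ℝ) • gradient loss w)
    (hp2 : ∫ x, ‖x‖ ^ 2 ∂(pub w) ≤ (B : ℝ) ^ 2 * ‖gradient loss w‖ ^ 2 + B * ξ ^ 2)
    (hq : PrivateMoments (priv w) B ξ (gradient loss w)) :
    ∫⁻ v, ENNReal.ofReal (loss v)
        ∂(stepLaw (publicRate B L T) (privateRate d B L L₀ σ T) σ pub priv w)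
      + ENNReal.ofReal ((1 - 1 / √T) * (1 / √T) * rateFun d B ξ L L₀ σ ‖gradient loss w‖)
      ≤ ENNReal.ofReal (loss w) + ENNReal.ofReal
        (1 / T * (ξ ^ 2 / (2 * B * L) + L₀ * (1 + B / (B ^ 2 + σ ^ 2 * d)))) := by
  obtain ⟨g, hg⟩ : ∃ g, g = gradient loss w := ⟨_, rfl⟩
  obtain ⟨q, hqT⟩ : ∃ q, q = 1 / √(T : ℝ) := ⟨_, rfl⟩
  obtain ⟨A, hA⟩ : ∃ A, A = gainWeight d B L L₀ σ := ⟨_, rfl⟩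
  have hT' : (0 : ℝ) < T := by exact_mod_cast hT
  have hB' : (0 : ℝ) < B := by exact_mod_cast hB
  have hsT : 0 < √(T : ℝ) := Real.sqrt_pos.2 hT'
  have hq0 : 0 < q := by rw [hqT]; positivity
  have hq1 : q ≤ 1 := by
    rw [hqT, div_le_one hsT, Real.one_le_sqrt]
    exact_mod_cast hT
  have hq2 : q ^ 2 = 1 / T := by rw [hqT, div_pow, Real.sq_sqrt hT'.le, one_pow]
  have hA0 : 0 < A := by rw [hA]; exact gainWeight_pos d B hL hL₀ σ
  have hA2 : A ^ 2 = L₀ / (2 * L * (1 + σ ^ 2 * d / (B : ℝ) ^ 2)) := by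
    rw [hA, gainWeight, Real.sq_sqrt (by positivity)]
  have hpubr : publicRate B L T = q / (B * L) := by rw [publicRate, hqT]; field_simp
  have hprivr : privateRate d B L L₀ σ T = 2 * A * q / B := by
    rw [privateRate]
    congr 1
    rw [Real.sqrt_eq_iff_mul_self_eq (by positivity) (by positivity)]
    have : 2 * A * q * (2 * A * q) = 4 * A ^ 2 * q ^ 2 := by ring
    rw [this, hA2, hq2]
    field_simp
    norm_num
  have hden : 0 < (B : ℝ) ^ 2 + σ ^ 2 * d := by positivity
  -- The private learning rate is tuned so that the leading part of its quadratic error is exactly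
  -- q² L₀, that is L₀ over T steps.
  have hnoise : L / 2 * (2 * A * q / B) ^ 2 * ((B : ℝ) ^ 2 + B + σ ^ 2 * d)
      = q ^ 2 * (L₀ * (1 + B / (B ^ 2 + σ ^ 2 * d))) := by
    have e1 : L / 2 * (2 * A * q / B) ^ 2 * ((B : ℝ) ^ 2 + B + σ ^ 2 * d)
      = 2 * L * A ^ 2 * q ^ 2 / B ^ 2 * ((B : ℝ) ^ 2 + B + σ ^ 2 * d) := by
      field_simp
    have e2 : 1 + σ ^ 2 * d / (B : ℝ) ^ 2 = ((B : ℝ) ^ 2 + σ ^ 2 * d) / B ^ 2 := by field_simp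
    rw [e1, hA2, e2]
    field_simp
    ring
  rw [hpubr, hprivr, stepLaw, lintegral_map (hsm.1.continuous.measurable.ennreal_ofReal)
    (by fun_prop)]
  obtain ⟨hint, hval⟩ := integral_quadratic_model hp hq.memLp (q / (B * L)) (2 * A * q / B) σ
    (loss w) L g
  have hmodel : ∀ Δ : Param d, loss (w - Δ) ≤ loss w - inner ℝ g Δ + L / 2 * ‖Δ‖ ^ 2 := by
    intro Δ
    have := hsm.2 w (w - Δ)
    rw [← hg, sub_sub_cancel_left, sub_sub_cancel, inner_neg_right] at this
    linarith
  have hb : ∫⁻ x, ENNReal.ofReal (loss (w - ((q / (B * L)) • x.1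
        + (2 * A * q / B) • (x.2.1 + σ • x.2.2))))
        ∂((pub w).prod ((priv w).prod (stdGaussian (Param d))))
      ≤ ENNReal.ofReal (loss w - (q / (B * L) * inner ℝ g ((B : ℝ) • g)
          + 2 * A * q / B * inner ℝ g (∫ y, y ∂(priv w)))
        + L / 2 * ((q / (B * L)) ^ 2 * ∫ x, ‖x‖ ^ 2 ∂(pub w)
          + 2 * (q / (B * L)) * (2 * A * q / B) * inner ℝ ((B : ℝ) • g) (∫ y, y ∂(priv w))
          + (2 * A * q / B) ^ 2 * (∫ y, ‖y‖ ^ 2 ∂(priv w) + σ ^ 2 * d))) := by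
    rw [hp1, ← hg] at hval
    rw [← hval, ofReal_integral_eq_lintegral_ofReal hint
      (.of_forall fun x => (hnn _).trans (hmodel _))]
    exact lintegral_mono fun x => ENNReal.ofReal_le_ofReal (hmodel _)
  rw [← hg] at hp2
  have hFr := rateFun_eq (d := d) (B := B) hL hL₀ hξ σ (norm_nonneg g)
  rw [← hA] at hFr
  have hgain : B * bestGain ξ ‖g‖ ≤ 2 * inner ℝ g (∫ y, y ∂(priv w)) := by
    rw [bestGain, Real.mul_iSup_of_nonneg hB'.le]
    exact ciSup_le fun r => by rw [hg]; exact hq.gain r r.2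
  have hsnd := hq.second_moment
  rw [← hg, ← hqT]
  refine (add_le_add_left hb _).trans ?_
  have hFnn : 0 ≤ (1 - q) * q * rateFun d B ξ L L₀ σ ‖g‖ :=
    mul_nonneg (mul_nonneg (by linarith) hq0.le) (rateFun_nonneg hL hL₀ hξ σ (norm_nonneg g))
  obtain ⟨I, hI⟩ : ∃ I, I = inner ℝ g (∫ y, y ∂(priv w)) := ⟨_, rfl⟩
  obtain ⟨V, hV⟩ : ∃ V, V = ∫ y, ‖y‖ ^ 2 ∂(priv w) := ⟨_, rfl⟩
  obtain ⟨U, hU⟩ : ∃ U, U = ∫ x, ‖x‖ ^ 2 ∂(pub w) := ⟨_, rfl⟩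
  rw [← hI] at hgain
  rw [← hV] at hsnd
  rw [← hU] at hp2
  -- The terms `t1` to `t6` match up the public noise, the private noise, the cross term, and the
  -- two parts of the rate function.
  have hmain : loss w - (q / (B * L) * inner ℝ g ((B : ℝ) • g) + 2 * A * q / B * I)
        + L / 2 * ((q / (B * L)) ^ 2 * U
          + 2 * (q / (B * L)) * (2 * A * q / B) * inner ℝ ((B : ℝ) • g) (∫ y, y ∂(priv w))
          + (2 * A * q / B) ^ 2 * (V + σ ^ 2 * d))
      + (1 - q) * q * rateFun d B ξ L L₀ σ ‖g‖
      ≤ loss w + q ^ 2 * (ξ ^ 2 / (2 * B * L) + L₀ * (1 + B / (B ^ 2 + σ ^ 2 * d))) := by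
    rw [inner_smul_right, inner_smul_left, real_inner_self_eq_norm_sq, ← hI, hFr]
    simp only [conj_trivial]
    have t1 : L / 2 * ((q / (B * L)) ^ 2 * U)
        ≤ q ^ 2 / (2 * L) * ‖g‖ ^ 2 + q ^ 2 * (ξ ^ 2 / (2 * B * L)) := by
      calc L / 2 * ((q / (B * L)) ^ 2 * U)
          ≤ L / 2 * ((q / (B * L)) ^ 2 * ((B : ℝ) ^ 2 * ‖g‖ ^ 2 + B * ξ ^ 2)) := by gcongr
        _ = _ := by field_simp
    have t2 : L / 2 * ((2 * A * q / B) ^ 2 * (V + σ ^ 2 * d))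
        ≤ q ^ 2 * (L₀ * (1 + B / (B ^ 2 + σ ^ 2 * d))) := by
      rw [← hnoise, mul_assoc (L / 2)]
      gcongr
    -- The cross term of public and private gradients eats the fraction q of the private gain; this
    -- is the origin of the factor 1 - q.
    have t3 : L / 2 * (2 * (q / (B * L)) * (2 * A * q / B) * (B * I)) = q * (2 * A * q / B * I) := by
      field_simp
    have t4 : q / (B * L) * (B * ‖g‖ ^ 2) = q / L * ‖g‖ ^ 2 := by field_simp
    have t5 : (1 - q) * q * (A * bestGain ξ ‖g‖) ≤ (1 - q) * (2 * A * q / B * I) := by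
      have hc : 0 ≤ (1 - q) * (A * q / B) := mul_nonneg (by linarith) (by positivity)
      have := mul_le_mul_of_nonneg_left hgain hc
      calc (1 - q) * q * (A * bestGain ξ ‖g‖) = (1 - q) * (A * q / B) * (B * bestGain ξ ‖g‖) := by
            field_simp
        _ ≤ _ := this
        _ = _ := by ring
    -- The public decrease (q/L)‖g‖² covers both quadratic terms with (q/(2L))‖g‖² to spare.
    have t6 : q ^ 2 / (2 * L) * ‖g‖ ^ 2 + (1 - q) * q * (1 / (2 * L) * ‖g‖ ^ 2)
        ≤ q / L * ‖g‖ ^ 2 := by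
      have e : q / L * ‖g‖ ^ 2 - (q ^ 2 / (2 * L) * ‖g‖ ^ 2
        + (1 - q) * q * (1 / (2 * L) * ‖g‖ ^ 2)) = q / (2 * L) * ‖g‖ ^ 2 := by
        field_simp
        ring
      have : 0 ≤ q / (2 * L) * ‖g‖ ^ 2 := by positivity
      linarith
    rw [t4, mul_add (L / 2), mul_add (L / 2), t3, mul_add ((1 - q) * q)]
    have e : q ^ 2 * (ξ ^ 2 / (2 * B * L) + L₀ * (1 + B / (B ^ 2 + σ ^ 2 * d)))
      = q ^ 2 * (ξ ^ 2 / (2 * B * L)) + q ^ 2 * (L₀ * (1 + B / (B ^ 2 + σ ^ 2 * d))) := by ring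
    rw [e]
    linarith
  rw [← hI, ← hV, ← hU, ← hq2, ← ENNReal.ofReal_add (hnn w) (by positivity)]
  -- The mean of the quadratic model lies above that of the nonnegative loss, which is needed to add
  -- it inside `ENNReal.ofReal`.
  have hmod : 0 ≤ ∫ x : Param d × Param d × Param d, (loss w
      - inner ℝ g ((q / (B * L)) • x.1 + (2 * A * q / B) • (x.2.1 + σ • x.2.2))
      + L / 2 * ‖(q / (B * L)) • x.1 + (2 * A * q / B) • (x.2.1 + σ • x.2.2)‖ ^ 2)
      ∂((pub w).prod ((priv w).prod (stdGaussian (Param d)))) :=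
    integral_nonneg fun x => (hnn _).trans (hmodel _)
  rw [hval, hp1, ← hg, ← hI, ← hV, ← hU] at hmod
  rw [← ENNReal.ofReal_add hmod hFnn]
  exact ENNReal.ofReal_le_ofReal hmain

/-- Telescoping the expected decrease along a trajectory. -/
lemma lintegral_sum_trajectoryLaw_le {step : Param d → Measure (Param d)} (hs : Measurable step)
    (hp : ∀ w, IsProbabilityMeasure (step w)) (w₀ : Param d) {V F : Param d → ENNReal}
    (hV : Measurable V) (hF : Measurable F) {b : ENNReal}
    (h : ∀ w, ∫⁻ v, V v ∂(step w) + F w ≤ V w + b) (T : ℕ) :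
    ∫⁻ x, (V (x (Fin.last T)) + ∑ t : Fin T, F (x t.castSucc)) ∂(trajectoryLaw step w₀ T)
      ≤ V w₀ + T * b := by
  induction T with
  | zero =>
    rw [trajectoryLaw, lintegral_dirac' _ (by fun_prop)]
    simp
  | succ T ih =>
    rw [lintegral_trajectoryLaw_succ hs hp w₀ T (by fun_prop)]
    have e : ∀ x : Fin (T + 1) → Param d, ∫⁻ w, (V ((Fin.snoc (α := fun _ => Param d) x w :
          Fin (T + 2) → Param d) (Fin.last (T + 1)))
        + ∑ t : Fin (T + 1), F ((Fin.snoc (α := fun _ => Param d) x w :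
          Fin (T + 2) → Param d) t.castSucc)) ∂(step (x (Fin.last T)))
        ≤ (V (x (Fin.last T)) + ∑ t : Fin T, F (x t.castSucc)) + b := by
      intro x
      have := hp (x (Fin.last T))
      simp only [Fin.snoc_last, Fin.snoc_castSucc]
      rw [lintegral_add_left hV, lintegral_const, measure_univ, mul_one, Fin.sum_univ_castSucc]
      calc _ = ∫⁻ v, V v ∂(step (x (Fin.last T))) + F (x (Fin.last T))
            + ∑ t : Fin T, F (x t.castSucc) := by ring
        _ ≤ V (x (Fin.last T)) + b + ∑ t : Fin T, F (x t.castSucc) := add_le_add (h _) le_rfl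
        _ = _ := by ring
    have := isProbabilityMeasure_trajectoryLaw hs hp w₀ T
    calc _ ≤ ∫⁻ x, ((V (x (Fin.last T)) + ∑ t : Fin T, F (x t.castSucc)) + b)
          ∂(trajectoryLaw step w₀ T) := lintegral_mono e
      _ ≤ V w₀ + T * b + b := by
        rw [lintegral_add_right _ measurable_const, lintegral_const, measure_univ, mul_one]
        gcongr
      _ = _ := by push_cast; ring

lemma measurable_gradient (loss : Param d → ℝ) : Measurable (gradient loss) := by
  have h := measurable_fderiv ℝ loss
  exact (InnerProductSpace.toDual ℝ (Param d)).symm.continuous.measurable.comp h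

/-- The gradient norm bound, for arbitrary laws of the public and the private gradient with the
right moments. -/
lemma gradientNormBound_of_moments {n B : ℕ} (hd : 0 < d) (hB : 0 < B) (hBn : B ≤ n)
    {μ L L₀ ξ : ℝ} (hμ : 0 < μ) (hL : 0 < L) (hL₀ : 0 < L₀) (hξ : 0 ≤ ξ) {loss : Param d → ℝ}
    (hnn : ∀ w, 0 ≤ loss w) (hsm : SmoothLoss loss L) {w₀ : Param d} (hw₀ : loss w₀ = L₀)
    {pub priv : Param d → Measure (Param d)} (hm : Measurable pub) (hm' : Measurable priv)
    (hpr : ∀ w, IsProbabilityMeasure (pub w)) (hpr' : ∀ w, IsProbabilityMeasure (priv w))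
    (hp : ∀ w, MemLp id 2 (pub w) ∧ ∫ x, x ∂(pub w) = (B : ℝ) • gradient loss w ∧
      ∫ x, ‖x‖ ^ 2 ∂(pub w) ≤ (B : ℝ) ^ 2 * ‖gradient loss w‖ ^ 2 + B * ξ ^ 2)
    (hq : ∀ w, PrivateMoments (priv w) B ξ (gradient loss w)) :
    GradientNormBound d B ξ L L₀ (noiseMultiplier n B μ) loss
      (fun T => trajectoryLaw (stepLaw (publicRate B L T)
        (privateRate d B L L₀ (noiseMultiplier n B μ T) T) (noiseMultiplier n B μ T) pub priv)
        w₀ T) := by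
  intro ε hε
  have hB' : (0 : ℝ) < B := by exact_mod_cast hB
  have hd' : (0 : ℝ) < d := by exact_mod_cast hd
  have hlim : Tendsto (fun T : ℕ => (1 + B / ((B : ℝ) ^ 2 + noiseMultiplier n B μ T ^ 2 * d))
      / (1 - 1 / √(T : ℝ))) atTop (𝓝 1) := by
    have h1 : Tendsto (fun T : ℕ => (B : ℝ) / ((B : ℝ) ^ 2 + noiseMultiplier n B μ T ^ 2 * d))
        atTop (𝓝 0) := by
      refine tendsto_const_nhds.div_atTop ?_
      exact tendsto_atTop_add_const_left _ _
        ((tendsto_noiseMultiplier_sq hB hBn hμ).atTop_mul_const hd')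
    have h2 : Tendsto (fun T : ℕ => 1 / √(T : ℝ)) atTop (𝓝 0) :=
      tendsto_const_nhds.div_atTop (Real.tendsto_sqrt_atTop.comp tendsto_natCast_atTop_atTop)
    have := (h1.const_add 1).div (h2.const_sub 1) (by norm_num)
    rw [add_zero, sub_zero, div_one] at this
    exact this
  -- Both conditions concern T only, so the threshold is uniform in c, which is introduced
  -- afterwards and cancels in the end.
  filter_upwards [hlim.eventually (gt_mem_nhds (show (1 : ℝ) < 1 + ε by linarith)),
    eventually_gt_atTop 1] with T hTε hT c hc
  have hT0 : 0 < T := by omega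
  have hT' : (0 : ℝ) < T := by exact_mod_cast hT0
  have hT1 : (1 : ℝ) < T := by exact_mod_cast hT
  have hsT : 0 < √(T : ℝ) := Real.sqrt_pos.2 hT'
  have hsT1 : 1 < √(T : ℝ) := by rw [Real.lt_sqrt zero_le_one]; simpa using hT1
  obtain ⟨σ, hσ⟩ : ∃ σ, σ = noiseMultiplier n B μ T := ⟨_, rfl⟩
  obtain ⟨K, hK⟩ : ∃ K, K = 2 * L₀ + ξ ^ 2 / (2 * B * L) := ⟨_, rfl⟩
  have hK0 : 0 < K := by rw [hK]; positivity
  rw [← hσ] at hTε ⊢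
  rw [← hK]
  obtain ⟨step, hstep⟩ : ∃ step, step = stepLaw (publicRate B L T)
    (privateRate d B L L₀ σ T) σ pub priv := ⟨_, rfl⟩
  have hs : Measurable step := by rw [hstep]; exact measurable_stepLaw _ _ _ hm hm' hpr hpr'
  have hsp : ∀ w, IsProbabilityMeasure (step w) := by
    rw [hstep]; exact isProbabilityMeasure_stepLaw _ _ _ hpr hpr'
  rw [← hstep]
  obtain ⟨a, ha⟩ : ∃ a, a = (1 - 1 / √(T : ℝ)) * (1 / √(T : ℝ)) := ⟨_, rfl⟩
  have hq1 : 0 < 1 - 1 / √(T : ℝ) := by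
    rw [sub_pos, div_lt_one hsT]; exact hsT1
  have ha0 : 0 < a := by rw [ha]; positivity
  obtain ⟨b, hb⟩ : ∃ b, b = ξ ^ 2 / (2 * B * L) + L₀ * (1 + B / (B ^ 2 + σ ^ 2 * d)) := ⟨_, rfl⟩
  have hb0 : 0 ≤ b := by rw [hb]; positivity
  obtain ⟨R, hR⟩ : ∃ R : Param d → ℝ, R = fun w => rateFun d B ξ L L₀ σ ‖gradient loss w‖ :=
    ⟨_, rfl⟩
  have hRm : Measurable R := by
    rw [hR]; exact (measurable_rateFun_norm hL hL₀ hξ σ).comp (measurable_gradient loss)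
  have hdesc : ∀ w, ∫⁻ v, ENNReal.ofReal (loss v) ∂(step w) + ENNReal.ofReal (a * R w)
      ≤ ENNReal.ofReal (loss w) + ENNReal.ofReal (1 / T * b) := by
    intro w
    have := hpr w
    have := hpr' w
    rw [ha, hb, hR, hstep]
    exact lintegral_loss_step_add_le hB hT0 hL hL₀ hξ hnn hsm w (hp w).1 (hp w).2.1 (hp w).2.2
      (hq w)
  have htel := lintegral_sum_trajectoryLaw_le hs hsp w₀
    hsm.1.continuous.measurable.ennreal_ofReal (hRm.const_mul a).ennreal_ofReal hdesc T
  obtain ⟨P, hP⟩ : ∃ P, P = trajectoryLaw step w₀ T := ⟨_, rfl⟩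
  have hPp : IsProbabilityMeasure P := by
    rw [hP]; exact isProbabilityMeasure_trajectoryLaw hs hsp w₀ T
  rw [← hP] at htel ⊢
  obtain ⟨y, hy⟩ : ∃ y, y = K / (c * √(T : ℝ)) := ⟨_, rfl⟩
  have hy0 : 0 < y := by rw [hy]; positivity
  rw [← hy]
  obtain ⟨m, hmdef⟩ : ∃ m, m = ⨅ t : Fin (T + 1), P.real {h | rateInv d B ξ L L₀ σ y
      < ‖gradient loss (h t)‖} := ⟨_, rfl⟩
  rw [← hmdef]
  have hm_le : ∀ t : Fin (T + 1), m ≤ P.real {h | rateInv d B ξ L L₀ σ y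
      < ‖gradient loss (h t)‖} := fun t => by
    rw [hmdef]
    exact ciInf_le ⟨0, by rintro _ ⟨t, rfl⟩; exact measureReal_nonneg⟩ t
  -- Markov's inequality for `rateFun` of the gradient norm at level y; the event in terms of
  -- `rateInv` is contained in {y ≤ R} by monotonicity.
  have hmarkov : ∀ t : Fin (T + 1), ENNReal.ofReal (a * y) * ENNReal.ofReal m
      ≤ ∫⁻ x, ENNReal.ofReal (a * R (x t)) ∂P := by
    intro t
    refine le_trans ?_ (mul_meas_ge_le_lintegral ((hRm.const_mul a).ennreal_ofReal.comp
      (measurable_pi_apply t)) (ENNReal.ofReal (a * y)))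
    gcongr
    refine (ENNReal.ofReal_le_ofReal (hm_le t)).trans ?_
    rw [ofReal_measureReal]
    refine measure_mono fun h hh => ?_
    have := le_rateFun_of_rateInv_lt hL hL₀ hξ σ hy0.le (norm_nonneg _) hh
    refine ENNReal.ofReal_le_ofReal (mul_le_mul_of_nonneg_left ?_ ha0.le)
    rw [hR]
    exact this
  -- Only the first T of the T + 1 iterates enter the telescoped sum; the minimum m bounds each of
  -- them from below.
  have hsum : ENNReal.ofReal (T * (a * y * m)) ≤ ENNReal.ofReal (L₀ + b) := by
    calc ENNReal.ofReal (T * (a * y * m))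
        = ∑ _t : Fin T, ENNReal.ofReal (a * y) * ENNReal.ofReal m := by
          rw [Finset.sum_const, Finset.card_univ, Fintype.card_fin, nsmul_eq_mul,
            ENNReal.ofReal_mul hT'.le, ENNReal.ofReal_mul (by positivity), ENNReal.ofReal_natCast]
      _ ≤ ∑ t : Fin T, ∫⁻ x, ENNReal.ofReal (a * R (x t.castSucc)) ∂P :=
          Finset.sum_le_sum fun t _ => hmarkov _
      _ = ∫⁻ x, ∑ t : Fin T, ENNReal.ofReal (a * R (x t.castSucc)) ∂P := by
          rw [lintegral_finsetSum _ fun t _ => by fun_prop]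
      _ ≤ _ := (lintegral_mono fun x => le_add_self).trans htel
      _ = ENNReal.ofReal (L₀ + b) := by
          rw [hw₀, ← ENNReal.ofReal_natCast T, ← ENNReal.ofReal_mul hT'.le,
            ← ENNReal.ofReal_add hL₀.le (by positivity)]
          congr 2
          field_simp
  have hle : T * (a * y * m) ≤ L₀ + b := (ENNReal.ofReal_le_ofReal_iff (by positivity)).1 hsum
  obtain ⟨δ, hδ⟩ : ∃ δ, δ = B / ((B : ℝ) ^ 2 + σ ^ 2 * d) := ⟨_, rfl⟩
  have hδ0 : 0 ≤ δ := by rw [hδ]; positivity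
  rw [← hδ] at hTε hb
  have hLb : L₀ + b ≤ K * (1 + δ) := by
    rw [hb, hK]
    have : 0 ≤ ξ ^ 2 / (2 * B * L) := by positivity
    nlinarith
  have hTay : T * (a * y * m) = K * (1 - 1 / √(T : ℝ)) / c * m := by
    have hTs : (T : ℝ) = √(T : ℝ) * √(T : ℝ) := (Real.mul_self_sqrt hT'.le).symm
    rw [ha, hy]
    nth_rewrite 1 [hTs]
    field_simp
  rw [div_lt_iff₀ hq1] at hTε
  have h1 : K * (1 - 1 / √(T : ℝ)) / c * m ≤ K * ((1 + ε) * (1 - 1 / √(T : ℝ))) := by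
    rw [← hTay]
    exact hle.trans (hLb.trans (mul_le_mul_of_nonneg_left hTε.le hK0.le))
  have hKq : 0 < K * (1 - 1 / √(T : ℝ)) := by positivity
  have h2 : K * (1 - 1 / √(T : ℝ)) * (m / c) ≤ K * (1 - 1 / √(T : ℝ)) * (1 + ε) := by
    calc _ = K * (1 - 1 / √(T : ℝ)) / c * m := by ring
      _ ≤ _ := h1
      _ = _ := by ring
  have h3 := le_of_mul_le_mul_left h2 hKq
  rwa [div_le_iff₀ hc] at h3

end Descent

/-! ### The chi-square inequality -/

section ChiSquare

/-- `Q` has chi-square divergence at most `K - 1` from `P`, in the form of a Cauchy–Schwarz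
inequality for test functions. -/
def ChiSqLE {Y : Type*} [MeasurableSpace Y] (Q P : Measure Y) (K : ENNReal) : Prop :=
  ∀ f : Y → ENNReal, Measurable f → (∫⁻ y, f y ∂Q) ^ 2 ≤ K * ∫⁻ y, f y ^ 2 ∂P

variable {Y Z : Type*} [MeasurableSpace Y] [MeasurableSpace Z]

lemma lintegral_mul_sq_le (P : Measure Y) {f g : Y → ENNReal} (hf : Measurable f)
    (hg : Measurable g) :
    (∫⁻ y, f y * g y ∂P) ^ 2 ≤ (∫⁻ y, f y ^ 2 ∂P) * ∫⁻ y, g y ^ 2 ∂P := by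
  have h := ENNReal.lintegral_mul_le_Lp_mul_Lq P Real.HolderConjugate.two_two hf.aemeasurable
    hg.aemeasurable
  simp only [Pi.mul_apply, ENNReal.rpow_two] at h
  have hsq : ∀ x : ENNReal, (x ^ (1 / 2 : ℝ)) ^ 2 = x := fun x => by
    rw [← ENNReal.rpow_natCast, ← ENNReal.rpow_mul]; norm_num
  calc _ ≤ _ := pow_le_pow_left₀ bot_le h 2
    _ = _ := by rw [mul_pow, hsq, hsq]

lemma lintegral_sq_le (P : Measure Y) [IsProbabilityMeasure P] {f : Y → ENNReal}
    (hf : Measurable f) : (∫⁻ y, f y ∂P) ^ 2 ≤ ∫⁻ y, f y ^ 2 ∂P := by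
  simpa using lintegral_mul_sq_le P hf measurable_const (g := fun _ => 1)

/-- Data processing: Jensen's inequality for the kernel replaces the square of the mean by the mean
of the square. -/
lemma ChiSqLE.bind {Q P : Measure Y} {K : ENNReal} (h : ChiSqLE Q P K) {κ : Y → Measure Z}
    (hκ : Measurable κ) (hp : ∀ y, IsProbabilityMeasure (κ y)) :
    ChiSqLE (Q.bind κ) (P.bind κ) K := by
  intro f hf
  rw [Measure.lintegral_bind hκ.aemeasurable hf.aemeasurable,
    Measure.lintegral_bind hκ.aemeasurable (hf.pow_const 2).aemeasurable]
  refine (h _ ((Measure.measurable_lintegral hf).comp hκ)).trans ?_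
  gcongr with y
  have := hp y
  exact lintegral_sq_le _ hf

lemma measurable_lintegral_snoc {d : ℕ} {step : Param d → Measure (Param d)}
    (hs : Measurable step) (hp : ∀ w, IsProbabilityMeasure (step w)) (T : ℕ)
    {f : (Fin (T + 2) → Param d) → ENNReal} (hf : Measurable f) :
    Measurable fun h : Fin (T + 1) → Param d =>
      ∫⁻ w, f (Fin.snoc (α := fun _ => Param d) h w) ∂(step (h (Fin.last T))) := by
  have e : ∀ h : Fin (T + 1) → Param d,
      ∫⁻ w, f (Fin.snoc (α := fun _ => Param d) h w) ∂(step (h (Fin.last T)))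
      = ∫⁻ x, f x ∂((step (h (Fin.last T))).map
        fun w => (Fin.snoc (α := fun _ => Param d) h w : Fin (T + 2) → Param d)) := fun h => by
    have hm : Measurable fun w => (Fin.snoc (α := fun _ => Param d) h w : Fin (T + 2) → Param d) :=
      (measurable_snoc T).comp measurable_prodMk_left
    rw [lintegral_map hf hm]
  simp only [e]
  exact (Measure.measurable_lintegral hf).comp (measurable_trajectory_step hs hp T)

/-- Apply the one-step inequality to the last transition, conditionally on the past, then induct.
Since K is uniform in the current point, the constants multiply although the steps are adaptive. -/
lemma ChiSqLE.trajectoryLaw {d : ℕ} {s s' : Param d → Measure (Param d)} (hs : Measurable s)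
    (hs' : Measurable s') (hp : ∀ w, IsProbabilityMeasure (s w))
    (hp' : ∀ w, IsProbabilityMeasure (s' w)) {K : ENNReal} (h : ∀ w, ChiSqLE (s w) (s' w) K)
    (w₀ : Param d) (T : ℕ) :
    ChiSqLE (trajectoryLaw s w₀ T) (trajectoryLaw s' w₀ T) (K ^ T) := by
  induction T with
  | zero =>
    intro f hf
    rw [MixedTraining.trajectoryLaw, MixedTraining.trajectoryLaw, lintegral_dirac' _ hf,
      lintegral_dirac' _ (hf.pow_const 2)]
    simp
  | succ T ih =>
    intro f hf
    rw [lintegral_trajectoryLaw_succ hs hp w₀ T hf,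
      lintegral_trajectoryLaw_succ hs' hp' w₀ T (hf.pow_const 2)]
    refine (ih _ (measurable_lintegral_snoc hs hp T hf)).trans ?_
    rw [pow_succ, mul_assoc,
      ← lintegral_const_mul _ (measurable_lintegral_snoc hs' hp' T (hf.pow_const 2))]
    gcongr with x
    have hm : Measurable fun w => (Fin.snoc (α := fun _ => Param d) x w : Fin (T + 2) → Param d) :=
      (measurable_snoc T).comp measurable_prodMk_left
    exact h _ _ (hf.comp hm)

lemma ChiSqLE.sq_integral_le {Q P : Measure Y} [IsProbabilityMeasure Q] [IsProbabilityMeasure P]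
    {K : ℝ} (hK : 0 ≤ K) (h : ChiSqLE Q P (ENNReal.ofReal K)) {ψ : Y → ℝ} (hψ : Measurable ψ)
    {C : ℝ} (hb : ∀ y, |ψ y| ≤ C) : (∫ y, ψ y ∂Q) ^ 2 ≤ K * ∫ y, ψ y ^ 2 ∂P := by
  have hiQ : Integrable (fun y => |ψ y|) Q :=
    integrable_of_norm_le hψ.abs.aestronglyMeasurable C fun y => by simpa using hb y
  have hiP : Integrable (fun y => ψ y ^ 2) P :=
    integrable_of_norm_le (hψ.pow_const 2).aestronglyMeasurable (C ^ 2) fun y => by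
      rw [norm_pow, Real.norm_eq_abs]; exact pow_le_pow_left₀ (abs_nonneg _) (hb y) 2
  have h1 : (∫ y, ψ y ∂Q) ^ 2 ≤ (∫ y, |ψ y| ∂Q) ^ 2 := by
    rw [← sq_abs (∫ y, ψ y ∂Q)]
    exact pow_le_pow_left₀ (abs_nonneg _) abs_integral_le_integral_abs 2
  have h2 := h (fun y => ENNReal.ofReal |ψ y|) hψ.abs.ennreal_ofReal
  have e : ∀ y, ENNReal.ofReal |ψ y| ^ 2 = ENNReal.ofReal (ψ y ^ 2) := fun y => by
    rw [← ENNReal.ofReal_pow (abs_nonneg _), sq_abs]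
  simp only [e] at h2
  rw [← ofReal_integral_eq_lintegral_ofReal hiQ (.of_forall fun y => abs_nonneg _),
    ← ofReal_integral_eq_lintegral_ofReal hiP (.of_forall fun y => sq_nonneg _),
    ← ENNReal.ofReal_pow (integral_nonneg fun y => abs_nonneg _), ← ENNReal.ofReal_mul hK,
    ENNReal.ofReal_le_ofReal_iff (mul_nonneg hK (integral_nonneg fun y => sq_nonneg _))] at h2
  exact h1.trans h2

/-- The chi-square inequality bounds the total variation distance. -/
lemma ChiSqLE.abs_integral_sub_le {Q P : Measure Y} [IsProbabilityMeasure Q]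
    [IsProbabilityMeasure P] {k : ℝ} (hk : 0 < k) (h : ChiSqLE Q P (ENNReal.ofReal (1 + k)))
    {φ : Y → ℝ} (hφ : Measurable φ) (h01 : ∀ y, 0 ≤ φ y ∧ φ y ≤ 1) :
    |∫ y, φ y ∂Q - ∫ y, φ y ∂P| ≤ √k := by
  have hi : ∀ R : Measure Y, IsProbabilityMeasure R → Integrable φ R := fun R _ =>
    integrable_of_norm_le hφ.aestronglyMeasurable 1 fun y => by
      rw [Real.norm_of_nonneg (h01 y).1]; exact (h01 y).2
  have hiQ := hi Q inferInstance
  have hiP := hi P inferInstance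
  obtain ⟨m, hm⟩ : ∃ m, m = ∫ y, φ y ∂P := ⟨_, rfl⟩
  obtain ⟨D, hD⟩ : ∃ D, D = ∫ y, φ y ∂Q - m := ⟨_, rfl⟩
  have hm0 : 0 ≤ m := by rw [hm]; exact integral_nonneg fun y => (h01 y).1
  have hm1 : m ≤ 1 := by
    rw [hm]
    refine (integral_mono hiP (integrable_const 1) fun y => (h01 y).2).trans ?_
    simp
  have hb : ∀ y, |φ y - m| ≤ 1 := fun y => by
    rw [abs_le]; constructor <;> linarith [(h01 y).1, (h01 y).2]
  have hiP2 : Integrable (fun y => (φ y - m) ^ 2) P :=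
    integrable_of_norm_le (by fun_prop) 1 fun y => by
      rw [norm_pow, Real.norm_eq_abs]; exact pow_le_one₀ (abs_nonneg _) (hb y)
  have hV : ∫ y, (φ y - m) ^ 2 ∂P ≤ 1 := by
    refine (integral_mono hiP2 (integrable_const 1) fun y => ?_).trans (by simp)
    rw [← sq_abs]; exact pow_le_one₀ (abs_nonneg _) (hb y)
  -- The inequality is tested on φ - m shifted by a free constant u; without the shift the constant
  -- 1 + k would not become small.
  have key : ∀ u : ℝ, (D + u) ^ 2 ≤ (1 + k) * (∫ y, (φ y - m) ^ 2 ∂P + u ^ 2) := by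
    intro u
    have h1 := h.sq_integral_le (by linarith) (ψ := fun y => φ y - m + u) (by fun_prop)
      (C := 1 + |u|) fun y => (abs_add_le _ _).trans (add_le_add (hb y) le_rfl)
    have e1 : ∫ y, (φ y - m + u) ∂Q = D + u := by
      have i1 : Integrable (fun y => φ y - m) Q := hiQ.sub (integrable_const m)
      rw [integral_add i1 (integrable_const u),
        integral_sub hiQ (integrable_const m), hD]
      simp
    have e2 : ∫ y, (φ y - m + u) ^ 2 ∂P = ∫ y, (φ y - m) ^ 2 ∂P + u ^ 2 := by
      have e3 : ∀ y, (φ y - m + u) ^ 2 = (φ y - m) ^ 2 + (2 * u * (φ y - m) + u ^ 2) :=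
        fun y => by ring
      simp only [e3]
      have i1 : Integrable (fun y => 2 * u * (φ y - m)) P :=
        (hiP.sub (integrable_const m)).const_mul _
      have i2 : Integrable (fun y => 2 * u * (φ y - m) + u ^ 2) P := i1.add (integrable_const _)
      rw [integral_add hiP2 i2, integral_add i1 (integrable_const _),
        integral_const_mul, integral_sub hiP (integrable_const m), ← hm]
      simp
    rwa [e1, e2] at h1
  rw [← hm, ← hD]
  refine Real.abs_le_sqrt ?_
  -- At u = D/k the inequality reduces to D²/k ≤ Var_P(φ) ≤ 1.
  have h2 := key (D / k)
  have e1 : (D + D / k) ^ 2 = (1 + k) * ((1 + k) * (D / k) ^ 2) := by field_simp; ring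
  rw [e1] at h2
  have h3 := le_of_mul_le_mul_left h2 (by linarith : 0 < 1 + k)
  have h4 : k * (D / k) ^ 2 ≤ 1 := by linarith
  have h5 : k * (D / k) ^ 2 = D ^ 2 / k := by field_simp
  rw [h5, div_le_one hk] at h4
  exact h4

end ChiSquare

/-! ### Gaussian computations -/

section Gaussian

/-- Change of measure by the likelihood ratio of N(a, 1) with respect to N(c, 1). -/
lemma lintegral_gaussianReal_shift (a c : ℝ) {f : ℝ → ENNReal} (hf : Measurable f) :
    ∫⁻ x, f x ∂(gaussianReal a 1) = ∫⁻ x, f x *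
      ENNReal.ofReal (Real.exp ((a - c) * (x - c) - (a - c) ^ 2 / 2)) ∂(gaussianReal c 1) := by
  rw [gaussianReal_of_var_ne_zero _ one_ne_zero, gaussianReal_of_var_ne_zero _ one_ne_zero,
    lintegral_withDensity_eq_lintegral_mul _ (measurable_gaussianPDF _ _) hf,
    lintegral_withDensity_eq_lintegral_mul _ (measurable_gaussianPDF _ _) (by fun_prop)]
  refine lintegral_congr fun x => ?_
  simp only [Pi.mul_apply]
  rw [mul_comm (f x), ← mul_assoc, gaussianPDF, gaussianPDF,
    ← ENNReal.ofReal_mul (gaussianPDFReal_nonneg _ _ _)]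
  congr 2
  rw [gaussianPDFReal, gaussianPDFReal, mul_assoc _ (Real.exp _) (Real.exp _), ← Real.exp_add]
  congr 2
  simp
  ring

lemma lintegral_exp_gaussianReal (a b c : ℝ) :
    ∫⁻ x, ENNReal.ofReal (Real.exp ((b - c) * (x - c) - (b - c) ^ 2 / 2)) ∂(gaussianReal a 1)
      = ENNReal.ofReal (Real.exp ((a - c) * (b - c))) := by
  have e : ∀ x : ℝ, Real.exp ((b - c) * (x - c) - (b - c) ^ 2 / 2)
      = Real.exp (-(b - c) * c - (b - c) ^ 2 / 2) * Real.exp ((b - c) * x) := fun x => by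
    rw [← Real.exp_add]; congr 1; ring
  simp only [e]
  rw [← ofReal_integral_eq_lintegral_ofReal ((integrable_exp_mul_gaussianReal (b - c)).const_mul _)
    (.of_forall fun x => by positivity), integral_const_mul]
  have h := congrFun (mgf_fun_id_gaussianReal (μ := a) (v := 1)) (b - c)
  rw [mgf] at h
  rw [h, ← Real.exp_add]
  congr 2
  simp
  ring

/-- The mixture of `N(a, 1)` and `N(b, 1)` with weights `p` and `1 - p`. -/
def gaussianMix (p : unitInterval) (a b : ℝ) : Measure ℝ :=
  unitInterval.toNNReal p • gaussianReal a 1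
    + unitInterval.toNNReal (unitInterval.symm p) • gaussianReal b 1

lemma lintegral_mix {Y : Type*} [MeasurableSpace Y] (p : unitInterval) (P Q : Measure Y)
    (f : Y → ENNReal) :
    ∫⁻ x, f x ∂(unitInterval.toNNReal p • P + unitInterval.toNNReal (unitInterval.symm p) • Q)
      = ENNReal.ofReal p * ∫⁻ x, f x ∂P + ENNReal.ofReal (1 - p) * ∫⁻ x, f x ∂Q := by
  have h : ∀ q : unitInterval, ((unitInterval.toNNReal q : NNReal) : ENNReal)
      = ENNReal.ofReal q := fun q => by
    rw [← ENNReal.ofReal_coe_nnreal]; rfl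
  rw [lintegral_add_measure]
  simp only [ENNReal.smul_def, h, unitInterval.coe_symm_eq, lintegral_smul_measure, smul_eq_mul]

instance isProbabilityMeasure_gaussianMix (p : unitInterval) (a b : ℝ) :
    IsProbabilityMeasure (gaussianMix p a b) := by
  refine ⟨?_⟩
  rw [← lintegral_one, gaussianMix, lintegral_mix]
  simp only [lintegral_one, measure_univ, mul_one]
  rw [← ENNReal.ofReal_add p.2.1 (by linarith [p.2.2])]
  simp

/-- Cauchy–Schwarz with the likelihood ratio ρ of the mixture. Its second moment is computed as the
mean of ρ under the mixture itself, a combination of four exponentials. -/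
lemma chiSqLE_gaussianMix (p : unitInterval) (a b c : ℝ) :
    ChiSqLE (gaussianMix p a b) (gaussianReal c 1)
      (ENNReal.ofReal ((p : ℝ) * (p * Real.exp ((a - c) * (a - c))
        + (1 - p) * Real.exp ((a - c) * (b - c)))
        + (1 - p) * (p * Real.exp ((b - c) * (a - c)) + (1 - p) * Real.exp ((b - c) * (b - c))))) := by
  have hp0 := p.2.1
  have hp1 : 0 ≤ 1 - (p : ℝ) := by linarith [p.2.2]
  obtain ⟨r, hr⟩ : ∃ r : ℝ → ℝ → ENNReal, r = fun s x =>
    ENNReal.ofReal (Real.exp ((s - c) * (x - c) - (s - c) ^ 2 / 2)) := ⟨_, rfl⟩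
  have hrm : ∀ s, Measurable (r s) := fun s => by rw [hr]; fun_prop
  obtain ⟨ρ, hρ⟩ : ∃ ρ : ℝ → ENNReal, ρ = fun x =>
    ENNReal.ofReal p * r a x + ENNReal.ofReal (1 - p) * r b x := ⟨_, rfl⟩
  have hρm : Measurable ρ := by
    rw [hρ]; exact ((hrm a).const_mul _).add ((hrm b).const_mul _)
  have hd : ∀ f : ℝ → ENNReal, Measurable f →
      ∫⁻ x, f x ∂(gaussianMix p a b) = ∫⁻ x, f x * ρ x ∂(gaussianReal c 1) := by
    intro f hf
    have hra := hrm a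
    have hrb := hrm b
    rw [gaussianMix, lintegral_mix, lintegral_gaussianReal_shift a c hf,
      lintegral_gaussianReal_shift b c hf, ← lintegral_const_mul _ (by fun_prop),
      ← lintegral_const_mul _ (by fun_prop), ← lintegral_add_left (by fun_prop)]
    refine lintegral_congr fun x => ?_
    rw [hρ, hr]
    ring
  have hexp : ∀ s t, ∫⁻ x, r t x ∂(gaussianReal s 1)
      = ENNReal.ofReal (Real.exp ((s - c) * (t - c))) := fun s t => by
    rw [hr]; exact lintegral_exp_gaussianReal s t c
  have hρs : ∀ s, ∫⁻ x, ρ x ∂(gaussianReal s 1)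
      = ENNReal.ofReal (p * Real.exp ((s - c) * (a - c)) + (1 - p) * Real.exp ((s - c) * (b - c))) := by
    intro s
    rw [hρ, lintegral_add_left ((hrm a).const_mul _), lintegral_const_mul _ (hrm a),
      lintegral_const_mul _ (hrm b), hexp, hexp, ← ENNReal.ofReal_mul hp0, ← ENNReal.ofReal_mul hp1,
      ← ENNReal.ofReal_add (by positivity) (by positivity)]
  intro f hf
  rw [hd f hf]
  refine (lintegral_mul_sq_le _ hf hρm).trans ?_
  rw [mul_comm]
  gcongr
  simp only [pow_two]
  rw [← hd ρ hρm, gaussianMix, lintegral_mix, hρs, hρs, ← ENNReal.ofReal_mul hp0,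
    ← ENNReal.ofReal_mul hp1, ← ENNReal.ofReal_add (by positivity) (by positivity)]

lemma exp_le_one_add_add_sq {x : ℝ} (hx : |x| ≤ 1) : Real.exp x ≤ 1 + x + x ^ 2 := by
  have h := Real.abs_exp_sub_one_sub_id_le hx
  have := (abs_le.1 h).2
  linarith

/-- The subsampled Gaussian is close to second order to the Gaussian with the same mean. -/
lemma chiSqLE_gaussianMix_mean (p : unitInterval) {θ : ℝ} (hθ : θ ^ 2 ≤ 1) :
    ChiSqLE (gaussianMix p θ 0) (gaussianReal (p * θ) 1) (ENNReal.ofReal (1 + θ ^ 4)) := by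
  intro f hf
  refine (chiSqLE_gaussianMix p θ 0 (p * θ) f hf).trans ?_
  refine mul_le_mul_left (ENNReal.ofReal_le_ofReal ?_) _
  obtain ⟨q, hq⟩ : ∃ q : ℝ, q = p := ⟨_, rfl⟩
  have hq0 : 0 ≤ q := by rw [hq]; exact p.2.1
  have hq1 : q ≤ 1 := by rw [hq]; exact p.2.2
  rw [← hq]
  obtain ⟨s, hs⟩ : ∃ s : ℝ, s = θ ^ 2 := ⟨_, rfl⟩
  have hs0 : 0 ≤ s := by rw [hs]; positivity
  rw [← hs] at hθ
  have e4 : θ ^ 4 = s ^ 2 := by rw [hs]; ring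
  have e1 : (θ - q * θ) * (θ - q * θ) = s * (1 - q) ^ 2 := by rw [hs]; ring
  have e2 : (θ - q * θ) * (0 - q * θ) = -(s * (q * (1 - q))) := by rw [hs]; ring
  have e2' : (0 - q * θ) * (θ - q * θ) = -(s * (q * (1 - q))) := by rw [hs]; ring
  have e3 : (0 - q * θ) * (0 - q * θ) = s * q ^ 2 := by rw [hs]; ring
  rw [e4, e1, e2, e2', e3]
  have hr0 : 0 ≤ 1 - q := by linarith
  have hq2 : q ^ 2 ≤ 1 := pow_le_one₀ hq0 hq1
  have hr2 : (1 - q) ^ 2 ≤ 1 := pow_le_one₀ hr0 (by linarith)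
  have hqr : q * (1 - q) ≤ 1 := mul_le_one₀ hq1 hr0 (by linarith)
  have hqr0 : 0 ≤ q * (1 - q) := mul_nonneg hq0 hr0
  have a1 := exp_le_one_add_add_sq (x := s * (1 - q) ^ 2)
    (by rw [abs_of_nonneg (by positivity)]; exact mul_le_one₀ hθ (by positivity) hr2)
  have a2 := exp_le_one_add_add_sq (x := -(s * (q * (1 - q))))
    (by rw [abs_neg, abs_of_nonneg (by positivity)]; exact mul_le_one₀ hθ hqr0 hqr)
  have a3 := exp_le_one_add_add_sq (x := s * q ^ 2)
    (by rw [abs_of_nonneg (by positivity)]; exact mul_le_one₀ hθ (by positivity) hq2)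
  -- The reference Gaussian has the mean of the mixture, so the terms linear in s cancel; what
  -- remains is s² (q(1 - q))².
  calc q * (q * Real.exp (s * (1 - q) ^ 2) + (1 - q) * Real.exp (-(s * (q * (1 - q)))))
        + (1 - q) * (q * Real.exp (-(s * (q * (1 - q)))) + (1 - q) * Real.exp (s * q ^ 2))
      ≤ q * (q * (1 + s * (1 - q) ^ 2 + (s * (1 - q) ^ 2) ^ 2)
          + (1 - q) * (1 + -(s * (q * (1 - q))) + (-(s * (q * (1 - q)))) ^ 2))
        + (1 - q) * (q * (1 + -(s * (q * (1 - q))) + (-(s * (q * (1 - q)))) ^ 2)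
          + (1 - q) * (1 + s * q ^ 2 + (s * q ^ 2) ^ 2)) := by gcongr
    _ = 1 + s ^ 2 * (q * (1 - q)) ^ 2 := by ring
    _ ≤ 1 + s ^ 2 := by
      have : (q * (1 - q)) ^ 2 ≤ 1 := pow_le_one₀ hqr0 hqr
      nlinarith [sq_nonneg s]

lemma chiSqLE_gaussianReal (μ : ℝ) :
    ChiSqLE (gaussianReal μ 1) (gaussianReal 0 1) (ENNReal.ofReal (Real.exp (μ ^ 2))) := by
  have h := chiSqLE_gaussianMix 1 μ 0 0
  have e : gaussianMix 1 μ 0 = gaussianReal μ 1 := by simp [gaussianMix]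
  rw [e] at h
  simpa [pow_two] using h

lemma charFunDual_gaussianReal (m : ℝ) (L : StrongDual ℝ ℝ) :
    charFunDual (gaussianReal m 1) L = Complex.exp (L m * Complex.I - (L 1) ^ 2 / 2) := by
  rw [charFunDual_eq_charFun_map_one, gaussianReal_map_continuousLinearMap, charFun_gaussianReal]
  congr 1
  simp [max_eq_left (sq_nonneg (L 1))]

/-- Rotating a pair of independent Gaussians. -/
lemma gaussianReal_prod_map_rotation (m : ℝ) {c s : ℝ} (hcs : c ^ 2 + s ^ 2 = 1) :
    ((gaussianReal m 1).prod (gaussianReal 0 1)).map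
      (fun x : ℝ × ℝ => (c * x.1 + s * x.2, s * x.1 - c * x.2))
      = (gaussianReal (c * m) 1).prod (gaussianReal (s * m) 1) := by
  obtain ⟨R, hR⟩ : ∃ R : ℝ × ℝ →L[ℝ] ℝ × ℝ, ∀ x, R x = (c * x.1 + s * x.2, s * x.1 - c * x.2) :=
    ⟨((c • ContinuousLinearMap.fst ℝ ℝ ℝ + s • ContinuousLinearMap.snd ℝ ℝ ℝ).prod
      (s • ContinuousLinearMap.fst ℝ ℝ ℝ - c • ContinuousLinearMap.snd ℝ ℝ ℝ)), fun x => by simp⟩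
  have e : (fun x : ℝ × ℝ => (c * x.1 + s * x.2, s * x.1 - c * x.2)) = R := by
    funext x; rw [hR]
  rw [e]
  have : IsFiniteMeasure (((gaussianReal m 1).prod (gaussianReal 0 1)).map R) :=
    Measure.isFiniteMeasure_map _ _
  refine Measure.ext_of_charFunDual ?_
  ext L
  rw [charFunDual_map, charFunDual_prod, charFunDual_prod, charFunDual_gaussianReal,
    charFunDual_gaussianReal, charFunDual_gaussianReal, charFunDual_gaussianReal,
    ← Complex.exp_add, ← Complex.exp_add]
  obtain ⟨α, hα⟩ : ∃ α, α = L (1, 0) := ⟨_, rfl⟩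
  obtain ⟨β, hβ⟩ : ∃ β, β = L (0, 1) := ⟨_, rfl⟩
  have hL : ∀ x y : ℝ, L (x, y) = x * α + y * β := fun x y => by
    have : ((x, y) : ℝ × ℝ) = x • ((1 : ℝ), (0 : ℝ)) + y • ((0 : ℝ), (1 : ℝ)) := by simp
    rw [this, map_add, map_smul, map_smul, hα, hβ]; simp
  congr 1
  simp only [ContinuousLinearMap.comp_apply, ContinuousLinearMap.inl_apply,
    ContinuousLinearMap.inr_apply, hR, hL]
  push_cast
  have hcs' : (c : ℂ) ^ 2 + (s : ℂ) ^ 2 = 1 := by exact_mod_cast hcs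
  linear_combination (-((α : ℂ) ^ 2 + (β : ℂ) ^ 2) / 2) * hcs'

variable {d : ℕ}

/-- The part of the standard Gaussian `z` that is added to `y • a` to give a standard Gaussian. -/
def residual (a z : Param d) : Param d := z - (1 / (1 + √(1 - ‖a‖ ^ 2)) * inner ℝ a z) • a

lemma stdGaussian_eq_map_residual {a : Param d} (ha : ‖a‖ ≤ 1) :
    ((gaussianReal 0 1).prod (stdGaussian (Param d))).map
      (fun x : ℝ × Param d => x.1 • a + residual a x.2) = stdGaussian (Param d) := by
  obtain ⟨k, hk⟩ : ∃ k, k = 1 / (1 + √(1 - ‖a‖ ^ 2)) := ⟨_, rfl⟩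
  -- This equation for k says that (I - k aaᵀ)² = I - aaᵀ. The residual thus has exactly the
  -- covariance that y • a lacks. Writing k with 1 + √(1 - ‖a‖²) in the denominator keeps it defined
  -- at a = 0.
  have hk2 : k ^ 2 * ‖a‖ ^ 2 - 2 * k + 1 = 0 := by
    have h1 : 0 ≤ 1 - ‖a‖ ^ 2 := by
      have := pow_le_one₀ (norm_nonneg a) ha (n := 2); linarith
    obtain ⟨q, hq⟩ : ∃ q, q = √(1 - ‖a‖ ^ 2) := ⟨_, rfl⟩
    have hq0 : 0 ≤ q := by rw [hq]; positivity
    have hq2 : ‖a‖ ^ 2 = 1 - q ^ 2 := by rw [hq, Real.sq_sqrt h1]; ring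
    rw [hk, ← hq, hq2]
    have : 1 + q ≠ 0 := by positivity
    field_simp
    ring
  have hmeas : Measurable fun x : ℝ × Param d => x.1 • a + residual a x.2 := by
    unfold residual; fun_prop
  have : IsFiniteMeasure (((gaussianReal 0 1).prod (stdGaussian (Param d))).map
    (fun x : ℝ × Param d => x.1 • a + residual a x.2)) := Measure.isFiniteMeasure_map _ _
  refine Measure.ext_of_charFun ?_
  ext t
  -- The residual map is self-adjoint; u is its value at t.
  obtain ⟨u, hu⟩ : ∃ u : Param d, u = t - (k * inner ℝ a t) • a := ⟨_, rfl⟩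
  have hin : ∀ x : ℝ × Param d, inner ℝ (x.1 • a + residual a x.2) t
      = x.1 * inner ℝ a t + inner ℝ x.2 u := fun x => by
    rw [residual, ← hk, hu, inner_add_left, inner_sub_left, inner_sub_right, real_inner_smul_left,
      real_inner_smul_left, inner_smul_right, real_inner_comm x.2 a]
    ring
  have hun : ‖u‖ ^ 2 = ‖t‖ ^ 2 - (inner ℝ a t) ^ 2 := by
    rw [hu, norm_sub_sq_real, inner_smul_right, norm_smul, mul_pow, Real.norm_eq_abs, sq_abs,
      real_inner_comm a t]
    linear_combination (inner ℝ a t) ^ 2 * hk2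
  rw [charFun_apply, integral_map hmeas.aemeasurable (by fun_prop)]
  simp only [hin]
  have e : ∀ x : ℝ × Param d, Complex.exp (((x.1 * inner ℝ a t + inner ℝ x.2 u : ℝ) : ℂ) * Complex.I)
      = Complex.exp ((inner ℝ x.1 (inner ℝ a t) : ℝ) * Complex.I)
        * Complex.exp ((inner ℝ x.2 u : ℝ) * Complex.I) := fun x => by
    rw [← Complex.exp_add]
    congr 1
    simp [mul_comm]
    ring
  simp only [e]
  rw [integral_prod_mul (fun y : ℝ => Complex.exp ((inner ℝ y (inner ℝ a t) : ℝ) * Complex.I))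
    (fun z : Param d => Complex.exp ((inner ℝ z u : ℝ) * Complex.I)), ← charFun_apply,
    ← charFun_apply, charFun_gaussianReal, charFun_stdGaussian, charFun_stdGaussian,
    ← Complex.exp_add]
  congr 1
  have hun' : (‖u‖ : ℂ) ^ 2 = (‖t‖ : ℂ) ^ 2 - ((inner ℝ a t : ℝ) : ℂ) ^ 2 := by exact_mod_cast hun
  rw [hun']
  simp
  ring

end Gaussian

/-! ### Trade-off functions -/

section Tradeoff

variable {Y Z : Type*} [MeasurableSpace Y] [MeasurableSpace Z]

lemma tradeoff_le {P Q : Measure Y} [IsProbabilityMeasure Q] {α : ℝ} {φ : Y → ℝ}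
    (hφ : Measurable φ) (h01 : ∀ y, 0 ≤ φ y ∧ φ y ≤ 1) (hα : ∫ y, φ y ∂P ≤ α) :
    tradeoff P Q α ≤ 1 - ∫ y, φ y ∂Q := by
  refine csInf_le ⟨0, ?_⟩ ⟨φ, hφ, h01, hα, rfl⟩
  rintro _ ⟨ψ, hψ, hψ01, -, rfl⟩
  have hi : Integrable ψ Q := integrable_of_norm_le hψ.aestronglyMeasurable 1 fun y => by
    rw [Real.norm_of_nonneg (hψ01 y).1]; exact (hψ01 y).2
  have := integral_mono hi (integrable_const 1) fun y => (hψ01 y).2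
  simp only [integral_const, probReal_univ, one_smul] at this
  linarith

lemma le_tradeoff {P Q : Measure Y} {α b : ℝ} (hα : 0 ≤ α)
    (h : ∀ φ : Y → ℝ, Measurable φ → (∀ y, 0 ≤ φ y ∧ φ y ≤ 1) → ∫ y, φ y ∂P ≤ α →
      b ≤ 1 - ∫ y, φ y ∂Q) : b ≤ tradeoff P Q α := by
  refine le_csInf ⟨1, fun _ => 0, measurable_const, fun _ => ⟨le_rfl, zero_le_one⟩, by simpa,
    by simp⟩ ?_
  rintro _ ⟨φ, hφ, h01, hP, rfl⟩
  exact h φ hφ h01 hP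

/-- Post-processing does not make testing easier. -/
lemma tradeoff_le_tradeoff_bind (P Q : Measure Y) [IsProbabilityMeasure P]
    [IsProbabilityMeasure Q] {κ : Y → Measure Z} (hκ : Measurable κ)
    (hp : ∀ y, IsProbabilityMeasure (κ y)) {α : ℝ} (hα : 0 ≤ α) :
    tradeoff P Q α ≤ tradeoff (P.bind κ) (Q.bind κ) α := by
  let K : Kernel Y Z := ⟨κ, hκ⟩
  have : IsMarkovKernel K := ⟨hp⟩
  refine le_tradeoff hα fun φ hφ h01 hφα => ?_
  have hnorm : ∀ z, ‖φ z‖ ≤ 1 := fun z => by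
    rw [Real.norm_of_nonneg (h01 z).1]; exact (h01 z).2
  have hi : ∀ R : Measure Z, IsProbabilityMeasure R → Integrable φ R := fun R _ =>
    integrable_of_norm_le hφ.aestronglyMeasurable 1 hnorm
  have hint : ∀ W : Measure Y, IsProbabilityMeasure W →
      ∫ z, φ z ∂(W.bind κ) = ∫ y, ∫ z, φ z ∂(κ y) ∂W := fun W _ => by
    have h := Kernel.integral_comp (κ := Kernel.const Unit W) (η := K) (a := ()) (f := φ)
      (hi _ inferInstance)
    rwa [Kernel.comp_apply, Kernel.const_apply] at h
  rw [hint P inferInstance] at hφα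
  rw [hint Q inferInstance]
  refine tradeoff_le ?_ (fun y => ⟨integral_nonneg fun z => (h01 z).1, ?_⟩) hφα
  · exact (StronglyMeasurable.integral_kernel (κ := K) hφ.stronglyMeasurable).measurable
  · have := hp y
    refine (integral_mono (hi _ inferInstance) (integrable_const 1) fun z => (h01 z).2).trans ?_
    simp

lemma tradeoff_le_tradeoff_map (P Q : Measure Y) [IsProbabilityMeasure Q] {g : Y → Z}
    (hg : Measurable g) {α : ℝ} (hα : 0 ≤ α) :
    tradeoff P Q α ≤ tradeoff (P.map g) (Q.map g) α := by
  refine le_tradeoff hα fun φ hφ h01 hφα => ?_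
  rw [integral_map hg.aemeasurable hφ.aestronglyMeasurable] at hφα ⊢
  exact tradeoff_le (hφ.comp hg) (fun y => h01 (g y)) hφα

/-- Scaling by c = m/μ and adding independent noise of variance 1 - c² turns the pair N(0, 1), N(μ,
1) into N(0, 1), N(m, 1). -/
lemma gaussianTradeoff_le_of_le {m μ : ℝ} (hm : 0 ≤ m) (hμ : 0 < μ) (hmμ : m ≤ μ) {α : ℝ}
    (hα : 0 ≤ α) : gaussianTradeoff μ α ≤ gaussianTradeoff m α := by
  obtain ⟨c, hc⟩ : ∃ c, c = m / μ := ⟨_, rfl⟩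
  have hc0 : 0 ≤ c := by rw [hc]; positivity
  have hc1 : c ≤ 1 := by rw [hc, div_le_one hμ]; exact hmμ
  have hcs : c ^ 2 + √(1 - c ^ 2) ^ 2 = 1 := by
    rw [Real.sq_sqrt (by have := pow_le_one₀ hc0 hc1 (n := 2); linarith)]; ring
  have hcm : c * μ = m := by rw [hc]; field_simp
  have hmap : ∀ a : ℝ, (gaussianReal a 1).bind
      (fun u => (gaussianReal 0 1).map fun v => c * u + √(1 - c ^ 2) * v)
      = gaussianReal (c * a) 1 := by
    intro a
    have h := congrArg (Measure.map Prod.fst) (gaussianReal_prod_map_rotation a hcs)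
    rw [Measure.map_map (by fun_prop) (by fun_prop), Measure.map_fst_prod] at h
    simp only [measure_univ, one_smul] at h
    rw [← h]
    refine Measure.ext_of_lintegral _ fun f hf => ?_
    rw [Measure.lintegral_bind, lintegral_map hf (by fun_prop), lintegral_prod _ (by fun_prop)]
    · refine lintegral_congr fun u => ?_
      rw [lintegral_map hf (by fun_prop)]
      rfl
    · exact (measurable_map_of_measurable (f := fun u v => c * u + √(1 - c ^ 2) * v)
        measurable_const (fun _ => inferInstance) (by unfold Function.uncurry; fun_prop)).aemeasurable
    · exact hf.aemeasurable
  have h := tradeoff_le_tradeoff_bind (gaussianReal 0 1) (gaussianReal μ 1)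
    (κ := fun u => (gaussianReal 0 1).map fun v => c * u + √(1 - c ^ 2) * v)
    (measurable_map_of_measurable (f := fun u v => c * u + √(1 - c ^ 2) * v)
        measurable_const (fun _ => inferInstance) (by unfold Function.uncurry; fun_prop))
    (fun u => Measure.isProbabilityMeasure_map (by fun_prop)) hα
  rwa [hmap, hmap, hcm, mul_zero] at h

/-- The reflection x ↦ m - x exchanges the two Gaussians. -/
lemma gaussianTradeoff_le_symm (m : ℝ) {α : ℝ} (hα : 0 ≤ α) :
    gaussianTradeoff m α ≤ tradeoff (gaussianReal m 1) (gaussianReal 0 1) α := by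
  have h := tradeoff_le_tradeoff_map (gaussianReal 0 1) (gaussianReal m 1)
    (g := fun x => m - x) (by fun_prop) hα
  rwa [gaussianReal_map_const_sub, gaussianReal_map_const_sub, sub_zero, sub_self] at h

/-- A quantitative continuity of the Gaussian trade-off function. -/
lemma gaussianTradeoff_sub_le (μ : ℝ) {α δ : ℝ} (hα : 0 ≤ α) (hδ : 0 < δ) :
    gaussianTradeoff μ α - Real.exp (μ ^ 2 / 2) * √δ ≤ gaussianTradeoff μ (α + δ) := by
  refine le_tradeoff (by linarith) fun φ hφ h01 hφα => ?_
  have hαδ : 0 < α + δ := by linarith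
  obtain ⟨E, hE⟩ : ∃ E, E = ∫ y, φ y ∂(gaussianReal μ 1) := ⟨_, rfl⟩
  have hi : Integrable φ (gaussianReal 0 1) :=
    integrable_of_norm_le hφ.aestronglyMeasurable 1 fun y => by
      rw [Real.norm_of_nonneg (h01 y).1]; exact (h01 y).2
  have hi2 : Integrable (fun y => φ y ^ 2) (gaussianReal 0 1) :=
    integrable_of_norm_le (hφ.pow_const 2).aestronglyMeasurable 1 fun y => by
      rw [Real.norm_of_nonneg (sq_nonneg _)]; exact pow_le_one₀ (h01 y).1 (h01 y).2
  have h2 : E ^ 2 ≤ Real.exp (μ ^ 2) * (α + δ) := by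
    have h := (chiSqLE_gaussianReal μ).sq_integral_le (by positivity) hφ (C := 1) fun y => by
      rw [abs_of_nonneg (h01 y).1]; exact (h01 y).2
    rw [← hE] at h
    refine h.trans (mul_le_mul_of_nonneg_left (le_trans ?_ hφα) (by positivity))
    exact integral_mono hi2 hi fun y => pow_le_of_le_one (h01 y).1 (h01 y).2 two_ne_zero
  have hEle : E ≤ Real.exp (μ ^ 2 / 2) * √(α + δ) := by
    refine abs_le_of_sq_le_sq' ?_ (by positivity) |>.2
    have e : ((2 : ℕ) : ℝ) * (μ ^ 2 / 2) = μ ^ 2 := by push_cast; ring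
    rw [mul_pow, Real.sq_sqrt hαδ.le, ← Real.exp_nat_mul, e]
    exact h2
  -- Scaling the test by α/(α + δ) brings its level back to α. The lost power δE/(α + δ) is small
  -- even for small α, since E ≤ exp(μ²/2) √(α + δ).
  have h3 := tradeoff_le (P := gaussianReal 0 1) (Q := gaussianReal μ 1) (α := α)
    (φ := fun y => α / (α + δ) * φ y) (hφ.const_mul _) (fun y => ⟨?_, ?_⟩) ?_
  · rw [integral_const_mul, ← hE] at h3
    rw [← hE]
    have h4 : δ / (α + δ) * E ≤ Real.exp (μ ^ 2 / 2) * √δ := by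
      calc δ / (α + δ) * E ≤ δ / (α + δ) * (Real.exp (μ ^ 2 / 2) * √(α + δ)) := by gcongr
        _ = Real.exp (μ ^ 2 / 2) * (δ / √(α + δ)) := by
          rw [div_mul_eq_mul_div, mul_left_comm, mul_div_assoc, mul_div_assoc,
            Real.sqrt_div_self', mul_one_div]
        _ ≤ Real.exp (μ ^ 2 / 2) * (δ / √δ) := by gcongr; linarith
        _ = _ := by rw [Real.div_sqrt]
    have h5 : α / (α + δ) * E = E - δ / (α + δ) * E := by field_simp; ring
    rw [gaussianTradeoff]
    linarith
  · exact mul_nonneg (by positivity) (h01 y).1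
  · exact mul_le_one₀ ((div_le_one hαδ).2 (by linarith)) (h01 y).1 (h01 y).2
  · rw [integral_const_mul]
    calc α / (α + δ) * ∫ y, φ y ∂(gaussianReal 0 1) ≤ α / (α + δ) * (α + δ) := by gcongr
      _ = α := by field_simp

end Tradeoff

/-! ### Chains driven by scalar noise -/

section ScalarNoise

variable {d : ℕ}

lemma measurable_bind_of_measurable {α β γ : Type*} [MeasurableSpace α] [MeasurableSpace β]
    [MeasurableSpace γ] {κ : α → Measure β} (hκ : Measurable κ)
    (hp : ∀ a, IsProbabilityMeasure (κ a)) {ζ : α → β → Measure γ}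
    (hζ : Measurable (Function.uncurry ζ)) : Measurable fun a => (κ a).bind (ζ a) := by
  let K : Kernel α β := ⟨κ, hκ⟩
  have : IsMarkovKernel K := ⟨hp⟩
  refine Measure.measurable_of_measurable_coe _ fun s hs => ?_
  have hζa : ∀ a, Measurable (ζ a) := fun a => hζ.comp measurable_prodMk_left
  have e : ∀ a, (κ a).bind (ζ a) s = ∫⁻ b, ζ a b s ∂(K a) := fun a =>
    Measure.bind_apply hs (hζa a).aemeasurable
  simp only [e]
  exact Measurable.lintegral_kernel_prod_right' (κ := K)
    (f := fun x : α × β => ζ x.1 x.2 s) ((Measure.measurable_coe hs).comp hζ)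

lemma isProbabilityMeasure_bind {β γ : Type*} [MeasurableSpace β] [MeasurableSpace γ]
    (P : Measure β) [IsProbabilityMeasure P] {ζ : β → Measure γ} (hζ : Measurable ζ)
    (hp : ∀ b, IsProbabilityMeasure (ζ b)) : IsProbabilityMeasure (P.bind ζ) := by
  refine ⟨?_⟩
  rw [Measure.bind_apply .univ hζ.aemeasurable]
  simp

variable {κ : Param d → ℝ → Measure (Param d)}

lemma measurable_scalarStep (hκ : Measurable (Function.uncurry κ)) (ρ : Measure ℝ)
    [IsProbabilityMeasure ρ] : Measurable fun w => ρ.bind (κ w) :=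
  measurable_bind_of_measurable measurable_const (fun _ => inferInstance) hκ

lemma isProbabilityMeasure_scalarStep (hκ : Measurable (Function.uncurry κ))
    (hp : ∀ w y, IsProbabilityMeasure (κ w y)) (ρ : Measure ℝ) [IsProbabilityMeasure ρ]
    (w : Param d) : IsProbabilityMeasure (ρ.bind (κ w)) :=
  isProbabilityMeasure_bind ρ (hκ.comp measurable_prodMk_left) (hp w)

/-- A chain with `T` steps, each driven by an independent `N(θ, 1)`, is a randomized function of a
single `N(√T θ, 1)`, the same function for all `θ`. -/
lemma exists_kernel_trajectoryLaw (hκ : Measurable (Function.uncurry κ))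
    (hp : ∀ w y, IsProbabilityMeasure (κ w y)) (w₀ : Param d) (T : ℕ) :
    ∃ η : ℝ → Measure (Fin (T + 1) → Param d), Measurable η ∧ (∀ u, IsProbabilityMeasure (η u)) ∧
      ∀ θ : ℝ, (gaussianReal (√T * θ) 1).bind η
        = trajectoryLaw (fun w => (gaussianReal θ 1).bind (κ w)) w₀ T := by
  induction T with
  | zero =>
    refine ⟨fun _ => Measure.dirac fun _ => w₀, measurable_const, fun _ => inferInstance,
      fun θ => ?_⟩
    rw [trajectoryLaw, Measure.bind_const]
    simp
  | succ T ih =>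
    obtain ⟨η, hη, hηp, hηeq⟩ := ih
    obtain ⟨r, hr⟩ : ∃ r, r = √((T : ℝ) + 1) := ⟨_, rfl⟩
    have hr0 : 0 < r := by rw [hr]; positivity
    have hr2 : r ^ 2 = T + 1 := by rw [hr, Real.sq_sqrt (by positivity)]
    obtain ⟨c, hc⟩ : ∃ c, c = √(T : ℝ) / r := ⟨_, rfl⟩
    obtain ⟨s, hs⟩ : ∃ s, s = 1 / r := ⟨_, rfl⟩
    have hcs : c ^ 2 + s ^ 2 = 1 := by
      rw [hc, hs, div_pow, div_pow, Real.sq_sqrt (by positivity), hr2]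
      field_simp
    have hκw : ∀ w, Measurable (κ w) := fun w => hκ.comp measurable_prodMk_left
    have hsnoc : ∀ h : Fin (T + 1) → Param d, Measurable fun w =>
        (Fin.snoc (α := fun _ => Param d) h w : Fin (T + 2) → Param d) := fun h =>
      (measurable_snoc T).comp measurable_prodMk_left
    -- the last step, given the previous iterates and the scalar noise
    obtain ⟨ζ, hζ⟩ : ∃ ζ : ℝ → (Fin (T + 1) → Param d) → Measure (Fin (T + 2) → Param d),
      ζ = fun y h => (κ (h (Fin.last T)) y).map
        fun w => (Fin.snoc (α := fun _ => Param d) h w : Fin (T + 2) → Param d) := ⟨_, rfl⟩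
    have hζm : Measurable (Function.uncurry ζ) := by
      rw [hζ]
      have h1 : Measurable fun x : ℝ × (Fin (T + 1) → Param d) => κ (x.2 (Fin.last T)) x.1 :=
        hκ.comp (by fun_prop : Measurable fun x : ℝ × (Fin (T + 1) → Param d) =>
          (x.2 (Fin.last T), x.1))
      refine measurable_map_of_measurable (f := fun x w =>
        (Fin.snoc (α := fun _ => Param d) x.2 w : Fin (T + 2) → Param d)) h1
        (fun x => hp (x.2 (Fin.last T)) x.1) ?_
      exact (measurable_snoc T).comp (by fun_prop :
        Measurable fun x : (ℝ × (Fin (T + 1) → Param d)) × Param d => (x.1.2, x.2))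
    have hζp : ∀ y h, IsProbabilityMeasure (ζ y h) := fun y h => by
      rw [hζ]
      have := hp (h (Fin.last T)) y
      exact Measure.isProbabilityMeasure_map (hsnoc h).aemeasurable
    have hζy : ∀ y, Measurable (ζ y) := fun y => hζm.comp measurable_prodMk_left
    obtain ⟨G, hG⟩ : ∃ G : ℝ × ℝ → Measure (Fin (T + 2) → Param d),
      G = fun x => (η x.1).bind (ζ x.2) := ⟨_, rfl⟩
    have hGm : Measurable G := by
      rw [hG]
      refine measurable_bind_of_measurable (ζ := fun x h => ζ x.2 h) (hη.comp measurable_fst)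
        (fun x => hηp x.1) ?_
      exact hζm.comp (by fun_prop :
        Measurable fun x : (ℝ × ℝ) × (Fin (T + 1) → Param d) => (x.1.2, x.2))
    have hGp : ∀ x, IsProbabilityMeasure (G x) := fun x => by
      rw [hG]
      have := hηp x.1
      exact isProbabilityMeasure_bind _ (hζy x.2) (hζp x.2)
    have hGrot : Measurable (Function.uncurry fun u v : ℝ => G (c * u + s * v, s * u - c * v)) :=
      hGm.comp (by fun_prop : Measurable fun x : ℝ × ℝ =>
        (c * x.1 + s * x.2, s * x.1 - c * x.2))
    -- From u ~ N(√(T+1) θ, 1) and a fresh v ~ N(0, 1), the orthogonal map with c = √T/√(T+1), s =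
    -- 1/√(T+1) makes independent variables N(√T θ, 1), for the first T steps, and N(θ, 1), for the
    -- last. Its coefficients do not involve θ.
    refine ⟨fun u => (gaussianReal 0 1).bind fun v => G (c * u + s * v, s * u - c * v),
      measurable_bind_of_measurable measurable_const (fun _ => inferInstance) hGrot,
      fun u => isProbabilityMeasure_bind _ (hGrot.comp measurable_prodMk_left) fun v => hGp _,
      fun θ => ?_⟩
    have hm1 : c * (√((T + 1 : ℕ) : ℝ) * θ) = √T * θ := by
      push_cast; rw [← hr, hc]; field_simp
    have hm2 : s * (√((T + 1 : ℕ) : ℝ) * θ) = θ := by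
      push_cast; rw [← hr, hs]; field_simp
    have hstep := measurable_scalarStep hκ (gaussianReal θ 1)
    have hstepp := isProbabilityMeasure_scalarStep hκ hp (gaussianReal θ 1)
    refine Measure.ext_of_lintegral _ fun f hf => ?_
    have hfG : Measurable fun x => ∫⁻ z, f z ∂(G x) := (Measure.measurable_lintegral hf).comp hGm
    have hfζ : Measurable fun x : ℝ × (Fin (T + 1) → Param d) => ∫⁻ z, f z ∂(ζ x.1 x.2) :=
      (Measure.measurable_lintegral hf).comp hζm
    calc _ = ∫⁻ u, ∫⁻ v, ∫⁻ z, f z ∂(G (c * u + s * v, s * u - c * v)) ∂(gaussianReal 0 1)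
          ∂(gaussianReal (√((T + 1 : ℕ) : ℝ) * θ) 1) := by
          rw [Measure.lintegral_bind (measurable_bind_of_measurable measurable_const
            (fun _ => inferInstance) hGrot).aemeasurable hf.aemeasurable]
          refine lintegral_congr fun u => ?_
          have hu : Measurable fun v => G (c * u + s * v, s * u - c * v) :=
            hGrot.comp measurable_prodMk_left
          rw [Measure.lintegral_bind hu.aemeasurable hf.aemeasurable]
      _ = ∫⁻ x, ∫⁻ z, f z ∂(G x) ∂(((gaussianReal (√((T + 1 : ℕ) : ℝ) * θ) 1).prod
          (gaussianReal 0 1)).map (fun x : ℝ × ℝ => (c * x.1 + s * x.2, s * x.1 - c * x.2))) := by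
          rw [lintegral_map hfG (by fun_prop), lintegral_prod]
          exact (hfG.comp (by fun_prop : Measurable fun x : ℝ × ℝ =>
            (c * x.1 + s * x.2, s * x.1 - c * x.2))).aemeasurable
      _ = ∫⁻ x, ∫⁻ y, ∫⁻ z, f z ∂(G (x, y)) ∂(gaussianReal θ 1) ∂(gaussianReal (√T * θ) 1) := by
          rw [gaussianReal_prod_map_rotation _ hcs, hm1, hm2, lintegral_prod _ hfG.aemeasurable]
      _ = ∫⁻ x, ∫⁻ h, ∫⁻ y, ∫⁻ z, f z ∂(ζ y h) ∂(gaussianReal θ 1) ∂(η x)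
          ∂(gaussianReal (√T * θ) 1) := by
          refine lintegral_congr fun x => ?_
          have := hηp x
          rw [lintegral_lintegral_swap (μ := η x) (ν := gaussianReal θ 1)
            (f := fun h y => ∫⁻ z, f z ∂(ζ y h)) (hfζ.comp measurable_swap).aemeasurable]
          refine lintegral_congr fun y => ?_
          rw [hG, Measure.lintegral_bind (hζy y).aemeasurable hf.aemeasurable]
      _ = ∫⁻ h, ∫⁻ y, ∫⁻ z, f z ∂(ζ y h) ∂(gaussianReal θ 1)
          ∂(trajectoryLaw (fun w => (gaussianReal θ 1).bind (κ w)) w₀ T) := by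
          rw [← hηeq θ, Measure.lintegral_bind hη.aemeasurable]
          exact (Measurable.lintegral_prod_left' hfζ).aemeasurable
      _ = _ := by
          rw [lintegral_trajectoryLaw_succ hstep hstepp w₀ T hf]
          refine lintegral_congr fun h => ?_
          have hfs : Measurable fun w => f (Fin.snoc (α := fun _ => Param d) h w) :=
            hf.comp (hsnoc h)
          rw [Measure.lintegral_bind (hκw _).aemeasurable hfs.aemeasurable]
          refine lintegral_congr fun y => ?_
          rw [hζ, lintegral_map hf (hsnoc h)]

/-- Trade-off bounds for chains driven by subsampled scalar Gaussian noise. -/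
lemma gaussianTradeoff_sub_le_trajectoryLaw (hκ : Measurable (Function.uncurry κ))
    (hp : ∀ w y, IsProbabilityMeasure (κ w y)) (w₀ : Param d) (T : ℕ) (hT : 0 < T)
    (p : unitInterval) {θ μ k : ℝ} (hθ0 : 0 < θ) (hθ : θ ^ 2 ≤ 1) (hμ : 0 < μ)
    (hμT : √T * (p * θ) ≤ μ) (hk : (1 + θ ^ 4) ^ T = 1 + k) {α : ℝ} (hα : 0 ≤ α) :
    gaussianTradeoff μ α - √k ≤
      tradeoff (trajectoryLaw (fun w => (gaussianReal 0 1).bind (κ w)) w₀ T)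
        (trajectoryLaw (fun w => (gaussianMix p θ 0).bind (κ w)) w₀ T) α ∧
    gaussianTradeoff μ α - Real.exp (μ ^ 2 / 2) * √√k ≤
      tradeoff (trajectoryLaw (fun w => (gaussianMix p θ 0).bind (κ w)) w₀ T)
        (trajectoryLaw (fun w => (gaussianReal 0 1).bind (κ w)) w₀ T) α := by
  have hk0 : 0 < k := by
    have h1 : 1 < (1 + θ ^ 4) ^ T := one_lt_pow₀ (by have := pow_pos hθ0 4; linarith) hT.ne'
    linarith
  have hprob : ∀ ρ : Measure ℝ, IsProbabilityMeasure ρ →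
      IsProbabilityMeasure (trajectoryLaw (fun w => ρ.bind (κ w)) w₀ T) := fun ρ _ =>
    isProbabilityMeasure_trajectoryLaw (measurable_scalarStep hκ ρ)
      (isProbabilityMeasure_scalarStep hκ hp ρ) w₀ T
  obtain ⟨A, hA⟩ : ∃ A, A = trajectoryLaw (fun w => (gaussianReal 0 1).bind (κ w)) w₀ T := ⟨_, rfl⟩
  obtain ⟨Q, hQ⟩ : ∃ Q, Q = trajectoryLaw (fun w => (gaussianMix p θ 0).bind (κ w)) w₀ T :=
    ⟨_, rfl⟩
  obtain ⟨M, hM⟩ : ∃ M, M = trajectoryLaw (fun w => (gaussianReal (p * θ) 1).bind (κ w)) w₀ T :=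
    ⟨_, rfl⟩
  have hAp : IsProbabilityMeasure A := by rw [hA]; exact hprob _ inferInstance
  have hQp : IsProbabilityMeasure Q := by rw [hQ]; exact hprob _ inferInstance
  have hMp : IsProbabilityMeasure M := by rw [hM]; exact hprob _ inferInstance
  -- M is the chain driven by the Gaussian with the mean of the mixture: close to Q in total
  -- variation, and comparable with A as one Gaussian shift.
  have hchi : ChiSqLE Q M (ENNReal.ofReal (1 + k)) := by
    rw [← hk, ENNReal.ofReal_pow (by positivity), hQ, hM]
    exact ChiSqLE.trajectoryLaw (measurable_scalarStep hκ _) (measurable_scalarStep hκ _)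
      (isProbabilityMeasure_scalarStep hκ hp _) (isProbabilityMeasure_scalarStep hκ hp _)
      (fun w => (chiSqLE_gaussianMix_mean p hθ).bind (hκ.comp measurable_prodMk_left) (hp w)) w₀ T
  obtain ⟨η, hη, hηp, hηeq⟩ := exists_kernel_trajectoryLaw hκ hp w₀ T
  have hm0 : 0 ≤ √T * (p * θ) := mul_nonneg (Real.sqrt_nonneg _) (mul_nonneg p.2.1 hθ0.le)
  have hA' : (gaussianReal 0 1).bind η = A := by
    have := hηeq 0
    rwa [mul_zero, ← hA] at this
  have hM' := hηeq (p * θ)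
  rw [← hM] at hM'
  have hAM : ∀ β, 0 ≤ β → gaussianTradeoff μ β ≤ tradeoff A M β := fun β hβ => by
    rw [← hA', ← hM']
    exact (gaussianTradeoff_le_of_le hm0 hμ hμT hβ).trans
      (tradeoff_le_tradeoff_bind _ _ hη hηp hβ)
  have hMA : ∀ β, 0 ≤ β → gaussianTradeoff μ β ≤ tradeoff M A β := fun β hβ => by
    rw [← hA', ← hM']
    exact ((gaussianTradeoff_le_of_le hm0 hμ hμT hβ).trans (gaussianTradeoff_le_symm _ hβ)).trans
      (tradeoff_le_tradeoff_bind _ _ hη hηp hβ)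
  rw [← hA, ← hQ]
  constructor
  · refine le_tradeoff hα fun φ hφ h01 hφα => ?_
    have h1 := (hAM α hα).trans (tradeoff_le hφ h01 hφα)
    have h2 := (abs_le.1 (hchi.abs_integral_sub_le hk0 hφ h01)).2
    linarith
  -- With Q as null hypothesis, replacing it by M raises the level to α + √k, which the continuity
  -- of the Gaussian trade-off function absorbs. In the first part only the power changes, by √k.
  · refine (gaussianTradeoff_sub_le μ hα (Real.sqrt_pos.2 hk0)).trans ?_
    refine le_tradeoff hα fun φ hφ h01 hφα => ?_
    have h2 := (abs_le.1 (hchi.abs_integral_sub_le hk0 hφ h01)).1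
    exact (hMA _ (by positivity)).trans (tradeoff_le hφ h01 (by linarith))

end ScalarNoise

/-! ### Privacy of mixed training -/

section MixedPrivacy

variable {d : ℕ}

/-- The law of the next iterate when the component of the noise along the clipped gradient `v w`
of the distinguished record is driven by the scalar `y`. -/
def drivenStep (ηpub ηpriv σ : ℝ) (pub priv : Param d → Measure (Param d))
    (v : Param d → Param d) (w : Param d) (y : ℝ) : Measure (Param d) :=
  ((pub w).prod ((priv w).prod (stdGaussian (Param d)))).map
    fun x => w - (ηpub • x.1 + ηpriv • (x.2.1 + σ • (y • v w + residual (v w) x.2.2)))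

variable {ηpub ηpriv σ : ℝ} {pub priv : Param d → Measure (Param d)} {v : Param d → Param d}

lemma measurable_residual (hv : Measurable v) {α : Type*} [MeasurableSpace α] {f g : α → Param d}
    (hf : Measurable f) (hg : Measurable g) : Measurable fun a => residual (v (f a)) (g a) := by
  unfold residual
  have h := hv.comp hf
  have h' : Measurable fun a => v (f a) := h
  fun_prop

lemma measurable_drivenStep (hm : Measurable pub) (hm' : Measurable priv)
    (hp : ∀ w, IsProbabilityMeasure (pub w)) (hp' : ∀ w, IsProbabilityMeasure (priv w))
    (hv : Measurable v) :
    Measurable (Function.uncurry (drivenStep ηpub ηpriv σ pub priv v)) := by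
  have h1 : ∀ w, IsProbabilityMeasure ((priv w).prod (stdGaussian (Param d))) := fun w => by
    have := hp' w; infer_instance
  have h2 : ∀ w, IsProbabilityMeasure ((pub w).prod ((priv w).prod (stdGaussian (Param d)))) :=
    fun w => by have := hp w; have := hp' w; infer_instance
  have h3 : Measurable fun w => (pub w).prod ((priv w).prod (stdGaussian (Param d))) :=
    measurable_prod_of_measurable hm (measurable_prod_of_measurable hm' measurable_const hp'
      fun _ => inferInstance) hp h1
  refine measurable_map_of_measurable (f := fun (a : Param d × ℝ) (x : Param d × Param d × Param d) =>
    a.1 - (ηpub • x.1 + ηpriv • (x.2.1 + σ • (a.2 • v a.1 + residual (v a.1) x.2.2))))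
    (h3.comp measurable_fst) (fun a => h2 a.1) ?_
  have h4 := measurable_residual hv (α := (Param d × ℝ) × Param d × Param d × Param d)
    (f := fun a => a.1.1) (g := fun a => a.2.2.2) (by fun_prop) (by fun_prop)
  have h5 : Measurable fun a : (Param d × ℝ) × Param d × Param d × Param d => v a.1.1 :=
    hv.comp (by fun_prop)
  unfold Function.uncurry
  fun_prop

lemma isProbabilityMeasure_drivenStep (hp : ∀ w, IsProbabilityMeasure (pub w))
    (hp' : ∀ w, IsProbabilityMeasure (priv w)) (w : Param d) (y : ℝ) :
    IsProbabilityMeasure (drivenStep ηpub ηpriv σ pub priv v w y) := by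
  have := hp w
  have := hp' w
  refine Measure.isProbabilityMeasure_map (Measurable.aemeasurable ?_)
  unfold residual
  fun_prop

/-- Driving the step by `N(t, 1)` shifts the private gradient by `σ t` times the clipped gradient
of the distinguished record. -/
lemma bind_drivenStep (hm : Measurable pub) (hm' : Measurable priv)
    (hp : ∀ w, IsProbabilityMeasure (pub w)) (hp' : ∀ w, IsProbabilityMeasure (priv w))
    (hv : Measurable v) (hv1 : ∀ w, ‖v w‖ ≤ 1) (w : Param d) (t : ℝ) :
    (gaussianReal t 1).bind (drivenStep ηpub ηpriv σ pub priv v w)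
      = stepLaw ηpub ηpriv σ pub (fun w => (priv w).map fun c => (σ * t) • v w + c) w := by
  have := hp w
  have := hp' w
  refine Measure.ext_of_lintegral _ fun f hf => ?_
  have hκ : Measurable (drivenStep ηpub ηpriv σ pub priv v w) :=
    (measurable_drivenStep hm hm' hp hp' hv).comp measurable_prodMk_left
  have hres : Measurable (residual (v w)) := by unfold residual; fun_prop
  have hF : Measurable fun x : Param d × Param d × Param d =>
    f (w - (ηpub • x.1 + ηpriv • (x.2.1 + σ • x.2.2))) := hf.comp (by fun_prop)
  have hshift : ∀ g : Param d → ENNReal, Measurable g →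
      ∫⁻ y, ∫⁻ z, g (y • v w + residual (v w) z) ∂(stdGaussian (Param d)) ∂(gaussianReal t 1)
      = ∫⁻ z, g (t • v w + z) ∂(stdGaussian (Param d)) := by
    intro g hg
    have h1 : gaussianReal t 1 = (gaussianReal 0 1).map (fun y => t + y) := by
      rw [gaussianReal_map_const_add, zero_add]
    have hgt : Measurable fun z => g (t • v w + z) := hg.comp (by fun_prop)
    have h2 : Measurable fun x : ℝ × Param d => g (t • v w + (x.1 • v w + residual (v w) x.2)) :=
      hg.comp (by fun_prop)
    have h3 : Measurable fun x : ℝ × Param d => g (x.1 • v w + residual (v w) x.2) :=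
      hg.comp (by fun_prop)
    rw [h1, lintegral_map (Measurable.lintegral_prod_right' h3) (by fun_prop)]
    conv_rhs => rw [← stdGaussian_eq_map_residual (hv1 w)]
    rw [lintegral_map hgt (by fun_prop), lintegral_prod _ h2.aemeasurable]
    simp only [add_smul, add_assoc]
  rw [Measure.lintegral_bind hκ.aemeasurable hf.aemeasurable]
  calc _ = ∫⁻ y, ∫⁻ x, f (w - (ηpub • x.1 + ηpriv • (x.2.1 + σ • (y • v w
          + residual (v w) x.2.2)))) ∂((pub w).prod ((priv w).prod (stdGaussian (Param d))))
          ∂(gaussianReal t 1) := by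
        refine lintegral_congr fun y => ?_
        rw [drivenStep, lintegral_map hf (by fun_prop)]
    _ = ∫⁻ y, ∫⁻ a, ∫⁻ c, ∫⁻ z, f (w - (ηpub • a + ηpriv • (c + σ • (y • v w
          + residual (v w) z)))) ∂(stdGaussian (Param d)) ∂(priv w) ∂(pub w)
          ∂(gaussianReal t 1) := by
        refine lintegral_congr fun y => ?_
        have hy : Measurable fun x : Param d × Param d × Param d =>
          f (w - (ηpub • x.1 + ηpriv • (x.2.1 + σ • (y • v w + residual (v w) x.2.2)))) :=
          hf.comp (by fun_prop)
        rw [lintegral_prod _ hy.aemeasurable]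
        refine lintegral_congr fun a => ?_
        have hya : Measurable fun x : Param d × Param d =>
          f (w - (ηpub • a + ηpriv • (x.1 + σ • (y • v w + residual (v w) x.2)))) :=
          hf.comp (by fun_prop)
        rw [lintegral_prod _ hya.aemeasurable]
    -- Fubini moves the scalar and residual noise innermost, where `hshift` recombines them into a
    -- shifted standard Gaussian.
    _ = ∫⁻ a, ∫⁻ c, ∫⁻ y, ∫⁻ z, f (w - (ηpub • a + ηpriv • (c + σ • (y • v w
          + residual (v w) z)))) ∂(stdGaussian (Param d)) ∂(gaussianReal t 1) ∂(priv w)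
          ∂(pub w) := by
        have h1 : Measurable fun x : (ℝ × Param d) × Param d => ∫⁻ z, f (w - (ηpub • x.1.2
            + ηpriv • (x.2 + σ • (x.1.1 • v w + residual (v w) z)))) ∂(stdGaussian (Param d)) :=
          Measurable.lintegral_prod_right' (f := fun x : ((ℝ × Param d) × Param d) × Param d =>
            f (w - (ηpub • x.1.1.2 + ηpriv • (x.1.2 + σ • (x.1.1.1 • v w
              + residual (v w) x.2))))) (hf.comp (by fun_prop))
        have h2 : Measurable fun x : ℝ × Param d => ∫⁻ c, ∫⁻ z, f (w - (ηpub • x.2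
            + ηpriv • (c + σ • (x.1 • v w + residual (v w) z)))) ∂(stdGaussian (Param d))
            ∂(priv w) := Measurable.lintegral_prod_right' h1
        rw [lintegral_lintegral_swap (f := fun y a => ∫⁻ c, ∫⁻ z, f (w - (ηpub • a
            + ηpriv • (c + σ • (y • v w + residual (v w) z)))) ∂(stdGaussian (Param d))
            ∂(priv w)) h2.aemeasurable]
        refine lintegral_congr fun a => ?_
        rw [lintegral_lintegral_swap (f := fun y c => ∫⁻ z, f (w - (ηpub • a
            + ηpriv • (c + σ • (y • v w + residual (v w) z)))) ∂(stdGaussian (Param d)))]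
        exact (h1.comp (by fun_prop : Measurable fun x : ℝ × Param d =>
          ((x.1, a), x.2))).aemeasurable
    _ = ∫⁻ a, ∫⁻ c, ∫⁻ z, f (w - (ηpub • a + ηpriv • ((σ * t) • v w + c + σ • z)))
          ∂(stdGaussian (Param d)) ∂(priv w) ∂(pub w) := by
        refine lintegral_congr fun a => lintegral_congr fun c => ?_
        rw [hshift (fun u => f (w - (ηpub • a + ηpriv • (c + σ • u)))) (hf.comp (by fun_prop))]
        refine lintegral_congr fun z => ?_
        have e : c + σ • (t • v w + z) = (σ * t) • v w + c + σ • z := by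
          rw [smul_add, smul_smul]; abel
        rw [e]
    _ = _ := by
        rw [stepLaw, lintegral_map hf (by fun_prop), lintegral_prod _ hF.aemeasurable]
        refine lintegral_congr fun a => ?_
        have ha : Measurable fun x : Param d × Param d =>
          f (w - (ηpub • a + ηpriv • (x.1 + σ • x.2))) := hf.comp (by fun_prop)
        have : IsProbabilityMeasure ((priv w).map fun c => (σ * t) • v w + c) :=
          Measure.isProbabilityMeasure_map (by fun_prop)
        rw [lintegral_prod _ ha.aemeasurable, lintegral_map (Measurable.lintegral_prod_right' ha)
          (by fun_prop)]

/-- Being linear in the private law, the step passes the mixture over inclusion of one record on to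
the next iterate. -/
lemma stepLaw_mix (p : unitInterval) {P Q : Param d → Measure (Param d)}
    (hp : ∀ w, IsProbabilityMeasure (pub w)) (hP : ∀ w, IsProbabilityMeasure (P w))
    (hQ : ∀ w, IsProbabilityMeasure (Q w)) (w : Param d) :
    stepLaw ηpub ηpriv σ pub (fun w => unitInterval.toNNReal p • P w
        + unitInterval.toNNReal (unitInterval.symm p) • Q w) w
      = unitInterval.toNNReal p • stepLaw ηpub ηpriv σ pub P w
        + unitInterval.toNNReal (unitInterval.symm p) • stepLaw ηpub ηpriv σ pub Q w := by
  have := hp w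
  have := hP w
  have := hQ w
  have hm : Measurable fun x : Param d × Param d × Param d =>
    w - (ηpub • x.1 + ηpriv • (x.2.1 + σ • x.2.2)) := by fun_prop
  refine Measure.ext_of_lintegral _ fun f hf => ?_
  have hx : Measurable fun x : Param d × Param d × Param d =>
    f (w - (ηpub • x.1 + ηpriv • (x.2.1 + σ • x.2.2))) := hf.comp hm
  have hxa : ∀ a, Measurable fun x : Param d × Param d =>
    f (w - (ηpub • a + ηpriv • (x.1 + σ • x.2))) := fun a => hf.comp (by fun_prop)
  have key : ∀ W : Measure (Param d), SFinite W →
      ∫⁻ y, f y ∂(((pub w).prod (W.prod (stdGaussian (Param d)))).map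
        fun x => w - (ηpub • x.1 + ηpriv • (x.2.1 + σ • x.2.2)))
      = ∫⁻ c, ∫⁻ a, ∫⁻ z, f (w - (ηpub • a + ηpriv • (c + σ • z))) ∂(stdGaussian (Param d))
        ∂(pub w) ∂W := fun W _ => by
    rw [lintegral_map hf hm, lintegral_prod _ hx.aemeasurable,
      ← lintegral_lintegral_swap (μ := pub w) (ν := W) (f := fun a c => ∫⁻ z,
        f (w - (ηpub • a + ηpriv • (c + σ • z))) ∂(stdGaussian (Param d)))]
    · refine lintegral_congr fun a => ?_
      rw [lintegral_prod _ (hxa a).aemeasurable]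
    · exact (Measurable.lintegral_prod_right' (f := fun x : (Param d × Param d) × Param d =>
        f (w - (ηpub • x.1.1 + ηpriv • (x.1.2 + σ • x.2)))) (hf.comp (by fun_prop))).aemeasurable
  rw [lintegral_mix, stepLaw, stepLaw, stepLaw, key _ inferInstance, key _ inferInstance,
    key _ inferInstance, lintegral_mix]

variable {𝒟 : Type*} [MeasurableSpace 𝒟] {l : 𝒟 → Param d → ℝ}

/-- Poisson subsampling includes a given record with probability `p`, independently of the rest. -/
lemma clippedGradientPoisson_succ {𝒟 : Type*} {l : 𝒟 → Param d → ℝ} (p : unitInterval) {m : ℕ} (s : Fin (m + 1) → 𝒟)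
    (i : Fin (m + 1)) (w : Param d) :
    clippedGradientPoisson p ⟨m + 1, s⟩ l w
      = unitInterval.toNNReal p • ((clippedGradientPoisson p ⟨m, fun j => s (i.succAbove j)⟩ l w).map
          fun c => clip (gradient (l (s i)) w) + c)
        + unitInterval.toNNReal (unitInterval.symm p) •
          clippedGradientPoisson p ⟨m, fun j => s (i.succAbove j)⟩ l w := by
  refine Measure.ext_of_lintegral _ fun f hf => ?_
  obtain ⟨c, hc⟩ : ∃ c : Fin (m + 1) → Param d, c = fun j => clip (gradient (l (s j)) w) :=
    ⟨_, rfl⟩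
  obtain ⟨P, hP⟩ : ∃ P : Measure Bool, P = bernoulliMeasure true false p := ⟨_, rfl⟩
  have hPp : IsProbabilityMeasure P := by rw [hP]; infer_instance
  have e1 : clippedGradientPoisson p ⟨m + 1, s⟩ l w
      = (Measure.pi fun _ : Fin (m + 1) => P).map
        fun b => ∑ j, if b j = true then c j else 0 := by rw [hc, hP]; rfl
  have e2 : clippedGradientPoisson p ⟨m, fun j => s (i.succAbove j)⟩ l w
      = (Measure.pi fun _ : Fin m => P).map
        fun b => ∑ j, if b j = true then c (i.succAbove j) else 0 := by rw [hc, hP]; rfl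
  have e3 : clip (gradient (l (s i)) w) = c i := by rw [hc]
  have hmp := measurePreserving_piFinSuccAbove (fun _ : Fin (m + 1) => P) i
  rw [e1, e2, e3, lintegral_mix, Measure.map_map (by fun_prop) (measurable_of_finite _),
    lintegral_map hf (measurable_of_finite _), lintegral_map hf (measurable_of_finite _),
    lintegral_map hf (measurable_of_finite _)]
  have e4 : ∫⁻ b : Fin (m + 1) → Bool, f (∑ j, if b j = true then c j else 0)
        ∂(Measure.pi fun _ => P)
      = ∫⁻ x : Bool × (Fin m → Bool), f ((if x.1 = true then c i else 0)
          + ∑ j, if x.2 j = true then c (i.succAbove j) else 0)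
        ∂(P.prod (Measure.pi fun _ => P)) := by
    rw [← hmp.lintegral_comp (measurable_of_finite _)]
    refine lintegral_congr fun b => ?_
    rw [Fin.sum_univ_succAbove _ i]
    rfl
  rw [e4, lintegral_prod _ (measurable_of_finite _).aemeasurable, hP, bernoulliMeasure_def,
    lintegral_mix, lintegral_dirac, lintegral_dirac]
  simp

/-- Both trade-off bounds for a dataset and the dataset without one of its records. -/
lemma tradeoff_mixedTraining {n B : ℕ} (hB : 0 < B) (hBn : B ≤ n) {μ : ℝ} (L L₀ : ℝ) (hμ : 0 < μ)
    (hlm : Measurable fun x : 𝒟 × Param d => gradient (l x.1) x.2) (ν : Measure 𝒟)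
    [IsProbabilityMeasure ν] (w₀ : Param d) {T : ℕ} (hT : 0 < T)
    (hσ : 1 / noiseMultiplier n B μ T ^ 2 ≤ 1) {k : ℝ}
    (hk : (1 + (1 / noiseMultiplier n B μ T ^ 2) ^ 2) ^ T = 1 + k)
    {S S' : Dataset 𝒟} (hS : OneRemoved S S') {α : ℝ} (hα : 0 ≤ α) :
    gaussianTradeoff μ α - √k ≤ tradeoff
      (mixedTraining n B μ L L₀ ν l (clippedGradientPoisson (samplingRate B n hBn) S' l) w₀ T)
      (mixedTraining n B μ L L₀ ν l (clippedGradientPoisson (samplingRate B n hBn) S l) w₀ T) α ∧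
    gaussianTradeoff μ α - Real.exp (μ ^ 2 / 2) * √√k ≤ tradeoff
      (mixedTraining n B μ L L₀ ν l (clippedGradientPoisson (samplingRate B n hBn) S l) w₀ T)
      (mixedTraining n B μ L L₀ ν l (clippedGradientPoisson (samplingRate B n hBn) S' l) w₀ T)
      α := by
  obtain ⟨m, s, i, rfl, rfl⟩ := hS
  obtain ⟨p, hp⟩ : ∃ p, p = samplingRate B n hBn := ⟨_, rfl⟩
  obtain ⟨σ, hσd⟩ : ∃ σ, σ = noiseMultiplier n B μ T := ⟨_, rfl⟩
  have hσ0 : 0 < σ := by rw [hσd]; exact noiseMultiplier_pos hB hBn hμ hT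
  have hT' : (0 : ℝ) < T := by exact_mod_cast hT
  have hB' : (0 : ℝ) < B := by exact_mod_cast hB
  have hn' : (0 : ℝ) < n := by exact_mod_cast hB.trans_le hBn
  have hθ2 : ∀ j : ℕ, (1 / σ) ^ (2 * j) = (1 / σ ^ 2) ^ j := fun j => by
    rw [pow_mul, div_pow, one_pow]
  have hμT : √T * (p * (1 / σ)) ≤ μ := by
    have h1 := one_div_noiseMultiplier_sq_le hB hBn hμ hT
    rw [← hσd] at h1
    have hpe : (p : ℝ) = B / n := by rw [hp]; rfl
    have h2 : (1 / σ) ^ 2 ≤ (n * μ / B / √T) ^ 2 := by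
      rw [div_pow _ (√(T : ℝ)), Real.sq_sqrt hT'.le, div_pow, one_pow]; exact h1
    have h3 : 1 / σ ≤ n * μ / B / √T := abs_le_of_sq_le_sq' h2 (by positivity) |>.2
    have hsT := Real.sqrt_pos.2 hT'
    calc √T * (p * (1 / σ)) ≤ √T * (B / n * (n * μ / B / √T)) := by rw [hpe]; gcongr
      _ = μ := by field_simp
  obtain ⟨v, hv⟩ : ∃ v : Param d → Param d, v = fun w => clip (gradient (l (s i)) w) := ⟨_, rfl⟩
  have hvm : Measurable v := by
    rw [hv]; exact measurable_clip.comp (measurable_gradient_right hlm _)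
  have hv1 : ∀ w, ‖v w‖ ≤ 1 := fun w => by rw [hv]; exact norm_clip_le_one _
  obtain ⟨pub, hpub⟩ : ∃ pub, pub = publicGradient B ν l := ⟨_, rfl⟩
  obtain ⟨priv, hpriv⟩ : ∃ priv, priv
    = clippedGradientPoisson p ⟨m, fun j => s (i.succAbove j)⟩ l := ⟨_, rfl⟩
  have hm : Measurable pub := by rw [hpub]; exact measurable_publicGradient hlm B ν
  have hm' : Measurable priv := by rw [hpriv]; exact measurable_clippedGradientPoisson hlm p _
  have hpp : ∀ w, IsProbabilityMeasure (pub w) := by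
    rw [hpub]; exact isProbabilityMeasure_publicGradient hlm B ν
  have hpp' : ∀ w, IsProbabilityMeasure (priv w) := by
    rw [hpriv]; exact isProbabilityMeasure_clippedGradientPoisson p _
  rw [mixedTraining, mixedTraining, ← hσd, ← hp, ← hpub, ← hpriv]
  obtain ⟨a, ha⟩ : ∃ a, a = publicRate B L T := ⟨_, rfl⟩
  obtain ⟨b, hb⟩ : ∃ b, b = privateRate d B L L₀ σ T := ⟨_, rfl⟩
  rw [← ha, ← hb]
  have e0 : ∀ w, (gaussianReal 0 1).bind (drivenStep a b σ pub priv v w)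
      = stepLaw a b σ pub priv w := fun w => by
    rw [bind_drivenStep hm hm' hpp hpp' hvm hv1]
    simp
  -- The shift 1/σ is the one for which σ · (1/σ) restores exactly one copy of `v w`.
  have eθ : ∀ w, (gaussianReal (1 / σ) 1).bind (drivenStep a b σ pub priv v w)
      = stepLaw a b σ pub (fun w => (priv w).map fun c => v w + c) w := fun w => by
    rw [bind_drivenStep hm hm' hpp hpp' hvm hv1, mul_one_div_cancel hσ0.ne']
    simp
  have hprivS : clippedGradientPoisson p ⟨m + 1, s⟩ l
      = fun w => unitInterval.toNNReal p • ((priv w).map fun c => v w + c)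
        + unitInterval.toNNReal (unitInterval.symm p) • priv w := by
    funext w
    rw [clippedGradientPoisson_succ p s i w, hv, hpriv]
  have hκ := measurable_drivenStep (ηpub := a) (ηpriv := b) (σ := σ) hm hm' hpp hpp' hvm
  have emix : (fun w => (gaussianMix p (1 / σ) 0).bind (drivenStep a b σ pub priv v w))
      = stepLaw a b σ pub (clippedGradientPoisson p ⟨m + 1, s⟩ l) := by
    funext w
    have hκw : Measurable (drivenStep a b σ pub priv v w) := hκ.comp measurable_prodMk_left
    rw [hprivS, stepLaw_mix p hpp (fun w => ?_) hpp', ← e0, ← eθ]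
    · refine Measure.ext_of_lintegral _ fun f hf => ?_
      rw [Measure.lintegral_bind hκw.aemeasurable hf.aemeasurable, gaussianMix, lintegral_mix,
        lintegral_mix, Measure.lintegral_bind hκw.aemeasurable hf.aemeasurable,
        Measure.lintegral_bind hκw.aemeasurable hf.aemeasurable]
    · have := hpp' w
      exact Measure.isProbabilityMeasure_map (by fun_prop)
  have hmain := gaussianTradeoff_sub_le_trajectoryLaw hκ
    (isProbabilityMeasure_drivenStep hpp hpp') w₀ T hT p (θ := 1 / σ) (k := k) (by positivity)
    (by rw [div_pow, one_pow, hσd]; exact hσ) hμ hμT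
    (by rw [hθ2 2, hσd]; exact hk) hα
  rw [emix, funext e0] at hmain
  exact hmain

lemma asymptoticallyGDP_mixedTraining {n B : ℕ} (hB : 0 < B) (hBn : B ≤ n) {μ : ℝ} (L L₀ : ℝ)
    (hμ : 0 < μ) (hlm : Measurable fun x : 𝒟 × Param d => gradient (l x.1) x.2) (ν : Measure 𝒟)
    [IsProbabilityMeasure ν] (w₀ : Param d) :
    AsymptoticallyGDP (fun T (S : Dataset 𝒟) => mixedTraining n B μ L L₀ ν l
      (clippedGradientPoisson (samplingRate B n hBn) S l) w₀ T) μ := by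
  intro ε hε
  obtain ⟨K, hK⟩ : ∃ K, K = ((n : ℝ) * μ / B) ^ 2 := ⟨_, rfl⟩
  obtain ⟨k, hk⟩ : ∃ k : ℕ → ℝ, k = fun T =>
    (1 + (1 / noiseMultiplier n B μ T ^ 2) ^ 2) ^ T - 1 := ⟨_, rfl⟩
  have hTinv : Tendsto (fun T : ℕ => (T : ℝ)⁻¹) atTop (𝓝 0) :=
    tendsto_inv_atTop_zero.comp tendsto_natCast_atTop_atTop
  have hk0 : Tendsto k atTop (𝓝 0) := by
    have hup : Tendsto (fun T : ℕ => Real.exp (K ^ 2 * (T : ℝ)⁻¹) - 1) atTop (𝓝 0) := by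
      have h1 := (Real.continuous_exp.tendsto _).comp (hTinv.const_mul (K ^ 2))
      have h2 := h1.sub_const 1
      simpa using h2
    -- With 1/σ_T² ≤ K/T, the accumulated chi-square distance is at most exp(K²/T) - 1.
    refine squeeze_zero' ?_ ?_ hup
    · refine .of_forall fun T => ?_
      rw [hk]
      have : (1 : ℝ) ≤ (1 + (1 / noiseMultiplier n B μ T ^ 2) ^ 2) ^ T :=
        one_le_pow₀ (by have := sq_nonneg (1 / noiseMultiplier n B μ T ^ 2); linarith)
      linarith
    · filter_upwards [eventually_gt_atTop 0] with T hT
      have hT' : (0 : ℝ) < T := by exact_mod_cast hT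
      have h1 := one_div_noiseMultiplier_sq_le hB hBn hμ hT
      rw [← hK] at h1
      rw [hk]
      refine sub_le_sub_right ?_ 1
      calc (1 + (1 / noiseMultiplier n B μ T ^ 2) ^ 2) ^ T ≤ (1 + (K / T) ^ 2) ^ T := by gcongr
        _ ≤ (Real.exp ((K / T) ^ 2)) ^ T := by
          gcongr
          linarith [Real.add_one_le_exp ((K / T) ^ 2)]
        _ = Real.exp (K ^ 2 * (T : ℝ)⁻¹) := by
          rw [← Real.exp_nat_mul]
          congr 1
          field_simp
  have hs1 : Tendsto (fun T => √(k T)) atTop (𝓝 0) := by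
    have := (Real.continuous_sqrt.tendsto 0).comp hk0
    rwa [Real.sqrt_zero] at this
  have hs2 : Tendsto (fun T => Real.exp (μ ^ 2 / 2) * √√(k T)) atTop (𝓝 0) := by
    have h := (Real.continuous_sqrt.tendsto 0).comp hs1
    rw [Real.sqrt_zero] at h
    have := h.const_mul (Real.exp (μ ^ 2 / 2))
    rwa [mul_zero] at this
  have hσ1 := (tendsto_noiseMultiplier_sq hB hBn hμ).eventually_ge_atTop 1
  filter_upwards [hs1.eventually (gt_mem_nhds hε), hs2.eventually (gt_mem_nhds hε), hσ1,
    eventually_gt_atTop 0] with T h1 h2 h3 hT S S' hN α hα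
  have hσ : 1 / noiseMultiplier n B μ T ^ 2 ≤ 1 := by
    rw [div_le_one (by linarith)]; exact h3
  have hkT : (1 + (1 / noiseMultiplier n B μ T ^ 2) ^ 2) ^ T = 1 + k T := by rw [hk]; ring
  rcases hN with hN | hN
  · have := (tradeoff_mixedTraining hB hBn L L₀ hμ hlm ν w₀ hT hσ hkT hN hα.1).2
    linarith
  · have := (tradeoff_mixedTraining hB hBn L L₀ hμ hlm ν w₀ hT hσ hkT hN hα.1).1
    linarith

end MixedPrivacy

end MixedTraining

end

/-! ### Assembly: accounting, privacy, rate function and convergence -/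

theorem mainTheorem4 {𝒟 : Type*} [MeasurableSpace 𝒟] (d n B : ℕ) (hd : 0 < d) (hB : 0 < B)
    (hBn : B ≤ n) (μ L L₀ ξ : ℝ) (hμ : 0 < μ) (hL : 0 < L) (hL₀ : 0 < L₀) (hξ : 0 ≤ ξ)
    (l : 𝒟 → MixedTraining.Param d → ℝ) (hl : ∀ z, Differentiable ℝ (l z))
    (hlm : Measurable fun x : 𝒟 × MixedTraining.Param d => gradient (l x.1) x.2)
    (ν : MeasureTheory.Measure 𝒟) [MeasureTheory.IsProbabilityMeasure ν]
    (w₀ : MixedTraining.Param d) :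
    -- the noise multiplier solves the accounting equation for `μ`
    (∀ T : ℕ, 0 < T → 0 < MixedTraining.noiseMultiplier n B μ T ∧
      μ = (B : ℝ) / n *
        √(T * (Real.exp (1 / MixedTraining.noiseMultiplier n B μ T ^ 2) - 1))) ∧
    -- mixed training with Poisson subsampling of the private data is asymptotically `μ`-GDP
    MixedTraining.AsymptoticallyGDP
      (fun T (S : MixedTraining.Dataset 𝒟) => MixedTraining.mixedTraining n B μ L L₀ ν l
        (MixedTraining.clippedGradientPoisson (MixedTraining.samplingRate B n hBn) S l) w₀ T) μ ∧
    -- the rate function is positive, increasing in the norm, invertible, and decreasing in `σ`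
    (∀ σ : ℝ, (∀ x : ℝ, 0 < x → 0 < MixedTraining.rateFun d B ξ L L₀ σ x) ∧
      StrictMonoOn (MixedTraining.rateFun d B ξ L L₀ σ) (Set.Ici 0) ∧
      Set.BijOn (MixedTraining.rateFun d B ξ L L₀ σ) (Set.Ici 0) (Set.Ici 0)) ∧
    (∀ x : ℝ, 0 < x →
      StrictAntiOn (fun σ => MixedTraining.rateFun d B ξ L L₀ σ x) (Set.Ici 0)) ∧
    -- the convergence bound, for every loss that satisfies the assumptions
    (∀ loss : MixedTraining.Param d → ℝ, (∀ w, 0 ≤ loss w) → loss w₀ = L₀ →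
      MixedTraining.SmoothLoss loss L → MixedTraining.GradientNoise ν l loss ξ →
      -- the private batches are Poisson subsamples of a dataset of `n` records
      (∀ s : Fin n → 𝒟, MixedTraining.GradientNoise (MixedTraining.empiricalLaw s) l loss ξ →
        MixedTraining.GradientNormBound d B ξ L L₀ (MixedTraining.noiseMultiplier n B μ) loss
          (MixedTraining.mixedTraining n B μ L L₀ ν l
            (MixedTraining.clippedGradientPoisson
              (MixedTraining.samplingRate B n hBn) ⟨n, s⟩ l) w₀)) ∧
      -- the private batches consist of `B` i.i.d. samples
      (∀ ρ : MeasureTheory.Measure 𝒟, MeasureTheory.IsProbabilityMeasure ρ →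
        MixedTraining.GradientNoise ρ l loss ξ →
        MixedTraining.GradientNormBound d B ξ L L₀ (MixedTraining.noiseMultiplier n B μ) loss
          (MixedTraining.mixedTraining n B μ L L₀ ν l
            (MixedTraining.clippedGradientIID B ρ l) w₀))) := by
  refine ⟨fun T hT => ⟨MixedTraining.noiseMultiplier_pos hB hBn hμ hT,
    MixedTraining.accounting hB hBn hμ hT⟩,
    MixedTraining.asymptoticallyGDP_mixedTraining hB hBn L L₀ hμ hlm ν w₀,
    fun σ => ⟨fun x hx => MixedTraining.rateFun_pos hL hL₀ hξ σ hx,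
      MixedTraining.rateFun_strictMonoOn hL hL₀ hξ σ, MixedTraining.rateFun_bijOn hL hL₀ hξ σ⟩,
    fun x hx => MixedTraining.rateFun_strictAntiOn hd hB hL hL₀ hξ hx,
    fun loss hnn hw₀ hsm hν => ⟨fun s hs => ?_, fun ρ hρ hρn => ?_⟩⟩
  · exact MixedTraining.gradientNormBound_of_moments hd hB hBn hμ hL hL₀ hξ hnn hsm hw₀
      (MixedTraining.measurable_publicGradient hlm B ν)
      (MixedTraining.measurable_clippedGradientPoisson hlm _ _)
      (MixedTraining.isProbabilityMeasure_publicGradient hlm B ν)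
      (MixedTraining.isProbabilityMeasure_clippedGradientPoisson _ _)
      (MixedTraining.publicGradient_moments hlm B hν)
      (MixedTraining.privateMoments_poisson hlm hB hBn s hξ hs)
  · exact MixedTraining.gradientNormBound_of_moments hd hB hBn hμ hL hL₀ hξ hnn hsm hw₀
      (MixedTraining.measurable_publicGradient hlm B ν)
      (MixedTraining.measurable_clippedGradientIID hlm B ρ)
      (MixedTraining.isProbabilityMeasure_publicGradient hlm B ν)
      (MixedTraining.isProbabilityMeasure_clippedGradientIID hlm B ρ)
      (MixedTraining.publicGradient_moments hlm B hν)
      (MixedTraining.privateMoments_iid hlm B hξ hρn)
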